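/- Call a finite simple graph a \emph{cluster graph} if each of its connected components is a clique. In the \textsc{Cluster Vertex Deletion} problem the input is a finite simple graph $G$ and an integer $k \ge 0$, and the task is to decide whether there is a set $S$ of at most $k$ vertices of $G$ such that $G - S$ is a cluster graph. \textbf{Theorem.} \textsc{Cluster Vertex Deletion} can be solved in $O^*(1.811^k)$ time. That is, there are a deterministic algorithm and a polynomial $p$ such that, for all integers $n, k \ge 0$ and every graph $G$ on $n$ vertices, the algorithm, given $G$ (as an adjacency matrix) and $k$, halts after at most $1.811^k \cdot p(n)$ elementary steps and answers correctly whether $G$ has a set $S$ of at most $k$ vertices for which $G - S$ is a cluster graph. (Algorithms are programs of a first-order list-processing language with recursive functions whose data are binary trees; each elementary operation, namely reading a variable, producing the empty tree, building a pair, testing for the empty tree and taking a pair apart, binding a local variable, or calling a function, counts as one step, and takes constant time on a random access machine.) -/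

import Mathlib

namespace ClusterVD

/-! ### The problem -/

/-- A cluster graph: every connected component is a clique. -/
def IsClusterGraph {V : Type*} (G : SimpleGraph V) : Prop :=
  ∀ C : G.ConnectedComponent, G.IsClique C.supp

/-- `S` is a cluster deletion set of `G`: deleting the vertices of `S` leaves a cluster graph. -/
def IsClusterDeletionSet {V : Type*} (G : SimpleGraph V) (S : Set V) : Prop :=
  IsClusterGraph (G.induce Sᶜ)

/-- The yes-instances of Cluster Vertex Deletion: some cluster deletion set has size at most `k`. -/
def ClusterVertexDeletion {V : Type*} (G : SimpleGraph V) (k : ℕ) : Prop :=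
  ∃ S : Finset V, S.card ≤ k ∧ IsClusterDeletionSet G (S : Set V)

/-! ### The model of computation

Algorithms are programs of a small deterministic list-processing language: first-order, call by
value, with recursive functions.  The only data are binary trees (Lisp cells).  Every elementary
operation (reading a variable, the constant `nil`, building a cell, testing for `nil` and taking a
cell apart, binding a local variable, calling a function) costs one step.  Values are passed by
reference, so each step takes a constant number of operations on a random access machine. -/

/-- Data: binary trees, built from the empty tree by pairing. -/
inductive Data : Type
  | nil : Data
  | cons : Data → Data → Data

/-- Expressions.  Local variables are de Bruijn indices into the current environment, functions
are referred to by their position in the program. -/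
inductive Expr : Type
  /-- the local variable with index `i` -/
  | var (i : ℕ) : Expr
  /-- the empty tree -/
  | nil : Expr
  /-- a new cell with components `a` and `b` -/
  | cons (a b : Expr) : Expr
  /-- evaluate `e`; continue with `a` if the value is `nil`, and with `b` if it is a cell,
  whose two components are then bound to the variables `0` and `1` -/
  | split (e a b : Expr) : Expr
  /-- evaluate `e`, bind its value to the variable `0`, and continue with `b` -/
  | bind (e b : Expr) : Expr
  /-- call the function with number `f` on the value of `e` -/
  | call (f : ℕ) (e : Expr) : Expr

/-- A program is a finite list of bodies of unary, possibly mutually recursive functions; the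
argument is the only variable of a body.  Execution starts with the function number `0`. -/
abbrev Program : Type := List Expr

/-- `Eval P ρ e v t`: under the program `P`, in the environment `ρ`, the evaluation of `e`
terminates with value `v` after exactly `t` steps. -/
inductive Eval (P : Program) : List Data → Expr → Data → ℕ → Prop
  | var {ρ : List Data} {i : ℕ} {v : Data} (h : ρ[i]? = some v) : Eval P ρ (.var i) v 1
  | nil {ρ : List Data} : Eval P ρ .nil .nil 1
  | cons {ρ : List Data} {a b : Expr} {x y : Data} {s t : ℕ}
      (ha : Eval P ρ a x s) (hb : Eval P ρ b y t) :
      Eval P ρ (.cons a b) (.cons x y) (s + t + 1)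
  | splitNil {ρ : List Data} {e a b : Expr} {v : Data} {s t : ℕ}
      (he : Eval P ρ e .nil s) (ha : Eval P ρ a v t) :
      Eval P ρ (.split e a b) v (s + t + 1)
  | splitCons {ρ : List Data} {e a b : Expr} {x y v : Data} {s t : ℕ}
      (he : Eval P ρ e (.cons x y) s) (hb : Eval P (x :: y :: ρ) b v t) :
      Eval P ρ (.split e a b) v (s + t + 1)
  | bind {ρ : List Data} {e b : Expr} {x v : Data} {s t : ℕ}
      (he : Eval P ρ e x s) (hb : Eval P (x :: ρ) b v t) :
      Eval P ρ (.bind e b) v (s + t + 1)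
  | call {ρ : List Data} {f : ℕ} {e body : Expr} {x v : Data} {s t : ℕ}
      (he : Eval P ρ e x s) (hf : P[f]? = some body) (hb : Eval P [x] body v t) :
      Eval P ρ (.call f e) v (s + t + 1)

/-- The language is deterministic: an evaluation has at most one value and one running time. -/
theorem Eval.deterministic {P : Program} {ρ : List Data} {e : Expr} {v w : Data} {s t : ℕ}
    (h : Eval P ρ e v s) (h' : Eval P ρ e w t) : v = w ∧ s = t := by
  induction h generalizing w t with
  | var h => cases h' with | var h2 => simp_all
  | nil => cases h'; simp
  | cons _ _ iha ihb =>
    cases h' with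
    | cons ha hb =>
      obtain ⟨rfl, rfl⟩ := iha ha
      obtain ⟨rfl, rfl⟩ := ihb hb
      simp
  | splitNil _ _ ihe iha =>
    cases h' with
    | splitNil he ha =>
      obtain ⟨_, rfl⟩ := ihe he
      obtain ⟨rfl, rfl⟩ := iha ha
      simp
    | splitCons he hb => simpa using (ihe he).1
  | splitCons _ _ ihe ihb =>
    cases h' with
    | splitNil he ha => simpa using (ihe he).1
    | splitCons he hb =>
      obtain ⟨h1, rfl⟩ := ihe he
      injection h1 with h1 h2
      subst h1 h2
      obtain ⟨rfl, rfl⟩ := ihb hb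
      simp
  | bind _ _ ihe ihb =>
    cases h' with
    | bind he hb =>
      obtain ⟨rfl, rfl⟩ := ihe he
      obtain ⟨rfl, rfl⟩ := ihb hb
      simp
  | call _ hf _ ihe ihb =>
    cases h' with
    | call he hf' hb =>
      obtain ⟨rfl, rfl⟩ := ihe he
      rw [hf] at hf'
      injection hf' with hf'
      subst hf'
      obtain ⟨rfl, rfl⟩ := ihb hb
      simp

/-- On input `x`, the program `P` halts with output `y` after exactly `t` steps. -/
def Program.HaltsWith (P : Program) (x y : Data) (t : ℕ) : Prop :=
  Eval P [x] (.call 0 (.var 0)) y t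

/-! ### Encoding of the instances -/

/-- Truth values: `nil` for false, the cell of two empty trees for true. -/
def Data.ofBool : Bool → Data
  | false => .nil
  | true => .cons .nil .nil

/-- Natural numbers, in unary. -/
def Data.ofNat : ℕ → Data
  | 0 => .nil
  | n + 1 => .cons .nil (Data.ofNat n)

/-- Lists, as linked lists of cells. -/
def Data.ofList : List Data → Data
  | [] => .nil
  | x :: l => .cons x (Data.ofList l)

open Classical in
/-- The adjacency matrix of a graph with vertices `0, …, n - 1`, as the list of its rows. -/
noncomputable def encodeGraph {n : ℕ} (G : SimpleGraph (Fin n)) : Data :=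
  .ofList ((List.finRange n).map fun i =>
    .ofList ((List.finRange n).map fun j => .ofBool (decide (G.Adj i j))))

/-- The instance `(G, k)`: the adjacency matrix of `G` paired with the number `k`. -/
noncomputable def encodeInstance {n : ℕ} (G : SimpleGraph (Fin n)) (k : ℕ) : Data :=
  .cons (encodeGraph G) (.ofNat k)

end ClusterVD

/-! A subproblem is a vertex set `A` with a budget `k`. A family of subsets covers `A` if, for every
cluster `B ⊆ A`, some member contains a cluster at least as large. Then `A` is solvable exactly if
some member is, its budget being lowered by the number of vertices it lacks. If the relative weight
`∑ γ ^ (|A| - |A'|)` is at most 1, where `γ = 1 / 1.811`, the sum of `1.811 ^ budget` does not grow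
from a set to its subproblems. A search with such families therefore takes polynomial time
multiplied by `1.811 ^ k`.

Families arise from keeping a vertex `v`. For a neighbour `u`, either `u` is deleted, or all its
conflicts are: the vertices that form an induced path with `v` and `u`. A single conflict may be
deleted outright, since `u` can take its place in any cluster (`Tree.covers`). Exchange arguments
supply the cases in which `v` may be kept or its twins deleted (`KeepFamily.covers`,
`RuleFamily.covers`).

The program makes no case distinction. It lists the families that all rules offer with trees of
depth at most 4, polynomially many, and takes the first whose weight passes a rounded test. The case
analysis only proves that a light family exists (`good_of_not_cluster`). Without one, every vertex
on an induced path has degree at least 3, no twin among its neighbours, and needs at least three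
vertices to hit the paths through it. For such a `v` of maximal degree, counting degrees shows that
each neighbour has at least as many conflicts inside the neighbourhood of `v` as outside. Keeping
`v` then costs at most `γ ^ 3 + 3 * γ ^ 4` (`Val.of_max_degree`) and deleting it costs `γ`. The
number 1.811 lies just above the root of `x ^ 4 = x ^ 3 + x + 3`, so the sum is below 1.

On the machine, one step of the search is polynomial by closure properties of `PolyTime`. Only the
search itself (`Eval.search`) and the reduction of the budget (`Eval.min`) are timed by hand. -/

namespace ClusterVD

set_option linter.unusedSectionVars false

/-! ### Branching rules and exchange arguments -/

section Covers

variable {V : Type*} [DecidableEq V] (G : SimpleGraph V) [DecidableRel G.Adj]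

/-- The three vertices are distinct and span exactly two edges. -/
def P3 (x y z : V) : Prop :=
  (G.Adj x y ∧ G.Adj y z ∧ ¬ G.Adj x z ∧ x ≠ z) ∨
  (G.Adj y z ∧ G.Adj z x ∧ ¬ G.Adj y x ∧ y ≠ x) ∨
  (G.Adj z x ∧ G.Adj x y ∧ ¬ G.Adj z y ∧ z ≠ y)

instance (x y z : V) : Decidable (P3 G x y z) := by unfold P3; infer_instance

variable {G}

theorem P3.rotate {x y z : V} (h : P3 G x y z) : P3 G y z x := by
  unfold P3 at *; tauto

theorem P3.swap {x y z : V} (h : P3 G x y z) : P3 G x z y := by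
  unfold P3 at *
  simp only [G.adj_comm x z, G.adj_comm y x, G.adj_comm z y, ne_comm] at *
  tauto

theorem P3.ne₁₂ {x y z : V} (h : P3 G x y z) : x ≠ y := by
  rintro rfl; unfold P3 at h; simp at h

theorem P3.ne₁₃ {x y z : V} (h : P3 G x y z) : x ≠ z := h.swap.ne₁₂

theorem P3.ne₂₃ {x y z : V} (h : P3 G x y z) : y ≠ z := h.rotate.ne₁₂

/-- A conflict is a vertex that tells the two ends of an edge apart, so an edge without conflicts
joins twins. -/
theorem p3_of_adj {v u z : V} (hvu : G.Adj v u) :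
    P3 G v u z ↔ z ≠ v ∧ z ≠ u ∧ ((G.Adj v z ∧ ¬ G.Adj u z) ∨ (¬ G.Adj v z ∧ G.Adj u z)) := by
  unfold P3
  have := hvu.symm
  simp only [G.adj_comm z v, G.adj_comm z u]
  constructor
  · rintro (h | h | h)
    · exact ⟨h.2.2.2.symm, h.2.1.ne', Or.inr ⟨h.2.2.1, h.2.1⟩⟩
    · exact absurd this h.2.2.1
    · exact ⟨h.1.ne', h.2.2.2, Or.inl ⟨h.1, h.2.2.1⟩⟩
  · rintro ⟨h1, h2, h | h⟩
    · exact Or.inr (Or.inr ⟨h.1, hvu, h.2, h2⟩)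
    · exact Or.inl ⟨hvu, h.2, h.1, h1.symm⟩

variable (G)

/-- The set spans a cluster graph. -/
def Cluster (B : Finset V) : Prop := ∀ x ∈ B, ∀ y ∈ B, ∀ z ∈ B, ¬ P3 G x y z

/-- The third vertices of the induced paths on three vertices through `v` and `u`. -/
def conflicts (A : Finset V) (v u : V) : Finset V := A.filter (P3 G v u)

/-- The vertices with the same closed neighbourhood as `v`. -/
def twins (A : Finset V) (v : V) : Finset V :=
  A.filter fun u => ∀ s ∈ A, (s = u ∨ G.Adj s u) ↔ (s = v ∨ G.Adj s v)

/-- No induced path on three vertices of `A` contains `v`. -/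
def Settled (A : Finset V) (v : V) : Prop := ∀ y ∈ A, ∀ z ∈ A, ¬ P3 G v y z

variable {G}

theorem mem_conflicts {A : Finset V} {v u z : V} :
    z ∈ conflicts G A v u ↔ z ∈ A ∧ P3 G v u z := by simp [conflicts]

theorem Cluster.subset {B C : Finset V} (h : Cluster G B) (hC : C ⊆ B) : Cluster G C :=
  fun x hx y hy z hz => h x (hC hx) y (hC hy) z (hC hz)

variable (G)

/-- Branching trees for solutions that keep `v`, of depth at most `L`, with the list of the vertex
sets that remain at the leaves. -/
inductive Tree (v : V) : ℕ → Finset V → List (Finset V) → Prop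
  | leaf (L : ℕ) (A : Finset V) : Tree v L A [A]
  | forced {L : ℕ} {A : Finset V} {F : List (Finset V)} {u : V} (hu : u ∈ A) (hvu : G.Adj v u)
      (h1 : (conflicts G A v u).card = 1) (hF : Tree v L (A \ conflicts G A v u) F) :
      Tree v (L + 1) A F
  | branch {L : ℕ} {A : Finset V} {F₁ F₂ : List (Finset V)} {u : V} (hu : u ∈ A)
      (hvu : G.Adj v u) (h₁ : Tree v L (A.erase u) F₁)
      (h₂ : Tree v L (A \ conflicts G A v u) F₂) : Tree v (L + 1) A (F₁ ++ F₂)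

/-- Some member of `F` contains a cluster at least as large as `B`. -/
def CoveredBy (F : List (Finset V)) (B : Finset V) : Prop :=
  ∃ A' ∈ F, ∃ B' ⊆ A', Cluster G B' ∧ B.card ≤ B'.card

variable {G}

theorem CoveredBy.mono {F F' : List (Finset V)} {B B' : Finset V} (h : CoveredBy G F B)
    (hF : F ⊆ F') (hB : B'.card ≤ B.card) : CoveredBy G F' B' := by
  obtain ⟨A', hA', C, hC, hC', hc⟩ := h
  exact ⟨A', hF hA', C, hC, hC', hB.trans hc⟩

/-- Relative to `B`, the new vertex is a twin of `v`, so an induced path through it would give one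
through `v`. -/
theorem cluster_insert {u v : V} {B : Finset V} (hB : Cluster G B) (hv : v ∈ B) (hu : u ∉ B)
    (h : ∀ s ∈ B, G.Adj u s ↔ (s = v ∨ G.Adj v s)) : Cluster G (insert u B) := by
  have key : ∀ s ∈ B, ∀ t ∈ B, ¬ P3 G u s t := by
    intro s hs t ht hp
    have h1 := h s hs
    have h2 := h t ht
    have h3 := hB v hv s hs t ht
    have h4 := hp.ne₁₂
    have h5 := hp.ne₁₃
    have h6 := hp.ne₂₃
    unfold P3 at hp h3
    simp only [G.adj_comm t u, G.adj_comm s u, G.adj_comm t v, G.adj_comm s v, G.adj_comm t s]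
      at hp h3 h1 h2
    by_cases hsv : s = v
    · subst hsv
      have : t ≠ s := h6.symm
      simp_all
    · by_cases htv : t = v
      · subst htv
        have e := G.adj_comm s t
        simp_all
        tauto
      · have : v ≠ s := Ne.symm hsv
        have : v ≠ t := Ne.symm htv
        have e := G.adj_comm s t
        simp only [hsv, htv, false_or] at h1 h2
        rw [h1, h2] at hp
        tauto
  intro x hx y hy z hz hp
  rw [Finset.mem_insert] at hx hy hz
  rcases hx with rfl | hx
  · exact key y (hy.resolve_left hp.ne₁₂.symm) z (hz.resolve_left hp.ne₁₃.symm) hp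
  rcases hy with rfl | hy
  · exact key z (hz.resolve_left hp.ne₂₃.symm) x hx hp.rotate
  rcases hz with rfl | hz
  · exact key x hx y hy hp.rotate.rotate
  · exact hB x hx y hy z hz hp

/-- The induction runs over all `B`, because a forced deletion may replace the cluster by another of
the same size. -/
theorem Tree.covers {v : V} {L : ℕ} {A : Finset V} {F : List (Finset V)} (h : Tree G v L A F)
    {B : Finset V} (hBA : B ⊆ A) (hv : v ∈ B) (hB : Cluster G B) : CoveredBy G F B := by
  induction h generalizing B with
  | leaf L A => exact ⟨A, by simp, B, hBA, hB, le_rfl⟩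
  | @forced L A F u hu hvu h1 hF ih =>
    obtain ⟨x, hx⟩ := Finset.card_eq_one.1 h1
    have hxc : x ∈ conflicts G A v u := by simp [hx]
    have hxP := (mem_conflicts.1 hxc).2
    by_cases hxB : x ∈ B
    · have huB : u ∉ B := fun huB => hB v hv u huB x hxB hxP
      have hvx : v ≠ x := hxP.ne₁₃
      -- Without `x`, the vertices `u` and `v` see the same part of `B`, so `u` can replace `x`.
      have hcl : Cluster G (insert u (B.erase x)) := by
        refine cluster_insert (v := v) (hB.subset (Finset.erase_subset _ _)) (by simp [hvx, hv])
          (by simp [huB]) ?_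
        intro s hs
        rw [Finset.mem_erase] at hs
        have hs' : ¬ P3 G v u s := by
          intro hp
          have : s ∈ conflicts G A v u := mem_conflicts.2 ⟨hBA hs.2, hp⟩
          rw [hx, Finset.mem_singleton] at this
          exact hs.1 this
        rw [p3_of_adj hvu] at hs'
        have hsu : s ≠ u := by rintro rfl; exact huB hs.2
        by_cases hsv : s = v
        · simp [hsv, hvu.symm]
        · simp only [ne_eq, hsv, not_false_eq_true, hsu, true_and, false_or] at hs' ⊢
          tauto
      refine (ih (B := insert u (B.erase x)) ?_ (by simp [hvx, hv]) hcl).mono (fun _ => id) ?_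
      · intro s hs
        rw [Finset.mem_insert, Finset.mem_erase] at hs
        rw [hx, Finset.mem_sdiff, Finset.mem_singleton]
        rcases hs with rfl | hs
        · exact ⟨hu, hxP.ne₂₃⟩
        · exact ⟨hBA hs.2, hs.1⟩
      · rw [Finset.card_insert_of_notMem (by simp [huB]), Finset.card_erase_add_one hxB]
    · refine ih (fun s hs => ?_) hv hB
      rw [hx, Finset.mem_sdiff, Finset.mem_singleton]
      exact ⟨hBA hs, by rintro rfl; exact hxB hs⟩
  | @branch L A F₁ F₂ u hu hvu h₁ h₂ ih₁ ih₂ =>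
    by_cases huB : u ∈ B
    · refine (ih₂ (fun s hs => ?_) hv hB).mono (List.subset_append_right _ _) le_rfl
      rw [Finset.mem_sdiff, mem_conflicts]
      exact ⟨hBA hs, fun hp => hB v hv u huB s hs hp.2⟩
    · refine (ih₁ (fun s hs => ?_) hv hB).mono (List.subset_append_left _ _) le_rfl
      exact Finset.mem_erase.2 ⟨by rintro rfl; exact huB hs, hBA hs⟩

theorem Tree.mono {v : V} {L L' : ℕ} {A : Finset V} {F : List (Finset V)} (h : Tree G v L A F)
    (hL : L ≤ L') : Tree G v L' A F := by
  induction h generalizing L' with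
  | leaf L A => exact .leaf L' A
  | forced hu hvu h1 hF ih =>
    obtain ⟨m, rfl⟩ := Nat.exists_eq_add_of_le' (Nat.one_le_of_lt hL)
    exact .forced hu hvu h1 (ih (by omega))
  | branch hu hvu h₁ h₂ ih₁ ih₂ =>
    obtain ⟨m, rfl⟩ := Nat.exists_eq_add_of_le' (Nat.one_le_of_lt hL)
    exact .branch hu hvu (ih₁ (by omega)) (ih₂ (by omega))

/-- If `v` lies in no induced path of `A \ X`, the component of `v` in `A \ X` can be kept. -/
theorem exists_cluster_exchange {A B X : Finset V} {v : V} (hv : v ∈ A) (hvX : v ∉ X)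
    (hS : Settled G (A \ X) v) (hBA : B ⊆ A) (hB : Cluster G B)
    (hc : (X ∩ B).card ≤ ((A.filter fun s => s ∉ X ∧ (s = v ∨ G.Adj v s)) \ B).card) :
    ∃ B' ⊆ A, v ∈ B' ∧ Cluster G B' ∧ B.card ≤ B'.card := by
  set C := A.filter fun s => s ∉ X ∧ (s = v ∨ G.Adj v s) with hC
  have hCm : ∀ s, s ∈ C ↔ s ∈ A ∧ s ∉ X ∧ (s = v ∨ G.Adj v s) := by simp [hC]
  have hstep : ∀ s t, s ∈ C → t ∈ A → t ∉ X → G.Adj s t → t ∈ C := by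
    intro s t hs ht htX hst
    rw [hCm] at hs ⊢
    refine ⟨ht, htX, ?_⟩
    rcases hs.2.2 with rfl | hvs
    · exact Or.inr hst
    · by_contra hcon
      push Not at hcon
      refine hS s (by simp [hs]) t (by simp [ht, htX]) ?_
      rw [p3_of_adj hvs]
      exact ⟨hcon.1, hst.ne', Or.inr ⟨hcon.2, hst⟩⟩
  have hclq : ∀ s t, s ∈ C → t ∈ C → s ≠ t → G.Adj s t := by
    intro s t hs ht hst
    rw [hCm] at hs ht
    rcases hs.2.2 with rfl | hvs
    · exact ht.2.2.resolve_left hst.symm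
    rcases ht.2.2 with rfl | hvt
    · exact hvs.symm
    by_contra hcon
    refine hS s (by simp [hs]) t (by simp [ht]) ?_
    rw [p3_of_adj hvs]
    exact ⟨hvt.ne', hst.symm, Or.inl ⟨hvt, hcon⟩⟩
  have hB'A : ∀ s ∈ (B \ X) ∪ C, s ∈ A ∧ s ∉ X := by
    intro s hs
    rw [Finset.mem_union, Finset.mem_sdiff, hCm] at hs
    rcases hs with hs | hs
    · exact ⟨hBA hs.1, hs.2⟩
    · exact ⟨hs.1, hs.2.1⟩
  -- `C` is the component of `v` outside `X`, a clique. Passing from `B` to this set loses `X ∩ B`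
  -- and gains `C \ B`.
  refine ⟨(B \ X) ∪ C, fun s hs => (hB'A s hs).1, ?_, ?_, ?_⟩
  · simp [hCm, hv, hvX]
  · have key : ∀ x ∈ (B \ X) ∪ C, ∀ y ∈ (B \ X) ∪ C, ∀ z ∈ (B \ X) ∪ C,
        ¬ (G.Adj x y ∧ G.Adj y z ∧ ¬ G.Adj x z ∧ x ≠ z) := by
      rintro x hx y hy z hz ⟨hxy, hyz, hxz, hne⟩
      have hx' := hB'A x hx
      have hy' := hB'A y hy
      have hz' := hB'A z hz
      by_cases hyC : y ∈ C
      · exact hxz (hclq x z (hstep y x hyC hx'.1 hx'.2 hxy.symm)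
          (hstep y z hyC hz'.1 hz'.2 hyz) hne)
      · have hxC : x ∉ C := fun h => hyC (hstep x y h hy'.1 hy'.2 hxy)
        have hzC : z ∉ C := fun h => hyC (hstep z y h hy'.1 hy'.2 hyz.symm)
        simp only [Finset.mem_union, hxC, hyC, hzC, or_false, Finset.mem_sdiff] at hx hy hz
        exact hB x hx.1 y hy.1 z hz.1 (Or.inl ⟨hxy, hyz, hxz, hne⟩)
    intro x hx y hy z hz hp
    rcases hp with h | h | h
    · exact key x hx y hy z hz h
    · exact key y hy z hz x hx h
    · exact key z hz x hx y hy h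
  · have h1 : B.card = (X ∩ B).card + (B \ X).card := by
      rw [Finset.inter_comm, Finset.card_inter_add_card_sdiff]
    have h2 : ((B \ X) ∪ (C \ B)).card = (B \ X).card + (C \ B).card := by
      apply Finset.card_union_of_disjoint
      rw [Finset.disjoint_left]
      intro s hs hs'
      simp_all
    have h3 : ((B \ X) ∪ (C \ B)).card ≤ ((B \ X) ∪ C).card :=
      Finset.card_le_card (Finset.union_subset_union_right Finset.sdiff_subset)
    omega

theorem mem_twins {A : Finset V} {u v : V} :
    u ∈ twins G A v ↔ u ∈ A ∧ ∀ s ∈ A, (s = u ∨ G.Adj s u) ↔ (s = v ∨ G.Adj s v) := by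
  simp [twins]

theorem mem_twins_self {A : Finset V} {v : V} (hv : v ∈ A) : v ∈ twins G A v := by
  simp [twins, hv]

theorem exists_cluster_of_twin {A B : Finset V} {u v : V} (hv : v ∈ A) (hBA : B ⊆ A)
    (hB : Cluster G B) (hu : u ∈ twins G A v) (huB : u ∈ B) :
    ∃ B' ⊆ A, v ∈ B' ∧ Cluster G B' ∧ B.card ≤ B'.card := by
  by_cases hvB : v ∈ B
  · exact ⟨B, hBA, hvB, hB, le_rfl⟩
  · refine ⟨insert v B, Finset.insert_subset hv hBA, by simp, ?_,
      Finset.card_le_card (Finset.subset_insert _ _)⟩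
    refine cluster_insert hB huB hvB fun s hs => ?_
    have := (mem_twins.1 hu).2 s (hBA hs)
    have hsv : s ≠ v := by rintro rfl; exact hvB hs
    rw [G.adj_comm v s, G.adj_comm u s, this]
    simp [hsv]

variable (G)

/-- Families for a vertex `v` that can be kept because it has at least as many twins as
vertices are needed to separate it. -/
def KeepFamily (L : ℕ) (A : Finset V) (F : List (Finset V)) : Prop :=
  ∃ v ∈ A, ∃ x ∈ A, ∃ y ∈ A, v ≠ x ∧ v ≠ y ∧ Settled G (A \ {x, y}) v ∧
    ({x, y} : Finset V).card ≤ (twins G A v).card ∧ Tree G v L A F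

/-- The families of remaining vertex sets that the branching rules offer. -/
def RuleFamily (L : ℕ) (A : Finset V) (F : List (Finset V)) : Prop :=
  KeepFamily G L A F ∨
  (∃ v ∈ A, ∃ F', Tree G v L A F' ∧ F = (A \ twins G A v) :: F') ∨
  (∃ v ∈ A, ∃ a ∈ A, ∃ b ∈ A, v ≠ a ∧ v ≠ b ∧ Settled G (A \ {a, b}) v ∧ ∃ F', Tree G v L A F' ∧
    F = ((A.erase v) \ conflicts G A a b) :: F') ∨
  (∃ w ∈ A, ∃ F₁ F₂, KeepFamily G L (A.erase w) F₁ ∧ Tree G w L A F₂ ∧ F = F₁ ++ F₂)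

variable {G}

/-- If `B` contains a twin of `v`, then `v` can be added. Otherwise all twins outside the separator
`X` are a gain, and they outnumber what is lost: `|X ∩ B| ≤ |X \ T| ≤ |T \ X|` for the set `T` of
twins. -/
theorem KeepFamily.covers {L : ℕ} {A B : Finset V} {F : List (Finset V)}
    (h : KeepFamily G L A F) (hBA : B ⊆ A) (hB : Cluster G B) : CoveredBy G F B := by
  obtain ⟨v, hv, x, hx, y, hy, hvx, hvy, hS, hc, hT⟩ := h
  have : ∃ B' ⊆ A, v ∈ B' ∧ Cluster G B' ∧ B.card ≤ B'.card := by
    by_cases hex : ∃ u ∈ twins G A v, u ∈ B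
    · obtain ⟨u, hu, huB⟩ := hex
      exact exists_cluster_of_twin hv hBA hB hu huB
    · push Not at hex
      refine exists_cluster_exchange hv (by simp [hvx, hvy]) hS hBA hB ?_
      set X : Finset V := {x, y}
      set T := twins G A v
      have h1 : (X ∩ B).card ≤ (X \ T).card := by
        refine Finset.card_le_card fun s hs => ?_
        rw [Finset.mem_inter] at hs
        exact Finset.mem_sdiff.2 ⟨hs.1, fun h => hex s h hs.2⟩
      have h2 : (X \ T).card ≤ (T \ X).card :=
        Finset.card_sdiff_le_card_sdiff_iff.2 hc
      refine h1.trans (h2.trans (Finset.card_le_card fun s hs => ?_))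
      rw [Finset.mem_sdiff] at hs
      have h3 := mem_twins.1 hs.1
      have h4 := (h3.2 v hv).2 (Or.inl rfl)
      simp only [Finset.mem_sdiff, Finset.mem_filter]
      refine ⟨⟨h3.1, hs.2, ?_⟩, hex s hs.1⟩
      rcases h4 with h4 | h4
      · exact Or.inl h4.symm
      · exact Or.inr h4
  obtain ⟨B', hB'A, hvB', hB', hle⟩ := this
  exact (hT.covers hB'A hvB' hB').mono (fun _ => id) hle

theorem RuleFamily.covers {L : ℕ} {A B : Finset V} {F : List (Finset V)}
    (h : RuleFamily G L A F) (hBA : B ⊆ A) (hB : Cluster G B) : CoveredBy G F B := by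
  have tail : ∀ (A₀ : Finset V) (F' : List (Finset V)) (v : V), Tree G v L A F' →
      (∃ B' ⊆ A, v ∈ B' ∧ Cluster G B' ∧ B.card ≤ B'.card) → CoveredBy G (A₀ :: F') B := by
    rintro A₀ F' v hT ⟨B', hB'A, hvB', hB', hle⟩
    exact (hT.covers hB'A hvB' hB').mono (List.subset_cons_self _ _) hle
  rcases h with h | ⟨v, hv, F', hT, rfl⟩ | ⟨v, hv, a, ha, b, hb, hva, hvb, hS, F', hT, rfl⟩ |
    ⟨w, hw, F₁, F₂, hK, hT, rfl⟩
  · exact h.covers hBA hB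
  · by_cases hex : ∃ u ∈ twins G A v, u ∈ B
    · obtain ⟨u, hu, huB⟩ := hex
      exact tail _ _ _ hT (exists_cluster_of_twin hv hBA hB hu huB)
    · push Not at hex
      exact ⟨_, List.mem_cons_self, B,
        fun s hs => Finset.mem_sdiff.2 ⟨hBA hs, fun h => hex s h hs⟩, hB, le_rfl⟩
  · by_cases hvB : v ∈ B
    · exact tail _ _ _ hT ⟨B, hBA, hvB, hB, le_rfl⟩
    -- If `B` lacks `v` and one of `a`, `b`, adding `v` with its component pays for the other. So
    -- `v` is lost only when both `a` and `b` are kept, and then their conflicts go too.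
    · by_cases hab : a ∈ B ∧ b ∈ B
      · refine ⟨_, List.mem_cons_self, B, fun s hs => ?_, hB, le_rfl⟩
        rw [Finset.mem_sdiff, Finset.mem_erase, mem_conflicts]
        exact ⟨⟨by rintro rfl; exact hvB hs, hBA hs⟩, fun h => hB a hab.1 b hab.2 s hs h.2⟩
      · refine tail _ _ _ hT (exists_cluster_exchange hv (by simp [hva, hvb]) hS hBA hB ?_)
        have h1 : (({a, b} : Finset V) ∩ B).card ≤ 1 := by
          rw [Finset.card_le_one]
          intro s hs t ht
          simp only [Finset.mem_inter, Finset.mem_insert, Finset.mem_singleton] at hs ht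
          rcases hs with ⟨rfl | rfl, hs⟩ <;> rcases ht with ⟨rfl | rfl, ht⟩ <;> tauto
        refine h1.trans (Finset.card_pos.2 ⟨v, ?_⟩)
        simp [hv, hva, hvb, hvB]
  · by_cases hwB : w ∈ B
    · exact (hT.covers hBA hwB hB).mono (List.subset_append_right _ _) le_rfl
    · refine (hK.covers (fun s hs => ?_) hB).mono (List.subset_append_left _ _) le_rfl
      exact Finset.mem_erase.2 ⟨by rintro rfl; exact hwB hs, hBA hs⟩

end Covers

/-! ### Relative weights of branching trees -/

section Weights

variable {V : Type*} [DecidableEq V] {G : SimpleGraph V} [DecidableRel G.Adj]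

/-- The inverse of the growth rate. -/
noncomputable def γ : ℝ := 1000 / 1811

/-- The total weight of the vertex sets of a family. -/
noncomputable def weight (F : List (Finset V)) : ℝ := (F.map fun A => (1.811 : ℝ) ^ A.card).sum

theorem weight_cons (A : Finset V) (F : List (Finset V)) :
    weight (A :: F) = (1.811 : ℝ) ^ A.card + weight F := by simp [weight]

theorem weight_append (F₁ F₂ : List (Finset V)) : weight (F₁ ++ F₂) = weight F₁ + weight F₂ := by
  simp [weight]

theorem pow_card_sdiff {A D : Finset V} {h : ℕ} (hD : D ⊆ A) (hc : h ≤ D.card) :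
    (1.811 : ℝ) ^ (A \ D).card ≤ γ ^ h * (1.811 : ℝ) ^ A.card := by
  have h1 : A.card = (A \ D).card + D.card := by
    rw [Finset.card_sdiff_add_card_eq_card hD]
  have h2 : (1.811 : ℝ) ^ ((A \ D).card + h) ≤ 1.811 ^ A.card :=
    pow_le_pow_right₀ (by norm_num) (by omega)
  have h3 : γ ^ h * (1.811 : ℝ) ^ h = 1 := by rw [← mul_pow]; norm_num [γ]
  have h4 : 0 < γ ^ h := by unfold γ; positivity
  calc (1.811 : ℝ) ^ (A \ D).card = γ ^ h * (1.811 : ℝ) ^ ((A \ D).card + h) := by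
        rw [pow_add, mul_comm ((1.811 : ℝ) ^ (A \ D).card), ← mul_assoc, h3, one_mul]
    _ ≤ _ := by gcongr

variable (G)

/-- There is a branching tree for `v` on `A` whose leaves have relative weight at most `q`. -/
def Val (v : V) (L : ℕ) (A : Finset V) (q : ℝ) : Prop :=
  ∃ F, Tree G v L A F ∧ weight F ≤ q * (1.811 : ℝ) ^ A.card

/-- Fewer than `j` vertices do not meet all induced paths through `v`. -/
def Hit (A : Finset V) (v : V) (j : ℕ) : Prop :=
  ∀ X : Finset V, X.card < j → ∃ y ∈ A, ∃ z ∈ A, y ∉ X ∧ z ∉ X ∧ P3 G v y z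

variable {G}

theorem Val.mono {v : V} {L L' : ℕ} {A : Finset V} {q q' : ℝ} (h : Val G v L A q) (hq : q ≤ q')
    (hL : L ≤ L') : Val G v L' A q' := by
  obtain ⟨F, hF, hw⟩ := h
  exact ⟨F, hF.mono hL, hw.trans (by gcongr)⟩

theorem Val.leaf {v : V} (L : ℕ) (A : Finset V) : Val G v L A 1 :=
  ⟨[A], .leaf L A, by simp [weight]⟩

theorem conflicts_subset {A : Finset V} {v u : V} : conflicts G A v u ⊆ A :=
  Finset.filter_subset _ _

theorem Val.forced {v u : V} {L : ℕ} {A : Finset V} {q q' : ℝ} (hu : u ∈ A) (hvu : G.Adj v u)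
    (h1 : (conflicts G A v u).card = 1) (h : Val G v L (A \ conflicts G A v u) q)
    (hq0 : 0 ≤ q) (hq : γ * q ≤ q') : Val G v (L + 1) A q' := by
  obtain ⟨F, hF, hw⟩ := h
  refine ⟨F, .forced hu hvu h1 hF, hw.trans ?_⟩
  have := pow_card_sdiff (conflicts_subset (G := G) (A := A) (v := v) (u := u)) h1.ge
  calc _ ≤ q * (γ ^ 1 * (1.811 : ℝ) ^ A.card) := by gcongr
    _ = γ * q * (1.811 : ℝ) ^ A.card := by ring
    _ ≤ _ := by gcongr

theorem Val.branch {v u : V} {L h : ℕ} {A : Finset V} {q₁ q₂ q' : ℝ} (hu : u ∈ A)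
    (hvu : G.Adj v u) (hh : h ≤ (conflicts G A v u).card) (h₁ : Val G v L (A.erase u) q₁)
    (h₂ : Val G v L (A \ conflicts G A v u) q₂) (hq₁ : 0 ≤ q₁) (hq₂ : 0 ≤ q₂)
    (hq : γ * q₁ + γ ^ h * q₂ ≤ q') : Val G v (L + 1) A q' := by
  obtain ⟨F₁, hF₁, hw₁⟩ := h₁
  obtain ⟨F₂, hF₂, hw₂⟩ := h₂
  refine ⟨F₁ ++ F₂, .branch hu hvu hF₁ hF₂, ?_⟩
  have e₂ := pow_card_sdiff (conflicts_subset (G := G) (A := A) (v := v) (u := u)) hh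
  have e₁ := pow_card_sdiff (A := A) (D := {u}) (h := 1) (by simpa using hu) (by simp)
  rw [Finset.sdiff_singleton_eq_erase] at e₁
  rw [weight_append]
  calc _ ≤ q₁ * (γ ^ 1 * (1.811 : ℝ) ^ A.card) + q₂ * (γ ^ h * (1.811 : ℝ) ^ A.card) := by
        refine add_le_add (hw₁.trans ?_) (hw₂.trans ?_) <;> gcongr
    _ = (γ * q₁ + γ ^ h * q₂) * (1.811 : ℝ) ^ A.card := by ring
    _ ≤ _ := by gcongr

theorem Hit.mono {A : Finset V} {v : V} {i j : ℕ} (h : Hit G A v j) (hij : i ≤ j) :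
    Hit G A v i := fun X hX => h X (by omega)

/-- A set that hits the remaining paths, together with `D`, hits them all. Hence a large hitting
number guarantees that the tree can branch again after deletions. -/
theorem Hit.sdiff {A : Finset V} {v : V} {i j : ℕ} (h : Hit G A v j) (D : Finset V)
    (hD : D.card + i ≤ j) : Hit G (A \ D) v i := by
  intro X hX
  obtain ⟨y, hy, z, hz, hyX, hzX, hp⟩ := h (X ∪ D) (by
    have := Finset.card_union_le X D
    omega)
  simp only [Finset.mem_union, not_or] at hyX hzX
  exact ⟨y, by simp [hy, hyX.2], z, by simp [hz, hzX.2], hyX.1, hzX.1, hp⟩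

theorem Hit.erase {A : Finset V} {v : V} {i j : ℕ} (h : Hit G A v j) (u : V) (hD : 1 + i ≤ j) :
    Hit G (A.erase u) v i := by
  rw [← Finset.sdiff_singleton_eq_erase]
  exact h.sdiff _ (by simpa using hD)

theorem hit_one_of_p3 {A : Finset V} {v y z : V} (hy : y ∈ A) (hz : z ∈ A) (hp : P3 G v y z) :
    Hit G A v 1 := by
  intro X hX
  have : X = ∅ := by simpa using hX
  exact ⟨y, hy, z, hz, by simp [this], by simp [this], hp⟩

/-- Some neighbour of `v` is in conflict with another vertex. -/
theorem Hit.exists_conflict {A : Finset V} {v : V} (h : Hit G A v 1) :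
    ∃ u ∈ A, G.Adj v u ∧ 1 ≤ (conflicts G A v u).card := by
  obtain ⟨y, hy, z, hz, -, -, hp⟩ := h ∅ (by simp)
  by_cases hvy : G.Adj v y
  · exact ⟨y, hy, hvy, Finset.card_pos.2 ⟨z, mem_conflicts.2 ⟨hz, hp⟩⟩⟩
  · have hvz : G.Adj v z := by
      unfold P3 at hp
      rw [G.adj_comm v z]
      tauto
    exact ⟨z, hz, hvz, Finset.card_pos.2 ⟨y, mem_conflicts.2 ⟨hy, hp.swap⟩⟩⟩

/-- The worst case is a branch with exactly two conflicts; a forced deletion costs only `γ`. The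
next two lemmas repeat this while the hitting number lasts. -/
theorem Val.of_hit_one {A : Finset V} {v : V} (h : Hit G A v 1) : Val G v 1 A (γ + γ ^ 2) := by
  obtain ⟨u, hu, hvu, hc⟩ := h.exists_conflict
  rcases hc.eq_or_lt with hc | hc
  · exact .forced hu hvu hc.symm (.leaf 0 _) (by norm_num) (by norm_num [γ])
  · exact .branch hu hvu hc (.leaf 0 _) (.leaf 0 _) (by norm_num) (by norm_num) (by norm_num)

theorem Val.of_hit_two {A : Finset V} {v : V} (h : Hit G A v 2) :
    Val G v 2 A (γ * (γ + γ ^ 2) + γ ^ 2) := by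
  obtain ⟨u, hu, hvu, hc⟩ := (h.mono one_le_two).exists_conflict
  rcases hc.eq_or_lt with hc | hc
  · exact .forced hu hvu hc.symm (.of_hit_one (h.sdiff _ (by omega))) (by norm_num [γ])
      (by norm_num [γ])
  · exact .branch hu hvu hc (.of_hit_one (h.erase u le_rfl)) (.leaf 1 _) (by norm_num [γ])
      (by norm_num) (by norm_num)

/-- With two conflicts, a path survives on both sides of the branch. With three or more, the side
that deletes them can stop, because `γ ^ 3` is already less than `γ ^ 2 * (γ + γ ^ 2)`. -/
theorem Val.of_hit_three {A : Finset V} {v : V} (h : Hit G A v 3) :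
    Val G v 3 A (γ * (γ * (γ + γ ^ 2) + γ ^ 2) + γ ^ 2 * (γ + γ ^ 2)) := by
  obtain ⟨u, hu, hvu, hc⟩ := (h.mono (by norm_num)).exists_conflict
  rcases hc.eq_or_lt with hc | hc
  · exact .forced hu hvu hc.symm (.of_hit_two (h.sdiff _ (by omega))) (by norm_num [γ])
      (by norm_num [γ])
  rcases (Nat.succ_le_of_lt hc).eq_or_lt with hc | hc
  · exact .branch hu hvu hc.le (.of_hit_two (h.erase u le_rfl))
      ((Val.of_hit_one (h.sdiff _ (by omega))).mono le_rfl one_le_two) (by norm_num [γ])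
      (by norm_num [γ]) le_rfl
  · exact .branch hu hvu (Nat.succ_le_of_lt hc) (.of_hit_two (h.erase u le_rfl)) (.leaf 2 _)
      (by norm_num [γ]) (by norm_num) (by norm_num [γ])

/-- A branch on a vertex with three conflicts. -/
theorem Val.of_three_conflicts {A : Finset V} {v u : V} (h : Hit G A v 2) (hu : u ∈ A)
    (hvu : G.Adj v u) (hc : 3 ≤ (conflicts G A v u).card) :
    Val G v 2 A (γ ^ 3 + γ * (γ + γ ^ 2)) :=
  .branch hu hvu hc (.of_hit_one (h.erase u le_rfl)) (.leaf 1 _) (by norm_num [γ]) (by norm_num)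
    (by norm_num [γ])

theorem conflicts_sdiff {A D : Finset V} {v u : V} :
    conflicts G (A \ D) v u = conflicts G A v u \ D := by
  ext; simp only [mem_conflicts, Finset.mem_sdiff]; tauto

theorem conflicts_erase {A : Finset V} {v u x : V} :
    conflicts G (A.erase x) v u = (conflicts G A v u).erase x := by
  ext; simp only [mem_conflicts, Finset.mem_erase]; tauto

/-- A branch on `x`, after which the other conflict of `y` is forced. -/
theorem Val.of_two_conflicts {L : ℕ} {A : Finset V} {v x y : V} {q : ℝ} (hx : x ∈ A)
    (hy : y ∈ A) (hvx : G.Adj v x) (hvy : G.Adj v y) (hxy : y ∈ conflicts G A v x)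
    (hcx : 2 ≤ (conflicts G A v x).card) (hcy : (conflicts G A v y).card = 2) (hq : 0 ≤ q)
    (h₁ : Val G v L (A.erase x \ conflicts G (A.erase x) v y) q)
    (h₂ : Val G v (L + 1) (A \ conflicts G A v x) q) : Val G v (L + 2) A (2 * γ ^ 2 * q) := by
  have hp := (mem_conflicts.1 hxy).2
  have hx' : x ∈ conflicts G A v y := mem_conflicts.2 ⟨hx, hp.swap⟩
  refine .branch hx hvx hcx (.forced (Finset.mem_erase.2 ⟨hp.ne₂₃.symm, hy⟩) hvy ?_ h₁ hq le_rfl)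
    h₂ (mul_nonneg (by norm_num [γ]) hq) hq (by ring_nf; rfl)
  rw [conflicts_erase, Finset.card_erase_of_mem hx', hcy]

end Weights

/-! ### Keeping a vertex of maximal degree -/

section MaxDegree

variable {V : Type*} [DecidableEq V] (G : SimpleGraph V) [DecidableRel G.Adj]

/-- The neighbours of `v` in `A`. -/
def nbrs (A : Finset V) (v : V) : Finset V := A.filter (G.Adj v)

/-- The conflicts of `u` that are neighbours of `v`. -/
def inner (A : Finset V) (v u : V) : Finset V := (conflicts G A v u).filter (G.Adj v)

/-- The conflicts of `u` that are not neighbours of `v`. -/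
def outer (A : Finset V) (v u : V) : Finset V := (conflicts G A v u).filter (¬ G.Adj v ·)

variable {G}

theorem mem_nbrs {A : Finset V} {v u : V} : u ∈ nbrs G A v ↔ u ∈ A ∧ G.Adj v u := by
  simp [nbrs]

theorem mem_inner {A : Finset V} {v u z : V} :
    z ∈ inner G A v u ↔ (z ∈ A ∧ P3 G v u z) ∧ G.Adj v z := by
  simp [inner, mem_conflicts]

theorem mem_outer {A : Finset V} {v u z : V} :
    z ∈ outer G A v u ↔ (z ∈ A ∧ P3 G v u z) ∧ ¬ G.Adj v z := by
  simp [outer, mem_conflicts]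

theorem card_inner_add_card_outer {A : Finset V} {v u : V} :
    (inner G A v u).card + (outer G A v u).card = (conflicts G A v u).card :=
  Finset.card_filter_add_card_filter_not _

theorem inner_symm {A : Finset V} {v u z : V} (hu : u ∈ A) (hvu : G.Adj v u)
    (hz : z ∈ inner G A v u) : u ∈ inner G A v z :=
  mem_inner.2 ⟨⟨hu, (mem_inner.1 hz).1.2.swap⟩, hvu⟩

theorem conflicts_mono {A A' : Finset V} {v u : V} (h : A' ⊆ A) :
    conflicts G A' v u ⊆ conflicts G A v u := Finset.filter_subset_filter _ h

theorem outer_mono {A A' : Finset V} {v u : V} (h : A' ⊆ A) :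
    outer G A' v u ⊆ outer G A v u := Finset.filter_subset_filter _ (conflicts_mono h)

/-- The neighbourhood of `u` arises from that of `v` by exchanging `u` and its inner conflicts for
`v` and the outer conflicts. If the degree of `v` is maximal, outer conflicts are therefore at most
as many as inner ones. -/
theorem card_nbrs_add_card_inner {A : Finset V} {v u : V} (hv : v ∈ A) (hu : u ∈ A)
    (hvu : G.Adj v u) :
    (nbrs G A u).card + (inner G A v u).card = (nbrs G A v).card + (outer G A v u).card := by
  have h1 : nbrs G A u = (nbrs G A v \ insert u (inner G A v u)) ∪ insert v (outer G A v u) := by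
    ext s
    simp only [mem_nbrs, Finset.mem_union, Finset.mem_sdiff, Finset.mem_insert, mem_inner,
      mem_outer, p3_of_adj hvu]
    by_cases hsv : s = v
    · subst hsv; simp [hv, hvu.symm]
    by_cases hsu : s = u
    · subst hsu; simp [hsv, hvu]
    simp only [hsv, hsu, ne_eq, not_false_eq_true, true_and, false_or]
    tauto
  have h2 : Disjoint (nbrs G A v \ insert u (inner G A v u)) (insert v (outer G A v u)) := by
    rw [Finset.disjoint_left]
    intro s hs hs'
    simp only [mem_nbrs, Finset.mem_sdiff, Finset.mem_insert, mem_outer] at hs hs'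
    rcases hs' with rfl | hs'
    · exact G.loopless.irrefl _ hs.1.2
    · exact hs'.2 hs.1.2
  have h3 : insert u (inner G A v u) ⊆ nbrs G A v := by
    intro s hs
    rw [Finset.mem_insert, mem_inner] at hs
    rw [mem_nbrs]
    rcases hs with rfl | hs
    · exact ⟨hu, hvu⟩
    · exact ⟨hs.1.1, hs.2⟩
  have h4 : u ∉ inner G A v u := fun h => (mem_inner.1 h).1.2.ne₂₃ rfl
  have h5 : v ∉ outer G A v u := fun h => (mem_outer.1 h).1.2.ne₁₃ rfl
  have h6 := Finset.card_sdiff_add_card_eq_card h3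
  rw [h1, Finset.card_union_of_disjoint h2, Finset.card_insert_of_notMem h5]
  rw [Finset.card_insert_of_notMem h4] at h6
  omega

/-- One round costs a factor of at most `2 * γ ^ 2`, the value of two branches with two deletions
each. A forced deletion is cheaper. If there is none, a vertex with two conflicts has an inner one,
which also has exactly two, so deleting the first forces a second deletion. -/
theorem Val.of_low_conflicts {L : ℕ} {A : Finset V} {v : V} {q : ℝ} (h : Hit G A v 1)
    (hP : ∀ u ∈ A, G.Adj v u → (conflicts G A v u).card ≤ 2 ∧ (outer G A v u).card ≤ 1)
    (hrest : ∀ D : Finset V, D.card ≤ 2 → Val G v L (A \ D) q) (hq : 0 ≤ q) :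
    Val G v (L + 2) A (2 * γ ^ 2 * q) := by
  by_cases h1 : ∃ u ∈ A, G.Adj v u ∧ (conflicts G A v u).card = 1
  · obtain ⟨u, hu, hvu, hc⟩ := h1
    refine (Val.forced hu hvu hc (hrest _ (by omega)) hq le_rfl).mono ?_ (by omega)
    gcongr
    norm_num [γ]
  · push Not at h1
    obtain ⟨x, hx, hvx, hcx⟩ := h.exists_conflict
    have e1 := hP x hx hvx
    have e2 := h1 x hx hvx
    have e3 := card_inner_add_card_outer (G := G) (A := A) (v := v) (u := x)
    obtain ⟨y, hy⟩ : (inner G A v x).Nonempty := Finset.card_pos.1 (by omega)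
    have hyx := inner_symm hx hvx hy
    obtain ⟨⟨hyA, hp⟩, hvy⟩ := mem_inner.1 hy
    have e4 := hP y hyA hvy
    have e5 := h1 y hyA hvy
    have e6 : 0 < (conflicts G A v y).card :=
      Finset.card_pos.2 ⟨x, mem_conflicts.2 ⟨hx, hp.swap⟩⟩
    refine .of_two_conflicts hx hyA hvx hvy (mem_conflicts.2 ⟨hyA, hp⟩) (by omega) (by omega) hq
      ?_ ((hrest _ (by omega)).mono le_rfl (by omega))
    rw [← Finset.sdiff_singleton_eq_erase, sdiff_sdiff, conflicts_sdiff]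
    refine hrest _ ((Finset.card_union_le _ _).trans ?_)
    rw [Finset.sdiff_singleton_eq_erase, Finset.card_erase_of_mem
      (mem_conflicts.2 ⟨hx, hp.swap⟩), Finset.card_singleton]
    omega

/-- Four conflicts make their side so light that `γ ^ 2 + 2 * γ ^ 3` suffices after the deletion of
`u`. The only obstacle would be a vertex left with two conflicts, both outer. In `A` its only inner
conflict could be `u`, against `hb`. -/
theorem Val.of_four_conflicts {A : Finset V} {v u : V} (hH : Hit G A v 3)
    (hb : ∀ u ∈ A, G.Adj v u → (outer G A v u).card ≤ (inner G A v u).card) (hu : u ∈ A)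
    (hvu : G.Adj v u) (hc : 4 ≤ (conflicts G A v u).card) :
    Val G v 4 A (γ ^ 3 + 3 * γ ^ 4) := by
  have hH1 : Hit G (A.erase u) v 2 := hH.erase u le_rfl
  suffices Val G v 3 (A.erase u) (γ ^ 2 + 2 * γ ^ 3) from
    .branch hu hvu hc this (.leaf 3 _) (by norm_num [γ]) (by norm_num) (by ring_nf; rfl)
  by_cases h1 : ∃ x ∈ A.erase u, G.Adj v x ∧ (conflicts G (A.erase u) v x).card = 1
  · obtain ⟨x, hx, hvx, hcx⟩ := h1
    exact .forced hx hvx hcx (.leaf 2 _) (by norm_num) (by norm_num [γ])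
  by_cases h3 : ∃ x ∈ A.erase u, G.Adj v x ∧ 3 ≤ (conflicts G (A.erase u) v x).card
  · obtain ⟨x, hx, hvx, hcx⟩ := h3
    exact (Val.of_three_conflicts hH1 hx hvx hcx).mono (by ring_nf; rfl) (by norm_num)
  push Not at h1 h3
  obtain ⟨x, hx, hvx, hcx⟩ := (hH1.mono one_le_two).exists_conflict
  have e1 := h1 x hx hvx
  have e2 := h3 x hx hvx
  have e3 := card_inner_add_card_outer (G := G) (A := A.erase u) (v := v) (u := x)
  by_cases hin : (inner G (A.erase u) v x).Nonempty
  · obtain ⟨y, hy⟩ := hin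
    obtain ⟨⟨hyA, hp⟩, hvy⟩ := mem_inner.1 hy
    have e4 := h1 y hyA hvy
    have e5 := h3 y hyA hvy
    have e6 : 0 < (conflicts G (A.erase u) v y).card :=
      Finset.card_pos.2 ⟨x, mem_conflicts.2 ⟨hx, hp.swap⟩⟩
    exact (Val.of_two_conflicts (L := 1) hx hyA hvx hvy (mem_conflicts.2 ⟨hyA, hp⟩) (by omega)
      (by omega) zero_le_one (.leaf _ _) (.leaf _ _)).mono (by norm_num [γ]) le_rfl
  · have hxA := Finset.mem_of_mem_erase hx
    have e4 : (inner G A v x).card ≤ 1 := by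
      refine (Finset.card_le_card (t := {u}) fun s hs => ?_).trans (by simp)
      by_contra hne
      rw [Finset.mem_singleton] at hne
      obtain ⟨⟨hsA, hp⟩, hvs⟩ := mem_inner.1 hs
      exact hin ⟨s, mem_inner.2 ⟨⟨Finset.mem_erase.2 ⟨hne, hsA⟩, hp⟩, hvs⟩⟩
    have e5 := hb x hxA hvx
    have e6 := Finset.card_le_card
      (outer_mono (G := G) (v := v) (u := x) (Finset.erase_subset u A))
    rw [Finset.not_nonempty_iff_eq_empty] at hin
    rw [hin, Finset.card_empty] at e3
    omega

/-- Deleting `u` leaves the three conflicts of `y` intact. Deleting `y` as well leaves `x` with a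
single conflict, which is forced. -/
theorem Val.of_three_conflicts_path {A : Finset V} {v u x y : V} (hu : u ∈ A) (hvu : G.Adj v u)
    (hx : x ∈ inner G A v u) (hy : y ∈ inner G A v x) (hyu : y ≠ u) (hyi : y ∉ inner G A v u)
    (hcu : (conflicts G A v u).card = 3) (hcx : (conflicts G A v x).card = 3)
    (hcy : (conflicts G A v y).card = 3) : Val G v 4 A (γ ^ 3 + 3 * γ ^ 4) := by
  obtain ⟨⟨hxA, hpx⟩, hvx⟩ := mem_inner.1 hx
  obtain ⟨⟨hyA, hpy⟩, hvy⟩ := mem_inner.1 hy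
  have huy : u ∉ conflicts G A v y := fun h =>
    hyi (mem_inner.2 ⟨⟨hyA, (mem_conflicts.1 h).2.swap⟩, hvy⟩)
  have hux : u ∈ conflicts G A v x := mem_conflicts.2 ⟨hu, hpx.swap⟩
  have hyx : y ∈ conflicts G A v x := mem_conflicts.2 ⟨hyA, hpy⟩
  have h3 : Val G v 1 ((A.erase u).erase y) γ := by
    refine .forced (u := x) (q := 1) ?_ hvx ?_ (.leaf 0 _) zero_le_one (by simp)
    · simp only [Finset.mem_erase]
      exact ⟨hpy.ne₂₃, hpx.ne₂₃.symm, hxA⟩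
    · rw [conflicts_erase, conflicts_erase, Finset.card_erase_of_mem, Finset.card_erase_of_mem hux,
        hcx]
      exact Finset.mem_erase.2 ⟨hyu, hyx⟩
  have h2 : Val G v 2 (A.erase u) (γ ^ 3 + γ ^ 2) := by
    refine .branch (h := 3) (u := y) (Finset.mem_erase.2 ⟨hyu, hyA⟩) hvy ?_ h3 (.leaf 1 _)
      (by norm_num [γ]) zero_le_one (by norm_num [γ])
    rw [conflicts_erase, Finset.erase_eq_of_notMem huy, hcy]
  exact .branch hu hvu hcu.ge (h2.mono le_rfl (by norm_num)) (.leaf 3 _) (by norm_num [γ])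
    zero_le_one (by norm_num [γ])

/-- Branching on `u` and then on `x`, after which `x'` is forced, gives three outcomes of weight `γ
^ 3`. By `hrest` each still contains a path through `v` and can be continued at cost `γ + γ ^ 2`.
The total is within the bound because `3 * γ ^ 2 ≤ 1`. -/
theorem Val.of_three_conflicts_triangle {A : Finset V} {v u x x' : V} (hu : u ∈ A)
    (hvu : G.Adj v u) (hx : x ∈ inner G A v u) (hx' : x' ∈ inner G A v u)
    (hxx' : x' ∈ inner G A v x) (hcu : (conflicts G A v u).card = 3)
    (hcx : (conflicts G A v x).card = 3) (hcx' : (conflicts G A v x').card = 3)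
    (hrest : ∀ D : Finset V, (∀ s ∈ D, s = u ∨ s = x ∨ s ∈ conflicts G A v u ∨
      s ∈ conflicts G A v x ∨ s ∈ conflicts G A v x') → Hit G (A \ D) v 1) :
    Val G v 4 A (γ ^ 3 + 3 * γ ^ 4) := by
  obtain ⟨⟨hxA, hpx⟩, hvx⟩ := mem_inner.1 hx
  obtain ⟨⟨hx'A, hpx'⟩, hvx'⟩ := mem_inner.1 hx'
  have hpxx' := (mem_inner.1 hxx').1.2
  have hux : u ∈ conflicts G A v x := mem_conflicts.2 ⟨hu, hpx.swap⟩
  have hux' : u ∈ conflicts G A v x' := mem_conflicts.2 ⟨hu, hpx'.swap⟩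
  have hxx'' : x ∈ conflicts G A v x' := mem_conflicts.2 ⟨hxA, hpxx'.swap⟩
  have h3 : Val G v 2 ((A.erase u).erase x) (γ * (γ + γ ^ 2)) := by
    refine .forced (u := x') ?_ hvx' ?_ (.of_hit_one ?_) (by norm_num [γ]) le_rfl
    · simp only [Finset.mem_erase]
      exact ⟨hpxx'.ne₂₃.symm, hpx'.ne₂₃.symm, hx'A⟩
    · rw [conflicts_erase, conflicts_erase, Finset.card_erase_of_mem,
        Finset.card_erase_of_mem hux', hcx']
      exact Finset.mem_erase.2 ⟨hpx.ne₂₃.symm, hxx''⟩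
    · rw [← Finset.sdiff_singleton_eq_erase, ← Finset.sdiff_singleton_eq_erase, sdiff_sdiff,
        sdiff_sdiff]
      refine hrest _ fun s hs => ?_
      simp only [Finset.sup_eq_union, Finset.mem_union, Finset.mem_singleton, mem_conflicts,
        Finset.mem_sdiff] at hs ⊢
      tauto
  have h2 : Val G v 3 (A.erase u) (2 * γ ^ 2 * (γ + γ ^ 2)) := by
    refine .branch (h := 2) (u := x) (Finset.mem_erase.2 ⟨hpx.ne₂₃.symm, hxA⟩) hvx ?_ h3
      ((Val.of_hit_one ?_).mono le_rfl (by norm_num)) (by norm_num [γ]) (by norm_num [γ])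
      (by ring_nf; rfl)
    · rw [conflicts_erase, Finset.card_erase_of_mem hux, hcx]
    · rw [← Finset.sdiff_singleton_eq_erase, sdiff_sdiff]
      refine hrest _ fun s hs => ?_
      simp only [Finset.sup_eq_union, Finset.mem_union, Finset.mem_singleton, mem_conflicts,
        Finset.mem_sdiff] at hs ⊢
      tauto
  refine .branch hu hvu hcu.ge h2 ((Val.of_hit_one (hrest _ fun s hs => ?_)).mono le_rfl
    (by norm_num)) (by norm_num [γ]) (by norm_num [γ]) (by norm_num [γ])
  exact Or.inr (Or.inr (Or.inl hs))

/-- Inner conflicts form a graph on the neighbours of `v`. Once the cheap cases are settled, the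
component of a vertex with three conflicts is a clique in this graph, and there is another component
with an edge. -/
theorem Val.of_max_degree {A : Finset V} {v : V} (hv : v ∈ A) (hH : Hit G A v 3)
    (hmax : ∀ u ∈ A, G.Adj v u → (nbrs G A u).card ≤ (nbrs G A v).card)
    (hdeg : ∀ u ∈ A, G.Adj v u → 3 ≤ (nbrs G A u).card)
    (htw : ∀ u ∈ A, G.Adj v u → 1 ≤ (conflicts G A v u).card) :
    Val G v 4 A (γ ^ 3 + 3 * γ ^ 4) := by
  have hsum := fun u => card_inner_add_card_outer (G := G) (A := A) (v := v) (u := u)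
  have hb : ∀ u ∈ A, G.Adj v u → (outer G A v u).card ≤ (inner G A v u).card := by
    intro u hu hvu
    have := card_nbrs_add_card_inner hv hu hvu
    have := hmax u hu hvu
    omega
  by_cases h4 : ∃ u ∈ A, G.Adj v u ∧ 4 ≤ (conflicts G A v u).card
  · obtain ⟨u, hu, hvu, hc⟩ := h4
    exact .of_four_conflicts hH hb hu hvu hc
  by_cases h1 : ∃ u ∈ A, G.Adj v u ∧ (conflicts G A v u).card = 1
  · obtain ⟨u, hu, hvu, hc⟩ := h1
    exact .forced hu hvu hc ((Val.of_hit_two (hH.sdiff _ (by omega))).mono le_rfl (by norm_num))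
      (by norm_num [γ]) (by norm_num [γ])
  push Not at h4 h1
  have hP : ∀ u ∈ A, G.Adj v u → 2 ≤ (conflicts G A v u).card ∧ (conflicts G A v u).card ≤ 3 ∧
      (outer G A v u).card ≤ 1 := by
    intro u hu hvu
    have e1 := h4 u hu hvu
    have e2 := h1 u hu hvu
    have e3 := htw u hu hvu
    have e4 := hsum u
    have e5 := hb u hu hvu
    omega
  by_cases h3 : ∃ u ∈ A, G.Adj v u ∧ (conflicts G A v u).card = 3
  swap
  · push Not at h3
    have hP2 : ∀ D : Finset V, ∀ u ∈ A \ D, G.Adj v u →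
        (conflicts G (A \ D) v u).card ≤ 2 ∧ (outer G (A \ D) v u).card ≤ 1 := by
      intro D u hu hvu
      have hu := (Finset.mem_sdiff.1 hu).1
      have e1 := h3 u hu hvu
      have e2 := hP u hu hvu
      have e3 := Finset.card_le_card
        (conflicts_mono (G := G) (v := v) (u := u) (Finset.sdiff_subset (s := A) (t := D)))
      have e4 := Finset.card_le_card
        (outer_mono (G := G) (v := v) (u := u) (Finset.sdiff_subset (s := A) (t := D)))
      omega
    -- Two rounds are possible: the first deletes at most two vertices, and three are needed to hit
    -- all paths. The cost is `4 * γ ^ 4`.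
    refine (Val.of_low_conflicts (L := 2) (q := 2 * γ ^ 2 * 1) (hH.mono (by norm_num))
      (by simpa using hP2 ∅) (fun D hD => ?_) (by norm_num [γ])).mono (by norm_num [γ]) le_rfl
    exact .of_low_conflicts (hH.sdiff D (by omega)) (hP2 D) (fun _ _ => .leaf 0 _) zero_le_one
  by_cases hi : ∃ u ∈ A, G.Adj v u ∧ (conflicts G A v u).card = 3 ∧ ∃ x ∈ inner G A v u,
      (conflicts G A v x).card = 2
  · obtain ⟨u, hu, hvu, hcu, x, hx, hcx⟩ := hi
    obtain ⟨⟨hxA, hpx⟩, hvx⟩ := mem_inner.1 hx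
    have hux : u ∈ conflicts G A v x := mem_conflicts.2 ⟨hu, hpx.swap⟩
    have hc1 : (conflicts G (A.erase u) v x).card = 1 := by
      rw [conflicts_erase, Finset.card_erase_of_mem hux, hcx]
    have h2 : Val G v 3 (A.erase u) (γ * (γ + γ ^ 2)) :=
      .forced (Finset.mem_erase.2 ⟨hpx.ne₂₃.symm, hxA⟩) hvx hc1
        ((Val.of_hit_one ((hH.erase u (i := 2) le_rfl).sdiff _ (by omega))).mono le_rfl
          (by norm_num)) (by norm_num [γ]) le_rfl
    exact .branch hu hvu hcu.ge h2 (.leaf 3 _) (by norm_num [γ]) zero_le_one (by norm_num [γ])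
  push Not at hi
  have hin3 : ∀ u ∈ A, G.Adj v u → (conflicts G A v u).card = 3 → ∀ x ∈ inner G A v u,
      (conflicts G A v x).card = 3 := by
    intro u hu hvu hcu x hx
    have e1 := hi u hu hvu hcu x hx
    have e2 := hP x (mem_inner.1 hx).1.1 (mem_inner.1 hx).2
    omega
  by_cases hii : ∃ u ∈ A, G.Adj v u ∧ (conflicts G A v u).card = 3 ∧ ∃ x ∈ inner G A v u,
      ∃ y ∈ inner G A v x, y ≠ u ∧ y ∉ inner G A v u
  · obtain ⟨u, hu, hvu, hcu, x, hx, y, hy, hyu, hyi⟩ := hii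
    have hcx := hin3 u hu hvu hcu x hx
    exact .of_three_conflicts_path hu hvu hx hy hyu hyi hcu hcx
      (hin3 x (mem_inner.1 hx).1.1 (mem_inner.1 hx).2 hcx y hy)
  push Not at hii
  obtain ⟨u, hu, hvu, hcu⟩ := h3
  have e1 := hsum u
  have e2 := hP u hu hvu
  obtain ⟨x, hx, x', hx', hne⟩ := Finset.one_lt_card.1 (show 1 < (inner G A v u).card by omega)
  have hxA := (mem_inner.1 hx).1.1
  have hvx := (mem_inner.1 hx).2
  have hcx := hin3 u hu hvu hcu x hx
  have hcx' := hin3 u hu hvu hcu x' hx'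
  have hxx' : x' ∈ inner G A v x :=
    hii x hxA hvx hcx u (inner_symm hu hvu hx) x' hx' hne.symm
  have hclosed : ∀ s ∈ inner G A v u, ∀ t ∈ inner G A v s, t ∈ insert u (inner G A v u) := by
    intro s hs t ht
    by_cases htu : t = u
    · simp [htu]
    · exact Finset.mem_insert_of_mem (hii u hu hvu hcu s hs t ht htu)
  -- If the clique of `u` were the whole neighbourhood of `v`, the degree of `u` would be at most
  -- one more than its number of outer conflicts, hence at most 2.
  obtain ⟨p, hp, hpu⟩ : ∃ p ∈ nbrs G A v, p ∉ insert u (inner G A v u) := by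
    by_contra hcon
    push Not at hcon
    have e3 := (Finset.card_le_card hcon).trans (Finset.card_insert_le _ _)
    have e4 := card_nbrs_add_card_inner hv hu hvu
    have e5 := hdeg u hu hvu
    omega
  obtain ⟨hpA, hvp⟩ := mem_nbrs.1 hp
  obtain ⟨r, hr⟩ : (inner G A v p).Nonempty := by
    rw [← Finset.card_pos]
    have := hP p hpA hvp
    have := hsum p
    omega
  have hpr := inner_symm hpA hvp hr
  have hru : r ∉ insert u (inner G A v u) := by
    intro h
    rcases Finset.mem_insert.1 h with rfl | h
    · exact hpu (Finset.mem_insert_of_mem hpr)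
    · exact hpu (hclosed r h p hpr)
  obtain ⟨⟨hrA, hpP⟩, hvr⟩ := mem_inner.1 hr
  refine .of_three_conflicts_triangle hu hvu hx hx' hxx' hcu hcx hcx' fun D hD => ?_
  -- Neighbours of `v` that the tree deletes belong to the clique of `u`, so the conflicting pair
  -- `p`, `r` survives.
  have havoid : ∀ s ∈ A, G.Adj v s → s ∉ insert u (inner G A v u) → s ∈ A \ D := by
    intro s hs hvs hsu
    refine Finset.mem_sdiff.2 ⟨hs, fun hsD => hsu ?_⟩
    have hmem : ∀ t, s ∈ conflicts G A v t → s ∈ inner G A v t := fun t ht =>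
      mem_inner.2 ⟨mem_conflicts.1 ht, hvs⟩
    rcases hD s hsD with rfl | rfl | h | h | h
    · simp
    · exact Finset.mem_insert_of_mem hx
    · exact Finset.mem_insert_of_mem (hmem _ h)
    · exact hclosed x hx s (hmem _ h)
    · exact hclosed x' hx' s (hmem _ h)
  exact hit_one_of_p3 (havoid p hpA hvp hpu) (havoid r hrA hvr hru) hpP

end MaxDegree

/-! ### Existence of a light family: reductions and small degrees -/

section Existence

variable {V : Type*} [DecidableEq V] (G : SimpleGraph V) [DecidableRel G.Adj]

/-- Some branching rule offers a family whose weight is small enough. -/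
def Good (A : Finset V) : Prop :=
  ∃ F, RuleFamily G 4 A F ∧ weight F ≤ 0.9995 * (1.811 : ℝ) ^ A.card

variable {G} {A : Finset V}

theorem Good.of_keep {v x y : V} {q : ℝ} (hv : v ∈ A) (hx : x ∈ A) (hy : y ∈ A) (hvx : v ≠ x)
    (hvy : v ≠ y) (hS : Settled G (A \ {x, y}) v)
    (hc : ({x, y} : Finset V).card ≤ (twins G A v).card) (hV : Val G v 4 A q)
    (hq : q ≤ 0.9995) : Good G A := by
  obtain ⟨F, hF, hw⟩ := hV
  exact ⟨F, Or.inl ⟨v, hv, x, hx, y, hy, hvx, hvy, hS, hc, hF⟩, hw.trans (by gcongr)⟩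

theorem Good.of_twins {v : V} {t : ℕ} {q : ℝ} (hv : v ∈ A) (ht : t ≤ (twins G A v).card)
    (hV : Val G v 4 A q) (hq : γ ^ t + q ≤ 0.9995) : Good G A := by
  obtain ⟨F, hF, hw⟩ := hV
  refine ⟨_, Or.inr (Or.inl ⟨v, hv, F, hF, rfl⟩), ?_⟩
  have := pow_card_sdiff (A := A) (Finset.filter_subset _ _ : twins G A v ⊆ A) ht
  rw [weight_cons]
  calc _ ≤ γ ^ t * (1.811 : ℝ) ^ A.card + q * (1.811 : ℝ) ^ A.card := add_le_add this hw
    _ = (γ ^ t + q) * (1.811 : ℝ) ^ A.card := by ring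
    _ ≤ _ := by gcongr

theorem Good.of_pair {v a b : V} {t : ℕ} {q : ℝ} (hv : v ∈ A) (ha : a ∈ A) (hb : b ∈ A)
    (hva : v ≠ a) (hvb : v ≠ b) (hS : Settled G (A \ {a, b}) v)
    (ht : t ≤ (insert v (conflicts G A a b)).card) (hV : Val G v 4 A q)
    (hq : γ ^ t + q ≤ 0.9995) : Good G A := by
  obtain ⟨F, hF, hw⟩ := hV
  refine ⟨_, Or.inr (Or.inr (Or.inl ⟨v, hv, a, ha, b, hb, hva, hvb, hS, F, hF, rfl⟩)), ?_⟩
  have := pow_card_sdiff (A := A) (Finset.insert_subset hv conflicts_subset) ht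
  rw [Finset.insert_eq, ← Finset.sup_eq_union, ← sdiff_sdiff,
    Finset.sdiff_singleton_eq_erase] at this
  rw [weight_cons]
  calc _ ≤ γ ^ t * (1.811 : ℝ) ^ A.card + q * (1.811 : ℝ) ^ A.card := add_le_add this hw
    _ = (γ ^ t + q) * (1.811 : ℝ) ^ A.card := by ring
    _ ≤ _ := by gcongr

theorem Good.of_delete {w v x : V} {q₁ q₂ : ℝ} (hw : w ∈ A) (hv : v ∈ A.erase w)
    (hx : x ∈ A.erase w) (hvx : v ≠ x) (hS : Settled G (A.erase w \ {x}) v)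
    (h₁ : Val G v 4 (A.erase w) q₁) (h₂ : Val G w 4 A q₂) (hq₁ : 0 ≤ q₁)
    (hq : γ * q₁ + q₂ ≤ 0.9995) : Good G A := by
  obtain ⟨F₁, hF₁, hw₁⟩ := h₁
  obtain ⟨F₂, hF₂, hw₂⟩ := h₂
  -- A single separating vertex is the pair `{x, x}`, and `v` pays for it as its own twin.
  refine ⟨_, Or.inr (Or.inr (Or.inr ⟨w, hw, F₁, F₂, ⟨v, hv, x, hx, x, hx, hvx, hvx, by simpa using hS,
    by simpa using ⟨v, mem_twins_self hv⟩, hF₁⟩, hF₂, rfl⟩)), ?_⟩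
  have e₁ := pow_card_sdiff (A := A) (D := {w}) (h := 1) (by simpa using hw) (by simp)
  rw [Finset.sdiff_singleton_eq_erase] at e₁
  rw [weight_append]
  calc _ ≤ q₁ * (γ ^ 1 * (1.811 : ℝ) ^ A.card) + q₂ * (1.811 : ℝ) ^ A.card := by
        refine add_le_add (hw₁.trans ?_) hw₂; gcongr
    _ = (γ * q₁ + q₂) * (1.811 : ℝ) ^ A.card := by ring
    _ ≤ _ := by gcongr

/-- A hitting set can be shrunk to lie in `A` and avoid `v`. It is not empty because a path exists,
so it has one or two elements; in the first case `x = y`. -/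
theorem exists_settled {v : V} {m : ℕ} (hm : m ≤ 2) (h1 : Hit G A v 1)
    (h : ¬ Hit G A v (m + 1)) : ∃ x ∈ A, ∃ y ∈ A, v ≠ x ∧ v ≠ y ∧ Settled G (A \ {x, y}) v ∧
      ({x, y} : Finset V).card ≤ m := by
  unfold Hit at h
  push Not at h
  obtain ⟨X, hX, hS⟩ := h
  have hS' : ∀ y ∈ A, ∀ z ∈ A, y ∉ (X ∩ A).erase v → z ∉ (X ∩ A).erase v → ¬ P3 G v y z := by
    intro y hy z hz hyX hzX hp
    rw [Finset.mem_erase, Finset.mem_inter] at hyX hzX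
    exact hS y hy z hz (fun h => hyX ⟨hp.ne₁₂.symm, h, hy⟩) (fun h => hzX ⟨hp.ne₁₃.symm, h, hz⟩) hp
  have hc : ((X ∩ A).erase v).card ≤ m := by
    have := Finset.card_le_card
      ((Finset.erase_subset v (X ∩ A)).trans Finset.inter_subset_left)
    omega
  have hmem : ∀ s ∈ (X ∩ A).erase v, s ∈ A ∧ v ≠ s := fun s hs => by
    rw [Finset.mem_erase, Finset.mem_inter] at hs
    exact ⟨hs.2.2, hs.1.symm⟩
  obtain ⟨x, y, hxy⟩ : ∃ x y, (X ∩ A).erase v = {x, y} := by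
    rcases (show ((X ∩ A).erase v).card = 0 ∨ ((X ∩ A).erase v).card = 1 ∨
      ((X ∩ A).erase v).card = 2 by omega) with h0 | h0 | h0
    · rw [Finset.card_eq_zero] at h0
      obtain ⟨y, hy, z, hz, -, -, hp⟩ := h1 ∅ (by simp)
      exact absurd hp (hS' y hy z hz (by simp [h0]) (by simp [h0]))
    · obtain ⟨x, hx⟩ := Finset.card_eq_one.1 h0
      exact ⟨x, x, by simpa using hx⟩
    · obtain ⟨x, y, -, hx⟩ := Finset.card_eq_two.1 h0
      exact ⟨x, y, hx⟩
  rw [hxy] at hS' hc hmem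
  refine ⟨x, (hmem x (by simp)).1, y, (hmem y (by simp)).1, (hmem x (by simp)).2,
    (hmem y (by simp)).2, fun s hs t ht => ?_, hc⟩
  rw [Finset.mem_sdiff] at hs ht
  exact hS' s hs.1 t ht.1 hs.2 ht.2

theorem adj_of_p3 {v y z : V} (h : P3 G v y z) : G.Adj v y ∨ G.Adj v z := by
  unfold P3 at h
  rw [G.adj_comm v z]
  tauto

theorem Hit.le_card_nbrs {v : V} {j : ℕ} (h : Hit G A v j) : j ≤ (nbrs G A v).card := by
  by_contra hcon
  obtain ⟨y, hy, z, hz, hy', hz', hp⟩ := h _ (not_le.1 hcon)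
  rw [mem_nbrs] at hy' hz'
  rcases adj_of_p3 hp with h | h <;> tauto

/-- If `u` were on no induced path, its component would be a clique. This component contains `v`,
which would then be on none either. -/
theorem Hit.of_adj {u v : V} (h : Hit G A v 1) (hv : v ∈ A) (hvu : G.Adj v u) :
    Hit G A u 1 := by
  obtain ⟨y, hy, z, hz, -, -, hp⟩ := h ∅ (by simp)
  by_contra hcon
  have hS : ∀ s ∈ A, ∀ t ∈ A, ¬ P3 G u s t := fun s hs t ht hp => hcon (hit_one_of_p3 hs ht hp)
  have c1 : ∀ s ∈ A, ∀ t ∈ A, G.Adj u s → G.Adj s t → t = u ∨ G.Adj u t := by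
    intro s hs t ht hus hst
    by_contra hc
    push Not at hc
    exact hS s hs t ht ((p3_of_adj hus).2 ⟨hc.1, hst.ne', Or.inr ⟨hc.2, hst⟩⟩)
  have c2 : ∀ s ∈ A, ∀ t ∈ A, G.Adj u s → G.Adj u t → s ≠ t → G.Adj s t := by
    intro s hs t ht hus hut hne
    by_contra hc
    exact hS s hs t ht ((p3_of_adj hus).2 ⟨hut.ne', hne.symm, Or.inl ⟨hut, hc⟩⟩)
  have c3 : ∀ s ∈ A, (s = u ∨ G.Adj u s) → ∀ t ∈ A, G.Adj s t → (t = u ∨ G.Adj u t) := by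
    rintro s hs (rfl | h) t ht hst
    · exact Or.inr hst
    · exact c1 s hs t ht h hst
  have c4 : ∀ s ∈ A, (s = u ∨ G.Adj u s) → ∀ t ∈ A, (t = u ∨ G.Adj u t) → s ≠ t →
      G.Adj s t := by
    rintro s hs (rfl | h) t ht (rfl | h') hne
    · exact absurd rfl hne
    · exact h'
    · exact h.symm
    · exact c2 s hs t ht h h' hne
  have hv' : v = u ∨ G.Adj u v := Or.inr hvu.symm
  have hboth : (y = u ∨ G.Adj u y) ∧ (z = u ∨ G.Adj u z) := by
    rcases hp with h | h | h
    · have := c3 v hv hv' y hy h.1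
      exact ⟨this, c3 y hy this z hz h.2.1⟩
    · have := c3 v hv hv' z hz h.2.1.symm
      exact ⟨c3 z hz this y hy h.1.symm, this⟩
    · exact ⟨c3 v hv hv' y hy h.2.1, c3 v hv hv' z hz h.1.symm⟩
  have e1 := c4 v hv hv' y hy hboth.1 hp.ne₁₂
  have e2 := c4 v hv hv' z hz hboth.2 hp.ne₁₃
  have e3 := c4 y hy hboth.1 z hz hboth.2 hp.ne₂₃
  rcases hp with h | h | h
  · exact h.2.2.1 e2
  · exact h.2.2.1 e1.symm
  · exact h.2.2.1 e3.symm

/-- A separator no larger than the number of twins lets `v` be kept outright, and `γ + γ ^ 2` is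
already light. -/
theorem Good.or_hit_succ {v : V} {m : ℕ} (hv : v ∈ A) (h1 : Hit G A v 1) (hm : m ≤ 2)
    (hc : m ≤ (twins G A v).card) : Good G A ∨ Hit G A v (m + 1) := by
  by_contra! hcon
  obtain ⟨x, hx, y, hy, hvx, hvy, hS, hcard⟩ := exists_settled hm h1 hcon.2
  exact hcon.1 (.of_keep hv hx hy hvx hvy hS (hcard.trans hc)
    ((Val.of_hit_one h1).mono le_rfl (by norm_num)) (by norm_num [γ]))

theorem one_le_card_twins {v : V} (hv : v ∈ A) : 1 ≤ (twins G A v).card :=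
  Finset.card_pos.2 ⟨v, mem_twins_self hv⟩

theorem hit_two_of_not_good (hG : ¬ Good G A) {v : V} (hv : v ∈ A) (h1 : Hit G A v 1) :
    Hit G A v 2 :=
  (Good.or_hit_succ hv h1 one_le_two (one_le_card_twins hv)).resolve_left hG

theorem two_le_card_nbrs_of_not_good (hG : ¬ Good G A) {v : V} (hv : v ∈ A)
    (h1 : Hit G A v 1) : 2 ≤ (nbrs G A v).card :=
  (hit_two_of_not_good hG hv h1).le_card_nbrs

/-- An edge without conflicts joins twins. Two twins raise the hitting number to 3, and then
deleting all twins or keeping `v` is light. -/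
theorem one_le_card_conflicts_of_not_good (hG : ¬ Good G A) {v u : V} (hv : v ∈ A) (hu : u ∈ A)
    (h1 : Hit G A v 1) (hvu : G.Adj v u) : 1 ≤ (conflicts G A v u).card := by
  by_contra hcon
  have hempty : conflicts G A v u = ∅ := by
    rw [← Finset.card_eq_zero]; omega
  have hutw : u ∈ twins G A v := by
    refine mem_twins.2 ⟨hu, fun s hs => ?_⟩
    have : ¬ P3 G v u s := fun hp => by
      have := mem_conflicts.2 ⟨hs, hp⟩
      simp [hempty] at this
    rw [p3_of_adj hvu] at this
    rw [G.adj_comm s u, G.adj_comm s v]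
    by_cases hsu : s = u
    · simp [hsu, hvu]
    by_cases hsv : s = v
    · simp [hsv, hvu.symm]
    simp only [hsu, hsv, ne_eq, not_false_eq_true, true_and, false_or] at this ⊢
    tauto
  have h2 : 2 ≤ (twins G A v).card :=
    Finset.one_lt_card.2 ⟨v, mem_twins_self hv, u, hutw, hvu.ne⟩
  have h3 := (Good.or_hit_succ hv h1 le_rfl h2).resolve_left hG
  exact hG (.of_twins hv h2 ((Val.of_hit_three h3).mono le_rfl (by norm_num)) (by norm_num [γ]))

theorem settled_of_nbrs_subset {X : Finset V} {v : V} (h : nbrs G A v ⊆ X) :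
    Settled G (A \ X) v := by
  intro y hy z hz hp
  rw [Finset.mem_sdiff] at hy hz
  rcases adj_of_p3 hp with h' | h'
  · exact hy.2 (h (mem_nbrs.2 ⟨hy.1, h'⟩))
  · exact hz.2 (h (mem_nbrs.2 ⟨hz.1, h'⟩))

/-- The pair rule applies with the neighbourhood `{a, b}` as separator: without `v`, the conflicts
of `a` and `b` go too. One of them is enough unless `a` and `b` both have exactly two conflicts with
`v`. Then the conflicts of `a` and `b` are the symmetric difference of two sets of equal size, so
there are at least two. -/
theorem Good.of_degree_two_triangle {v a b : V} (hv : v ∈ A) (h1 : Hit G A v 1)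
    (hN : nbrs G A v = {a, b}) (hab : G.Adj a b) : Good G A := by
  by_contra hG
  have hN' : ∀ s ∈ A, G.Adj v s ↔ s = a ∨ s = b := by
    intro s hs
    have : s ∈ nbrs G A v ↔ s ∈ ({a, b} : Finset V) := by rw [hN]
    simpa [mem_nbrs, hs] using this
  obtain ⟨ha, hva⟩ := mem_nbrs.1 (show a ∈ nbrs G A v by simp [hN])
  obtain ⟨hb, hvb⟩ := mem_nbrs.1 (show b ∈ nbrs G A v by simp [hN])
  have h2 := hit_two_of_not_good hG hv h1
  have hS : Settled G (A \ {a, b}) v := settled_of_nbrs_subset hN.subset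
  have hca := one_le_card_conflicts_of_not_good hG hv ha h1 hva
  have hcb := one_le_card_conflicts_of_not_good hG hv hb h1 hvb
  have hcab := one_le_card_conflicts_of_not_good hG ha hb (h1.of_adj hv hva) hab
  have hvn : v ∉ conflicts G A a b := by
    rw [mem_conflicts, p3_of_adj hab]
    simp [hva.symm, hvb.symm]
  have hcard := Finset.card_insert_of_notMem hvn
  have h3 : ∀ u ∈ A, G.Adj v u → (conflicts G A v u).card ≤ 2 := by
    intro u hu hvu
    by_contra! hcon
    exact hG (.of_pair (t := 2) hv ha hb hva.ne hvb.ne hS (by omega)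
      ((Val.of_three_conflicts h2 hu hvu hcon).mono le_rfl (by norm_num)) (by norm_num [γ]))
  have h4 : ∀ u ∈ A, G.Adj v u → (conflicts G A v u).card ≠ 1 := by
    intro u hu hvu hcon
    exact hG (.of_pair (t := 2) hv ha hb hva.ne hvb.ne hS (by omega)
      ((Val.forced hu hvu hcon (.of_hit_one (h2.sdiff _ (by omega))) (by norm_num [γ])
        le_rfl).mono le_rfl (by norm_num)) (by norm_num [γ]))
  have ea : (conflicts G A v a).card = 2 := by have := h3 a ha hva; have := h4 a ha hva; omega
  have eb : (conflicts G A v b).card = 2 := by have := h3 b hb hvb; have := h4 b hb hvb; omega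
  have hsub : (conflicts G A v a \ conflicts G A v b) ∪ (conflicts G A v b \ conflicts G A v a) =
      conflicts G A a b := by
    ext s
    simp only [Finset.mem_union, Finset.mem_sdiff, mem_conflicts, p3_of_adj hva, p3_of_adj hvb,
      p3_of_adj hab]
    by_cases hs : s ∈ A
    · have := hN' s hs
      by_cases hsa : s = a
      · subst hsa; simp [hs, hva, hab.symm]
      by_cases hsb : s = b
      · subst hsb; simp [hs, hvb, hab]
      by_cases hsv : s = v
      · subst hsv; simp [hs, hva.symm, hvb.symm]
      simp only [hsa, hsb, or_self, iff_false] at this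
      simp only [hs, hsa, hsb, hsv, this, ne_eq, not_false_eq_true, true_and, false_and, false_or]
      tauto
    · simp [hs]
  have hdisj : Disjoint (conflicts G A v a \ conflicts G A v b)
      (conflicts G A v b \ conflicts G A v a) := by
    rw [Finset.disjoint_left]
    intro s hs hs'
    rw [Finset.mem_sdiff] at hs hs'
    exact hs.2 hs'.1
  have hcd := Finset.card_union_of_disjoint hdisj
  have hsd := Finset.card_sdiff_comm (ea.trans eb.symm)
  rw [hsub] at hcd
  exact hG (.of_pair (t := 3) hv ha hb hva.ne hvb.ne hS (by omega)
    ((Val.of_hit_two h2).mono le_rfl (by norm_num)) (by norm_num [γ]))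

/-- Since `v` sees only `a` and `b`, every other neighbour of `a` is a conflict, and `b` replaces
`v` in the count. -/
theorem conflicts_of_degree_two {v a b : V} (hv : v ∈ A) (hN : nbrs G A v = {a, b})
    (hne : a ≠ b) (hab : ¬ G.Adj a b) :
    conflicts G A a v = insert b ((nbrs G A a).erase v) ∧
      (conflicts G A a v).card = (nbrs G A a).card := by
  obtain ⟨ha, hva⟩ := mem_nbrs.1 (show a ∈ nbrs G A v by simp [hN])
  obtain ⟨hb, hvb⟩ := mem_nbrs.1 (show b ∈ nbrs G A v by simp [hN])
  have h1 : conflicts G A a v = insert b ((nbrs G A a).erase v) := by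
    ext s
    simp only [mem_conflicts, p3_of_adj hva.symm, Finset.mem_insert, Finset.mem_erase, mem_nbrs]
    by_cases hs : s ∈ A
    · have h2 : s ∈ nbrs G A v ↔ s ∈ ({a, b} : Finset V) := by rw [hN]
      simp only [mem_nbrs, hs, true_and, Finset.mem_insert, Finset.mem_singleton] at h2
      by_cases hsb : s = b
      · subst hsb; simp [hs, hab, hvb, hne.symm, hvb.ne']
      by_cases hsa : s = a
      · subst hsa; simp [hne]
      simp only [hsa, hsb, or_self, iff_false] at h2
      simp [hs, hsa, hsb, h2]
    · have : s ≠ b := by rintro rfl; exact hs hb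
      simp [hs, this]
  refine ⟨h1, ?_⟩
  rw [h1, Finset.card_insert_of_notMem (by simp [mem_nbrs, hab]),
    Finset.card_erase_add_one (mem_nbrs.2 ⟨hv, hva.symm⟩)]

/-- On the path `w a v b`, once `w` is deleted, `b` alone separates `a`, which is then kept with one
forced deletion. If `w` is kept instead, `a` has as many conflicts as `w` has neighbours. -/
theorem Good.of_adjacent_degree_two {v a b w : V} (hv : v ∈ A) (h1 : Hit G A v 1)
    (hN : nbrs G A v = {a, b}) (hne : a ≠ b) (hab : ¬ G.Adj a b)
    (hNa : nbrs G A a = {v, w}) (hvw : v ≠ w) : Good G A := by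
  by_contra hG
  obtain ⟨ha, hva⟩ := mem_nbrs.1 (show a ∈ nbrs G A v by simp [hN])
  obtain ⟨hb, hvb⟩ := mem_nbrs.1 (show b ∈ nbrs G A v by simp [hN])
  obtain ⟨hw, haw⟩ := mem_nbrs.1 (show w ∈ nbrs G A a by simp [hNa])
  have hwb : w ≠ b := by rintro rfl; exact hab haw
  have hnvw : ¬ G.Adj v w := by
    intro h
    have : w ∈ nbrs G A v := mem_nbrs.2 ⟨hw, h⟩
    rw [hN] at this
    simp [haw.ne', hwb] at this
  have hHw := (h1.of_adj hv hva).of_adj ha haw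
  have hHw2 := hit_two_of_not_good hG hw hHw
  obtain ⟨hcv, hcv'⟩ := conflicts_of_degree_two hv hN hne hab
  obtain ⟨hca, hca'⟩ := conflicts_of_degree_two ha (hNa.trans (Finset.pair_comm v w)) hvw.symm
    (fun h => hnvw h.symm)
  have hVa : Val G a 4 (A.erase w) γ := by
    refine .forced (u := v) (Finset.mem_erase.2 ⟨hvw, hv⟩) hva.symm ?_ (.leaf 3 _) zero_le_one
      (by simp)
    rw [conflicts_erase, Finset.card_erase_of_mem, hcv', hNa, Finset.card_pair hvw]
    rw [hcv]
    simp [mem_nbrs, hw, haw, hvw.symm]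
  have hS : Settled G (A.erase w \ {b}) a := by
    intro y hy z hz hp
    simp only [Finset.mem_sdiff, Finset.mem_erase, Finset.mem_singleton] at hy hz
    have key : ∀ s t, s ≠ w → s ≠ b → s ∈ A → t ≠ w → t ≠ b → t ∈ A → P3 G a s t →
        ¬ G.Adj a s := by
      intro s t hsw hsb hs htw htb ht hp has
      have h2 : s ∈ nbrs G A a := mem_nbrs.2 ⟨hs, has⟩
      rw [hNa] at h2
      simp only [Finset.mem_insert, Finset.mem_singleton, hsw, or_false] at h2
      subst h2
      have h3 : t ∈ conflicts G A a s := mem_conflicts.2 ⟨ht, hp⟩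
      rw [hcv, hNa] at h3
      simp [htw, htb] at h3
    rcases adj_of_p3 hp with h | h
    · exact key y z hy.1.1 hy.2 hy.1.2 hz.1.1 hz.2 hz.1.2 hp h
    · exact key z y hz.1.1 hz.2 hz.1.2 hy.1.1 hy.2 hy.1.2 hp.swap h
  have main : ∀ q, Val G w 4 A q → ¬ γ * γ + q ≤ 0.9995 := fun q hq hle =>
    hG (.of_delete hw (Finset.mem_erase.2 ⟨haw.ne, ha⟩) (Finset.mem_erase.2 ⟨hwb.symm, hb⟩) hne hS
      hVa hq (by norm_num [γ]) hle)
  have hdeg := hHw2.le_card_nbrs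
  rcases hdeg.eq_or_lt with hdeg | hdeg
  · obtain ⟨x, hx, hxa⟩ := Finset.exists_mem_ne (show 1 < (nbrs G A w).card by omega) a
    obtain ⟨hxA, hwx⟩ := mem_nbrs.1 hx
    have hxc : x ∈ conflicts G A w a := by simp [hca, hx, hxa]
    have hac : a ∈ conflicts G A w x :=
      mem_conflicts.2 ⟨ha, (mem_conflicts.1 hxc).2.swap⟩
    rcases (Nat.succ_le_of_lt (Finset.card_pos.2 ⟨a, hac⟩)).eq_or_lt with hc | hc
    · exact main γ (.forced hxA hwx hc.symm (.leaf 3 _) zero_le_one (by simp)) (by norm_num [γ])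
    · exact main _ (.of_two_conflicts (L := 2) hxA ha hwx haw.symm hac hc (by omega) zero_le_one
        (.leaf _ _) (.leaf _ _)) (by norm_num [γ])
  · exact main _ ((Val.of_three_conflicts hHw2 ha haw.symm (by omega)).mono le_rfl (by norm_num))
      (by norm_num [γ])

/-- After the deletion of `x` and `y`, only `b` is left of the conflicts `{b, x, y}` of `v` and is
forced. If `x` has just two conflicts, so does `y`. Deleting those of `x`, among them `v`, leaves
`y` with one, forced again. -/
theorem Val.of_adjacent_pair {a v b x y : V} (hv : v ∈ A)
    (hN : nbrs G A v = {a, b}) (hne : a ≠ b) (hab : ¬ G.Adj a b) (hNa : nbrs G A a = {v, x, y})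
    (hvx : v ≠ x) (hvy : v ≠ y) (hxy : G.Adj x y) (hH : Hit G A a 3)
    (hcx : 2 ≤ (conflicts G A a x).card) (hcy : 2 ≤ (conflicts G A a y).card)
    (hc : 3 ≤ (conflicts G A a x).card ∨ (conflicts G A a y).card = 2) :
    Val G a 4 A (3 * γ ^ 3) := by
  obtain ⟨hx, hax⟩ := mem_nbrs.1 (show x ∈ nbrs G A a by simp [hNa])
  obtain ⟨hy, hay⟩ := mem_nbrs.1 (show y ∈ nbrs G A a by simp [hNa])
  have hva := (mem_nbrs.1 (show v ∈ nbrs G A a by simp [hNa])).2.symm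
  have hnv : ∀ s ∈ nbrs G A a, s ≠ a → ¬ G.Adj v s := by
    intro s hs hsa h
    have : s ∈ nbrs G A v := mem_nbrs.2 ⟨(mem_nbrs.1 hs).1, h⟩
    rw [hN] at this
    simp only [Finset.mem_insert, hsa, Finset.mem_singleton, false_or] at this
    subst this
    exact hab (mem_nbrs.1 hs).2
  have hvx' : v ∈ conflicts G A a x := by
    rw [mem_conflicts, p3_of_adj hax]
    exact ⟨hv, hva.ne, hvx, Or.inl ⟨hva.symm, fun h => hnv x (by simp [hNa]) hax.ne' h.symm⟩⟩
  have hvy' : v ∈ conflicts G A a y := by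
    rw [mem_conflicts, p3_of_adj hay]
    exact ⟨hv, hva.ne, hvy, Or.inl ⟨hva.symm, fun h => hnv y (by simp [hNa]) hay.ne' h.symm⟩⟩
  have hxny : x ∉ conflicts G A a y := by
    rw [mem_conflicts, p3_of_adj hay]
    simp [hax, hxy.symm]
  obtain ⟨hcv, hcv'⟩ := conflicts_of_degree_two hv hN hne hab
  have h2 : Val G a 1 ((A.erase x).erase y) γ := by
    refine .forced (u := v) (by simp [hvx, hvy, hv]) hva.symm ?_ (.leaf 0 _) zero_le_one (by simp)
    rw [conflicts_erase, conflicts_erase, Finset.card_erase_of_mem, Finset.card_erase_of_mem, hcv',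
      hNa, Finset.card_insert_of_notMem (by simp [hvx, hvy]), Finset.card_pair hxy.ne]
    · simp [hcv, hNa, hvx.symm]
    · simp [hcv, hNa, hvy.symm, hxy.ne']
  have h1 : Val G a 3 (A.erase x) (2 * γ ^ 2) := by
    refine .branch (h := 2) (u := y) (Finset.mem_erase.2 ⟨hxy.ne', hy⟩) hay ?_
      (h2.mono le_rfl (by norm_num)) (.leaf 2 _) (by norm_num [γ]) zero_le_one (by norm_num [γ])
    rw [conflicts_erase, Finset.erase_eq_of_notMem hxny]
    exact hcy
  by_cases hc3 : 3 ≤ (conflicts G A a x).card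
  · exact .branch hx hax hc3 h1 (.leaf 3 _) (by norm_num [γ]) zero_le_one (by norm_num [γ])
  · have hcy2 := hc.resolve_left hc3
    refine .branch (q₂ := γ) hx hax hcx h1 ?_ (by norm_num [γ]) (by norm_num [γ])
      (by norm_num [γ])
    obtain ⟨u, hu, hau, hcu⟩ := (hH.sdiff (i := 1) (conflicts G A a x) (by omega)).exists_conflict
    rw [Finset.mem_sdiff] at hu
    have huN : u ∈ nbrs G A a := mem_nbrs.2 ⟨hu.1, hau⟩
    simp only [hNa, Finset.mem_insert, Finset.mem_singleton] at huN
    rcases huN with rfl | rfl | rfl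
    · exact absurd hvx' hu.2
    · simp [conflicts_sdiff] at hcu
    · refine .forced (Finset.mem_sdiff.2 hu) hau ?_ (.leaf 2 _) zero_le_one (by simp)
      rw [conflicts_sdiff] at hcu ⊢
      have e1 := Finset.card_le_card (show conflicts G A a u \ conflicts G A a x ⊆
        (conflicts G A a u).erase v from fun s hs => by
          rw [Finset.mem_sdiff] at hs
          exact Finset.mem_erase.2 ⟨by rintro rfl; exact hs.2 hvx', hs.1⟩)
      rw [Finset.card_erase_of_mem hvy'] at e1
      omega

/-- Without `a`, the vertex `b` alone separates `v`, which is then kept. With `a` kept, `v` has as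
many conflicts as `a` has neighbours, and only degree 3 needs a closer look at the other two
neighbours. -/
theorem Good.of_degree_two_path {v a b : V} (hv : v ∈ A) (h1 : Hit G A v 1)
    (hN : nbrs G A v = {a, b}) (hne : a ≠ b) (hab : ¬ G.Adj a b) (hH : Hit G A a 3) :
    Good G A := by
  by_contra hG
  obtain ⟨ha, hva⟩ := mem_nbrs.1 (show a ∈ nbrs G A v by simp [hN])
  obtain ⟨hb, hvb⟩ := mem_nbrs.1 (show b ∈ nbrs G A v by simp [hN])
  have h2 := hit_two_of_not_good hG hv h1
  have hS : Settled G (A.erase a \ {b}) v := by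
    rw [← Finset.sdiff_singleton_eq_erase, sdiff_sdiff]
    exact settled_of_nbrs_subset (hN.le.trans (by intro s; simp))
  have main : ∀ q, Val G a 4 A q → ¬ γ * (γ + γ ^ 2) + q ≤ 0.9995 := fun q hq hle =>
    hG (.of_delete ha (Finset.mem_erase.2 ⟨hva.ne, hv⟩) (Finset.mem_erase.2 ⟨hne.symm, hb⟩)
      hvb.ne hS ((Val.of_hit_one (h2.erase a le_rfl)).mono le_rfl (by norm_num)) hq
      (by norm_num [γ]) hle)
  obtain ⟨hcv, hcv'⟩ := conflicts_of_degree_two hv hN hne hab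
  rcases hH.le_card_nbrs.eq_or_lt with hdeg | hdeg
  swap
  · exact main (γ ^ 4 + γ * (γ * (γ + γ ^ 2) + γ ^ 2)) (.branch (h := 4) hv hva.symm (by omega)
      ((Val.of_hit_two (hH.erase v le_rfl)).mono le_rfl (by norm_num)) (.leaf 3 _) (by norm_num [γ])
      zero_le_one (by norm_num [γ])) (by norm_num [γ])
  have hvN : v ∈ nbrs G A a := mem_nbrs.2 ⟨hv, hva.symm⟩
  obtain ⟨x, y, hxy, hNe⟩ := Finset.card_eq_two.1
    (show ((nbrs G A a).erase v).card = 2 by rw [Finset.card_erase_of_mem hvN]; omega)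
  have hNa : nbrs G A a = {v, x, y} := by rw [← hNe, Finset.insert_erase hvN]
  have hxN : x ∈ (nbrs G A a).erase v := by simp [hNe]
  have hyN : y ∈ (nbrs G A a).erase v := by simp [hNe]
  rw [Finset.mem_erase, mem_nbrs] at hxN hyN
  obtain ⟨hxv, hx, hax⟩ := hxN
  obtain ⟨hyv, hy, hay⟩ := hyN
  have hnv : ∀ s, G.Adj a s → s ∈ A → ¬ G.Adj v s := by
    intro s has hs h
    have : s ∈ nbrs G A v := mem_nbrs.2 ⟨hs, h⟩
    rw [hN] at this
    simp only [Finset.mem_insert, has.ne', Finset.mem_singleton, false_or] at this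
    subst this
    exact hab has
  by_cases hadj : G.Adj x y
  · have hc : ∀ s t, nbrs G A a = {v, s, t} → 2 ≤ (conflicts G A a s).card := by
      intro s t hst
      obtain ⟨hs, has⟩ := mem_nbrs.1 (show s ∈ nbrs G A a by simp [hst])
      have hsv : v ≠ s := by
        rintro rfl
        have := Finset.card_le_two (a := v) (b := t)
        rw [hst, Finset.insert_idem] at hdeg
        omega
      have hvc : v ∈ conflicts G A a s := by
        rw [mem_conflicts, p3_of_adj has]
        exact ⟨hv, hva.ne, hsv, Or.inl ⟨hva.symm, fun h => hnv s has hs h.symm⟩⟩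
      -- A path through `a` that avoids `v` and `t` must use `s`, which yields a second conflict
      -- besides `v`.
      obtain ⟨y', hy', z', hz', hy1, hz1, hp⟩ := hH {v, t} (by
        have := Finset.card_le_two (a := v) (b := t); omega)
      have key : ∀ p r, p ∈ A → r ∈ A → p ∉ ({v, t} : Finset V) → r ∉ ({v, t} : Finset V) →
          P3 G a p r → G.Adj a p → 2 ≤ (conflicts G A a s).card := by
        intro p r hp hr hp1 hr1 hP hap
        have : p ∈ nbrs G A a := mem_nbrs.2 ⟨hp, hap⟩
        rw [hst] at this
        simp only [Finset.mem_insert, Finset.mem_singleton, not_or] at this hp1 hr1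
        have hps : p = s := by tauto
        subst hps
        exact Finset.one_lt_card.2 ⟨v, hvc, r, mem_conflicts.2 ⟨hr, hP⟩, Ne.symm hr1.1⟩
      rcases adj_of_p3 hp with h | h
      · exact key y' z' hy' hz' hy1 hz1 hp h
      · exact key z' y' hz' hy' hz1 hy1 hp.swap h
    have hNa' : nbrs G A a = {v, y, x} := by rw [hNa, Finset.pair_comm x y]
    have hcx := hc x y hNa
    have hcy := hc y x hNa'
    by_cases h3 : 3 ≤ (conflicts G A a x).card ∨ (conflicts G A a y).card = 2
    · exact main _ (.of_adjacent_pair hv hN hne hab hNa hxv.symm hyv.symm hadj hH hcx hcy h3)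
        (by norm_num [γ])
    · exact main _ (.of_adjacent_pair hv hN hne hab hNa' hyv.symm hxv.symm hadj.symm hH hcy hcx
        (by omega)) (by norm_num [γ])
  · have hc : ∀ s t, nbrs G A a = {v, s, t} → s ≠ t → v ≠ s → v ≠ t → ¬ G.Adj s t →
        t ∈ conflicts G (A.erase v) a s ∧ 2 ≤ (conflicts G (A.erase v) a s).card := by
      intro s t hst hne' hvs hvt hnst
      obtain ⟨hs, has⟩ := mem_nbrs.1 (show s ∈ nbrs G A a by simp [hst])
      obtain ⟨ht, hat⟩ := mem_nbrs.1 (show t ∈ nbrs G A a by simp [hst])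
      have htc : t ∈ conflicts G (A.erase v) a s := by
        rw [mem_conflicts, p3_of_adj has, Finset.mem_erase]
        exact ⟨⟨hvt.symm, ht⟩, hat.ne', hne'.symm, Or.inl ⟨hat, hnst⟩⟩
      refine ⟨htc, ?_⟩
      -- A second neighbour of `s` is another conflict, because `a` sees only `v`, `s` and `t`.
      have hds := two_le_card_nbrs_of_not_good hG hs ((h1.of_adj hv hva).of_adj ha has)
      obtain ⟨e, he, hea⟩ := Finset.exists_mem_ne hds a
      obtain ⟨heA, hse⟩ := mem_nbrs.1 he
      have het : e ≠ t := by rintro rfl; exact hnst hse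
      have hev : e ≠ v := by rintro rfl; exact hnv s has hs hse.symm
      refine Finset.one_lt_card.2 ⟨t, htc, e, ?_, het.symm⟩
      rw [mem_conflicts, p3_of_adj has, Finset.mem_erase]
      refine ⟨⟨hev, heA⟩, hea, hse.ne', Or.inr ⟨fun hae => ?_, hse⟩⟩
      have : e ∈ nbrs G A a := mem_nbrs.2 ⟨heA, hae⟩
      simp [hst, hev, hse.ne', het] at this
    obtain ⟨hyc, hcx⟩ := hc x y hNa hxy hxv.symm hyv.symm hadj
    obtain ⟨hxc, hcy⟩ := hc y x (by rw [hNa, Finset.pair_comm x y]) hxy.symm hyv.symm hxv.symm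
      (fun h => hadj h.symm)
    have hV : Val G a 3 (A.erase v) (γ ^ 3 + γ * (γ + γ ^ 2)) := by
      rcases hcy.eq_or_lt with hcy | hcy
      · exact (Val.of_two_conflicts (L := 0) (Finset.mem_erase.2 ⟨hxv, hx⟩)
          (Finset.mem_erase.2 ⟨hyv, hy⟩) hax hay hyc hcx hcy.symm zero_le_one (.leaf _ _)
          (.leaf _ _)).mono (by norm_num [γ]) (by norm_num)
      · exact (Val.of_three_conflicts (hH.erase v le_rfl) (Finset.mem_erase.2 ⟨hyv, hy⟩) hay
          hcy).mono le_rfl (by norm_num)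
    exact main (γ ^ 3 + γ * (γ ^ 3 + γ * (γ + γ ^ 2))) (.branch (h := 3) hv hva.symm (by omega) hV
      (.leaf 3 _) (by norm_num [γ]) zero_le_one (by norm_num [γ])) (by norm_num [γ])

end Existence

/-! ### Existence of a light family: cut pairs and the general case -/

section Existence

variable {V : Type*} [DecidableEq V] {G : SimpleGraph V} [DecidableRel G.Adj] {A : Finset V}

/-- Keeping `k` costs `γ ^ 2` and deleting it `γ`. -/
theorem Good.of_forced_twice {k u s : V} (hk : k ∈ A) (hu : u ∈ A) (hku : G.Adj k u)
    (hcu : (conflicts G A k u).card = 1) (hs : s ∈ A) (hks : G.Adj k s)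
    (hsu : s ∉ conflicts G A k u)
    (hcs : (conflicts G A k s \ conflicts G A k u).card = 1) : Good G A := by
  refine .of_twins (t := 1) hk (one_le_card_twins hk) (.forced (q := γ) hu hku hcu (.forced
    (u := s) (Finset.mem_sdiff.2 ⟨hs, hsu⟩) hks ?_ (.leaf 2 _) zero_le_one (by simp))
    (by norm_num [γ]) le_rfl) (by norm_num [γ])
  rwa [conflicts_sdiff]

/-- A set with two elements has only three nonempty subsets, so three different ones are all of
them. -/
theorem exists_of_three_types {p₁ p₂ p₃ q₁ q₂ q₃ : Prop} (a₁ : p₁ ∨ q₁) (a₂ : p₂ ∨ q₂)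
    (a₃ : p₃ ∨ q₃) (t₁₂ : ¬ ((p₁ ↔ p₂) ∧ (q₁ ↔ q₂))) (t₁₃ : ¬ ((p₁ ↔ p₃) ∧ (q₁ ↔ q₃)))
    (t₂₃ : ¬ ((p₂ ↔ p₃) ∧ (q₂ ↔ q₃))) :
    ((p₁ ∧ ¬ q₁) ∨ (p₂ ∧ ¬ q₂) ∨ (p₃ ∧ ¬ q₃)) ∧ ((¬ p₁ ∧ q₁) ∨ (¬ p₂ ∧ q₂) ∨ (¬ p₃ ∧ q₃)) ∧
      ((p₁ ∧ q₁) ∨ (p₂ ∧ q₂) ∨ (p₃ ∧ q₃)) := by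
  by_cases h₁ : p₁ <;> by_cases h₂ : p₂ <;> by_cases h₃ : p₃ <;> by_cases h₄ : q₁ <;>
    by_cases h₅ : q₂ <;> by_cases h₆ : q₃ <;> simp_all

/-- The component `K` of `v` without `p` and `q` is a clique. Its vertices are not twins, so they
differ in their adjacency to `p` and `q`. In almost all cases this allows two forced deletions in a
row. -/
theorem Good.of_cut_pair {v p q : V} (hv : v ∈ A) (h1 : Hit G A v 1)
    (hdeg : 3 ≤ (nbrs G A v).card) (hp : p ∈ A) (hq : q ∈ A) (hvp : v ≠ p) (hvq : v ≠ q)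
    (hS : Settled G (A \ {p, q}) v) : Good G A := by
  by_contra hG
  set K : Finset V := A.filter fun s => (s ≠ p ∧ s ≠ q) ∧ (s = v ∨ G.Adj v s) with hK
  have hKm : ∀ s, s ∈ K ↔ s ∈ A ∧ (s ≠ p ∧ s ≠ q) ∧ (s = v ∨ G.Adj v s) := by simp [hK]
  have hvK : v ∈ K := (hKm v).2 ⟨hv, ⟨hvp, hvq⟩, Or.inl rfl⟩
  have hadj : ∀ k ∈ K, ∀ s ∈ A, s ≠ p → s ≠ q → s ≠ k → (G.Adj k s ↔ s ∈ K) := by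
    intro k hk s hs hsp hsq hsk
    rw [hKm] at hk ⊢
    obtain ⟨hkA, hkpq, rfl | hvk⟩ := hk
    · simp [hs, hsp, hsq, hsk]
    · have := hS k (by simp [hkA, hkpq]) s (by simp [hs, hsp, hsq])
      rw [p3_of_adj hvk] at this
      by_cases hsv : s = v
      · subst hsv; simp [hs, hsp, hsq, hvk.symm]
      · simp only [hsv, hsk, hs, hsp, hsq, ne_eq, not_false_eq_true, true_and, false_or] at this ⊢
        tauto
  have hHK : ∀ k ∈ K, Hit G A k 1 := by
    intro k hk
    obtain ⟨-, -, rfl | hvk⟩ := (hKm k).1 hk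
    · exact h1
    · exact h1.of_adj hv hvk
  have hKA : ∀ k ∈ K, k ∈ A ∧ k ≠ p ∧ k ≠ q := fun k hk => ⟨((hKm k).1 hk).1, ((hKm k).1 hk).2.1⟩
  have hKK : ∀ k ∈ K, ∀ k' ∈ K, k' ≠ k → G.Adj k k' := fun k hk k' hk' hne =>
    (hadj k hk k' (hKA k' hk').1 (hKA k' hk').2.1 (hKA k' hk').2.2 hne).2 hk'
  have hsub : ∀ k ∈ K, ∀ k' ∈ K, k' ≠ k → conflicts G A k k' ⊆ {p, q} := by
    intro k hk k' hk' hne z hz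
    rw [mem_conflicts, p3_of_adj (hKK k hk k' hk' hne)] at hz
    by_contra hcon
    simp only [Finset.mem_insert, Finset.mem_singleton, not_or] at hcon
    rw [hadj k hk z hz.1 hcon.1 hcon.2 hz.2.1, hadj k' hk' z hz.1 hcon.1 hcon.2 hz.2.2.1] at hz
    tauto
  have hmem : ∀ k ∈ K, ∀ k' ∈ K, k' ≠ k → ∀ z ∈ A, (z = p ∨ z = q) →
      (z ∈ conflicts G A k k' ↔ ¬ (G.Adj k z ↔ G.Adj k' z)) := by
    intro k hk k' hk' hne z hz hzpq
    have e1 := hKA k hk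
    have e2 := hKA k' hk'
    have hzk : z ≠ k := by rintro rfl; tauto
    have hzk' : z ≠ k' := by rintro rfl; tauto
    rw [mem_conflicts, p3_of_adj (hKK k hk k' hk' hne)]
    simp only [hz, hzk, hzk', ne_eq, not_false_eq_true, true_and]
    tauto
  have htw : ∀ k ∈ K, ∀ k' ∈ K, k' ≠ k →
      ¬ ((G.Adj k p ↔ G.Adj k' p) ∧ (G.Adj k q ↔ G.Adj k' q)) := by
    intro k hk k' hk' hne hcon
    have := one_le_card_conflicts_of_not_good hG (hKA k hk).1 (hKA k' hk').1 (hHK k hk)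
      (hKK k hk k' hk' hne)
    obtain ⟨z, hz⟩ := Finset.card_pos.1 this
    have hz' := hsub k hk k' hk' hne hz
    simp only [Finset.mem_insert, Finset.mem_singleton] at hz'
    rw [hmem k hk k' hk' hne z (mem_conflicts.1 hz).1 hz'] at hz
    rcases hz' with rfl | rfl <;> tauto
  -- A vertex that sees neither `p` nor `q` has all its neighbours in `K`. They cannot all see both,
  -- as two such would be twins, so one has a single conflict. After that forced deletion only one
  -- of `p`, `q` can still be a conflict.
  by_cases hfree : ∃ k ∈ K, ¬ G.Adj k p ∧ ¬ G.Adj k q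
  · obtain ⟨k, hk, hkp, hkq⟩ := hfree
    have hnK : ∀ u ∈ nbrs G A k, u ∈ K := by
      intro u hu
      rw [mem_nbrs] at hu
      refine (hadj k hk u hu.1 ?_ ?_ hu.2.ne').1 hu.2
      · rintro rfl; exact hkp hu.2
      · rintro rfl; exact hkq hu.2
    have hkA := (hKA k hk).1
    have h2 := hit_two_of_not_good hG hkA (hHK k hk)
    obtain ⟨u₁, hu₁, u₂, hu₂, hne⟩ := Finset.one_lt_card.1 h2.le_card_nbrs
    have hbd : ∀ u ∈ nbrs G A k, 1 ≤ (conflicts G A k u).card ∧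
        conflicts G A k u ⊆ {p, q} := fun u hu =>
      ⟨one_le_card_conflicts_of_not_good hG hkA (mem_nbrs.1 hu).1 (hHK k hk) (mem_nbrs.1 hu).2,
        hsub k hk u (hnK u hu) (mem_nbrs.1 hu).2.ne'⟩
    obtain ⟨u, hu, hcu⟩ : ∃ u ∈ nbrs G A k, (conflicts G A k u).card = 1 := by
      by_contra! hcon
      have key : ∀ u ∈ nbrs G A k, G.Adj u p ∧ G.Adj u q := by
        intro u hu
        have e1 := hbd u hu
        have e2 := hcon u hu
        have e3 := Finset.eq_of_subset_of_card_le e1.2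
          (Finset.card_le_two.trans (show 2 ≤ (conflicts G A k u).card by omega))
        have e4 := hmem k hk u (hnK u hu) (mem_nbrs.1 hu).2.ne' p hp (Or.inl rfl)
        have e5 := hmem k hk u (hnK u hu) (mem_nbrs.1 hu).2.ne' q hq (Or.inr rfl)
        simp only [e3, Finset.mem_insert, Finset.mem_singleton, true_or, or_true, hkp, hkq,
          true_iff, false_iff, not_not] at e4 e5
        exact ⟨e4, e5⟩
      have e1 := key u₁ hu₁
      have e2 := key u₂ hu₂
      exact htw u₁ (hnK u₁ hu₁) u₂ (hnK u₂ hu₂) hne.symm (by tauto)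
    obtain ⟨s, hs, hks, hcs⟩ :=
      (h2.sdiff (i := 1) (conflicts G A k u) (by omega)).exists_conflict
    rw [Finset.mem_sdiff] at hs
    refine hG (.of_forced_twice hkA (mem_nbrs.1 hu).1 (mem_nbrs.1 hu).2 hcu hs.1 hks hs.2 ?_)
    rw [conflicts_sdiff] at hcs
    have e1 := Finset.card_le_card (Finset.sdiff_subset_sdiff
      (hbd s (mem_nbrs.2 ⟨hs.1, hks⟩)).2 (subset_refl (conflicts G A k u)))
    have e2 := Finset.card_sdiff_add_card_eq_card (hbd u hu).2
    have e3 := Finset.card_le_two (a := p) (b := q)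
    omega
  push Not at hfree
  have hall : ∀ k ∈ K, G.Adj k p ∨ G.Adj k q := fun k hk => by
    by_cases h : G.Adj k p
    · exact Or.inl h
    · exact Or.inr (hfree k hk h)
  -- Otherwise `K = {v, k}` and `v` sees both `p` and `q`. Not being a twin, `k` sees only one of
  -- them and forms a triangle of degree two.
  have hthree : 2 < K.card := by
    by_contra! hcard
    obtain ⟨k, hkv, hk⟩ : ∃ k ∈ nbrs G A v, k ∉ ({p, q} : Finset V) := by
      by_contra! hcon
      have := Finset.card_le_card (show nbrs G A v ⊆ {p, q} from hcon)
      have := Finset.card_le_two (a := p) (b := q)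
      omega
    obtain ⟨hkA, hvk⟩ := mem_nbrs.1 hkv
    have hkK : k ∈ K := (hKm k).2 ⟨hkA, by simpa using hk, Or.inr hvk⟩
    have hKe : ∀ s ∈ K, s = v ∨ s = k := by
      have := Finset.eq_of_subset_of_card_le (show ({v, k} : Finset V) ⊆ K from
        Finset.insert_subset hvK (by simpa using hkK)) (by rw [Finset.card_pair hvk.ne]; exact hcard)
      intro s hs
      rw [← this] at hs
      simpa using hs
    have hNv : nbrs G A v = {k, p, q} := by
      refine Finset.eq_of_subset_of_card_le (fun s hs => ?_) (Finset.card_le_three.trans hdeg)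
      rw [mem_nbrs] at hs
      simp only [Finset.mem_insert, Finset.mem_singleton]
      by_contra! hcon
      have := hKe s ((hKm s).2 ⟨hs.1, hcon.2, Or.inr hs.2⟩)
      rcases this with rfl | rfl
      · exact G.loopless.irrefl _ hs.2
      · exact hcon.1 rfl
    have hvp' := (mem_nbrs.1 (show p ∈ nbrs G A v by simp [hNv])).2
    have hvq' := (mem_nbrs.1 (show q ∈ nbrs G A v by simp [hNv])).2
    have fin : ∀ r ∈ A, G.Adj v r → G.Adj k r → (∀ s ∈ A, G.Adj k s → s = v ∨ s = r) → False := by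
      intro r hr hvr hkr hs
      refine hG (.of_degree_two_triangle (a := v) (b := r) hkA (hHK k hkK) ?_ hvr)
      ext s
      simp only [mem_nbrs, Finset.mem_insert, Finset.mem_singleton]
      constructor
      · exact fun h => hs s h.1 h.2
      · rintro (rfl | rfl)
        · exact ⟨hv, hvk.symm⟩
        · exact ⟨hr, hkr⟩
    have hns : ∀ s ∈ A, G.Adj k s → s = v ∨ s = p ∨ s = q := by
      intro s hs hks
      by_contra! hcon
      have := hKe s ((hadj k hkK s hs hcon.2.1 hcon.2.2 hks.ne').1 hks)
      rcases this with rfl | rfl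
      · exact hcon.1 rfl
      · exact G.loopless.irrefl _ hks
    have e1 := htw v hvK k hkK hvk.ne'
    simp only [hvp', hvq', true_iff] at e1
    rcases hall k hkK with h | h
    · refine fin p hp hvp' h fun s hs hks => ?_
      rcases hns s hs hks with h' | h' | rfl
      · exact Or.inl h'
      · exact Or.inr h'
      · exact absurd ⟨h, hks⟩ e1
    · refine fin q hq hvq' h fun s hs hks => ?_
      rcases hns s hs hks with h' | rfl | h'
      · exact Or.inl h'
      · exact absurd ⟨hks, h⟩ e1
      · exact Or.inr h'
  obtain ⟨x₁, x₂, x₃, hx₁, hx₂, hx₃, h12, h13, h23⟩ := Finset.two_lt_card_iff.1 hthree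
  have t12 := htw x₁ hx₁ x₂ hx₂ h12.symm
  have t13 := htw x₁ hx₁ x₃ hx₃ h13.symm
  have t23 := htw x₂ hx₂ x₃ hx₃ h23.symm
  have a1 := hall x₁ hx₁
  have a2 := hall x₂ hx₂
  have a3 := hall x₃ hx₃
  obtain ⟨o₁, o₂, o₃⟩ := exists_of_three_types a1 a2 a3 t12 t13 t23
  have hex : ∀ P : V → Prop, P x₁ ∨ P x₂ ∨ P x₃ → ∃ x ∈ K, P x := by
    rintro P (h | h | h)
    exacts [⟨_, hx₁, h⟩, ⟨_, hx₂, h⟩, ⟨_, hx₃, h⟩]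
  obtain ⟨x, hx, hxp, hxq⟩ := hex (fun x => G.Adj x p ∧ ¬ G.Adj x q) o₁
  obtain ⟨y, hy, hyp, hyq⟩ := hex (fun x => ¬ G.Adj x p ∧ G.Adj x q) o₂
  obtain ⟨z, hz, hzp, hzq⟩ := hex (fun x => G.Adj x p ∧ G.Adj x q) o₃
  have hzx : z ≠ x := by rintro rfl; exact hxq hzq
  have hyx : y ≠ x := by rintro rfl; exact hxq hyq
  have hpq : p ≠ q := by rintro rfl; exact hxq hxp
  -- Here `x` sees only `p`, `y` only `q`, and `z` both. From `x`, the vertex `z` forces `q` out,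
  -- and then `y` forces `p` out.
  have hcz : conflicts G A x z = {q} := by
    have e0 := hsub x hx z hz hzx
    have e1 := hmem x hx z hz hzx p hp (Or.inl rfl)
    have e2 := hmem x hx z hz hzx q hq (Or.inr rfl)
    simp only [hxp, hzp, hxq, hzq, not_true_eq_false, iff_false, iff_true,
      not_false_eq_true] at e1 e2
    ext s
    rw [Finset.mem_singleton]
    constructor
    · intro h
      have := e0 h
      simp only [Finset.mem_insert, Finset.mem_singleton] at this
      rcases this with rfl | h'
      · exact absurd h e1
      · exact h'
    · rintro rfl; exact e2
  have hcy : conflicts G A x y \ {q} = {p} := by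
    have e0 := hsub x hx y hy hyx
    have e1 := hmem x hx y hy hyx p hp (Or.inl rfl)
    simp only [hxp, hyp, iff_false, not_true_eq_false, not_false_eq_true, iff_true] at e1
    ext s
    rw [Finset.mem_singleton, Finset.mem_sdiff, Finset.mem_singleton]
    constructor
    · rintro ⟨h, h'⟩
      have := e0 h
      simp only [Finset.mem_insert, Finset.mem_singleton, h', or_false] at this
      exact this
    · rintro rfl; exact ⟨e1, hpq⟩
  exact hG (.of_forced_twice (hKA x hx).1 (hKA z hz).1 (hKK x hx z hz hzx) (by simp [hcz])
    (hKA y hy).1 (hKK x hx y hy hyx) (by simp [hcz, (hKA y hy).2.2]) (by simp [hcz, hcy]))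

theorem hit_three_of_not_good (hG : ¬ Good G A) {v : V} (hv : v ∈ A) (h1 : Hit G A v 1)
    (hdeg : 3 ≤ (nbrs G A v).card) : Hit G A v 3 := by
  by_contra hcon
  obtain ⟨x, hx, y, hy, hvx, hvy, hS, -⟩ := exists_settled le_rfl h1 hcon
  exact hG (.of_cut_pair hv h1 hdeg hx hy hvx hvy hS)

/-- Every graph that is not a cluster graph has a family of small weight. -/
theorem good_of_not_cluster (hA : ¬ Cluster G A) : Good G A := by
  classical
  by_contra hG
  unfold Cluster at hA
  push Not at hA
  obtain ⟨v₀, hv₀, y₀, hy₀, z₀, hz₀, hp₀⟩ := hA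
  have hdeg3 : ∀ v ∈ A, Hit G A v 1 → 3 ≤ (nbrs G A v).card := by
    intro v hv h1
    by_contra! hlt
    have h2 := two_le_card_nbrs_of_not_good hG hv h1
    obtain ⟨a, b, hne, hN⟩ := Finset.card_eq_two.1 (show (nbrs G A v).card = 2 by omega)
    obtain ⟨ha, hva⟩ := mem_nbrs.1 (show a ∈ nbrs G A v by simp [hN])
    have h1a := h1.of_adj hv hva
    have hab : ¬ G.Adj a b := fun h => hG (.of_degree_two_triangle hv h1 hN h)
    have h2a := two_le_card_nbrs_of_not_good hG ha h1a
    by_cases h3a : 3 ≤ (nbrs G A a).card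
    · exact hG (.of_degree_two_path hv h1 hN hne hab (hit_three_of_not_good hG ha h1a h3a))
    · have hvN : v ∈ nbrs G A a := mem_nbrs.2 ⟨hv, hva.symm⟩
      obtain ⟨w, hw⟩ := Finset.card_eq_one.1 (show ((nbrs G A a).erase v).card = 1 by
        rw [Finset.card_erase_of_mem hvN]; omega)
      have hwv : v ≠ w := by
        have : w ∈ (nbrs G A a).erase v := by simp [hw]
        exact (Finset.mem_erase.1 this).1.symm
      exact hG (.of_adjacent_degree_two hv h1 hN hne hab
        (by rw [← hw, Finset.insert_erase hvN]) hwv)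
  -- The maximum is taken over vertices on induced paths only, but neighbours of such vertices are
  -- on induced paths as well.
  obtain ⟨v, hv, hmax⟩ := Finset.exists_max_image (A.filter fun v => Hit G A v 1)
    (fun v => (nbrs G A v).card) ⟨v₀, by simp [hv₀, hit_one_of_p3 hy₀ hz₀ hp₀]⟩
  rw [Finset.mem_filter] at hv
  have hnb : ∀ u ∈ A, G.Adj v u → Hit G A u 1 := fun u _ hvu => hv.2.of_adj hv.1 hvu
  -- The closing inequality `γ + γ ^ 3 + 3 * γ ^ 4 ≤ 0.9995` is the one that fixes the base 1.811.
  exact hG (.of_twins (t := 1) hv.1 (one_le_card_twins hv.1) (.of_max_degree hv.1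
    (hit_three_of_not_good hG hv.1 hv.2 (hdeg3 v hv.1 hv.2))
    (fun u hu hvu => hmax u (Finset.mem_filter.2 ⟨hu, hnb u hu hvu⟩))
    (fun u hu hvu => hdeg3 u hu (hnb u hu hvu))
    (fun u hu hvu => one_le_card_conflicts_of_not_good hG hv.1 hu hv.2 hvu)) (by norm_num [γ]))

end Existence

/-! ### Polynomial-time functions on the machine -/

section Machine

/-- The number of nodes of a tree. -/
def Data.size : Data → ℕ
  | .nil => 1
  | .cons a b => a.size + b.size + 1

/-- Renumbering of the functions that an expression calls. -/
def Expr.shift (m : ℕ) : Expr → Expr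
  | .var i => .var i
  | .nil => .nil
  | .cons a b => .cons (a.shift m) (b.shift m)
  | .split e a b => .split (e.shift m) (a.shift m) (b.shift m)
  | .bind e b => .bind (e.shift m) (b.shift m)
  | .call f e => .call (m + f) (e.shift m)

/-- An expression with a given value. -/
def Data.literal : Data → Expr
  | .nil => .nil
  | .cons a b => .cons a.literal b.literal

theorem Eval.literal (P : Program) (ρ : List Data) (d : Data) : Eval P ρ d.literal d d.size := by
  induction d with
  | nil => exact .nil
  | cons a b iha ihb => exact .cons iha ihb

theorem Eval.shift {P P' : Program} {m : ℕ} {ρ : List Data} {e : Expr} {v : Data} {t : ℕ}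
    (h : Eval P ρ e v t) (hP : ∀ j b, P[j]? = some b → P'[m + j]? = some (b.shift m)) :
    Eval P' ρ (e.shift m) v t := by
  induction h with
  | var h => exact .var h
  | nil => exact .nil
  | cons _ _ iha ihb => exact .cons iha ihb
  | splitNil _ _ ihe iha => exact .splitNil ihe iha
  | splitCons _ _ ihe ihb => exact .splitCons ihe ihb
  | bind _ _ ihe ihb => exact .bind ihe ihb
  | call _ hf _ ihe ihb => exact .call ihe (hP _ _ hf) ihb

theorem eval_mono (p : Polynomial ℕ) {a b : ℕ} (h : a ≤ b) : p.eval a ≤ p.eval b := by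
  rw [Polynomial.eval_eq_sum, Polynomial.eval_eq_sum]
  exact Finset.sum_le_sum fun i _ => Nat.mul_le_mul_left _ (Nat.pow_le_pow_left h i)

/-- Types whose elements are represented by trees. -/
class Enc (α : Type) where
  /-- the representation -/
  enc : α → Data

open Enc (enc)

instance : Enc Unit := ⟨fun _ => .nil⟩
instance : Enc Bool := ⟨Data.ofBool⟩
instance : Enc ℕ := ⟨Data.ofNat⟩
instance {α : Type} [Enc α] : Enc (List α) := ⟨fun l => Data.ofList (l.map enc)⟩
instance {α β : Type} [Enc α] [Enc β] : Enc (α × β) := ⟨fun x => .cons (enc x.1) (enc x.2)⟩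

variable {α β γ δ : Type} [Enc α] [Enc β] [Enc γ] [Enc δ]

/-- The size of the representation. -/
def esize (x : α) : ℕ := (enc x).size

theorem enc_cons (a : α) (l : List α) : enc (a :: l) = .cons (enc a) (enc l) := rfl
theorem enc_pair (x : α × β) : enc x = .cons (enc x.1) (enc x.2) := rfl

theorem esize_nil : esize ([] : List α) = 1 := rfl
theorem esize_cons (a : α) (l : List α) : esize (a :: l) = esize a + esize l + 1 := rfl
theorem esize_pair (x : α × β) : esize x = esize x.1 + esize x.2 + 1 := rfl

theorem Data.size_pos (d : Data) : 1 ≤ d.size := by cases d <;> simp [Data.size]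

theorem one_le_esize (x : α) : 1 ≤ esize x := Data.size_pos _

theorem length_le_esize (l : List α) : l.length ≤ esize l := by
  induction l with
  | nil => simp
  | cons a l ih => simp only [List.length_cons, esize_cons]; omega

theorem esize_append (l m : List α) : esize (l ++ m) + 1 = esize l + esize m := by
  induction l with
  | nil => simp [esize_nil, add_comm]
  | cons a l ih => simp only [List.cons_append, esize_cons]; omega

theorem esize_le_of_mem {l : List α} {a : α} (h : a ∈ l) : esize a ≤ esize l := by
  induction l with
  | nil => simp at h
  | cons b l ih =>
    rw [esize_cons]
    rcases List.mem_cons.1 h with rfl | h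
    · omega
    · have := ih h; omega

theorem esize_le_of_suffix {l m : List α} (h : l <:+ m) : esize l ≤ esize m := by
  obtain ⟨k, rfl⟩ := h
  have := esize_append k l
  have := one_le_esize k
  omega

theorem esize_le_of_forall {l : List α} {N : ℕ} (h : ∀ a ∈ l, esize a ≤ N) :
    esize l ≤ l.length * (N + 1) + 1 := by
  induction l with
  | nil => simp [esize_nil]
  | cons a l ih =>
    have h1 := h a (by simp)
    have h2 := ih fun b hb => h b (by simp [hb])
    rw [esize_cons, List.length_cons, add_mul]
    omega

/-- Function number `i` of `P` computes `f`, with the time and the size of the result bounded by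
a polynomial. -/
def Computes (P : Program) (i : ℕ) (f : α → β) (p : Polynomial ℕ) : Prop :=
  ∃ body, P[i]? = some body ∧ ∀ x, ∃ t, Eval P [enc x] body (enc (f x)) t ∧
    t ≤ p.eval (esize x) ∧ esize (f x) ≤ p.eval (esize x)

theorem Computes.esize_le {P : Program} {i : ℕ} {f : α → β} {p : Polynomial ℕ}
    (h : Computes P i f p) (x : α) : esize (f x) ≤ p.eval (esize x) := by
  obtain ⟨_, _, h⟩ := h
  obtain ⟨_, _, _, h⟩ := h x
  exact h

/-- The function is computed by some program in polynomial time. -/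
def PolyTime (f : α → β) : Prop := ∃ P p, Computes P 0 f p

theorem PolyTime.exists_bound {f : α → β} (h : PolyTime f) :
    ∃ p : Polynomial ℕ, ∀ x, esize (f x) ≤ p.eval (esize x) := by
  obtain ⟨P, p, h⟩ := h
  exact ⟨p, h.esize_le⟩

theorem Computes.shift {P P' : Program} {m : ℕ} {f : α → β} {p : Polynomial ℕ}
    (h : Computes P 0 f p) (hP : ∀ j b, P[j]? = some b → P'[m + j]? = some (b.shift m)) :
    Computes P' m f p := by
  obtain ⟨body, hb, h⟩ := h
  refine ⟨_, hP 0 body hb, fun x => ?_⟩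
  obtain ⟨t, ht, h1, h2⟩ := h x
  exact ⟨t, ht.shift hP, h1, h2⟩

theorem Computes.call {P : Program} {i : ℕ} {f : α → β} {p : Polynomial ℕ}
    (h : Computes P i f p) {ρ : List Data} {e : Expr} {x : α} {s : ℕ} (he : Eval P ρ e (enc x) s) :
    ∃ t, Eval P ρ (.call i e) (enc (f x)) t ∧ t ≤ s + p.eval (esize x) + 1 := by
  obtain ⟨body, hb, h⟩ := h
  obtain ⟨t, ht, h1, -⟩ := h x
  exact ⟨_, .call he hb ht, by omega⟩

/-- Programs can be linked behind given functions that call them. -/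
theorem exists_link {f : α → β} {g : γ → δ} {α' β' : Type} [Enc α'] [Enc β'] {h : α' → β'}
    (hf : PolyTime f) (hg : PolyTime g) (hh : PolyTime h) (m : ℕ) (front : ℕ → ℕ → ℕ → Program)
    (hm : ∀ i j l, (front i j l).length = m) :
    ∃ (P : Program) (i j l : ℕ) (pf pg ph : Polynomial ℕ), Computes P i f pf ∧ Computes P j g pg ∧
      Computes P l h ph ∧ ∀ (r : ℕ) (b : Expr), (front i j l)[r]? = some b → P[r]? = some b := by
  obtain ⟨Pf, pf, hf⟩ := hf
  obtain ⟨Pg, pg, hg⟩ := hg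
  obtain ⟨Ph, ph, hh⟩ := hh
  set i := m
  set j := m + Pf.length
  set l := m + Pf.length + Pg.length
  refine ⟨front i j l ++ (Pf.map (Expr.shift i) ++ (Pg.map (Expr.shift j) ++
    Ph.map (Expr.shift l))), i, j, l, pf, pg, ph, hf.shift ?_, hg.shift ?_, hh.shift ?_, ?_⟩
  · intro r b hr
    have hlt := (List.getElem?_eq_some_iff.1 hr).1
    rw [List.getElem?_append_right (by simp [hm, i]), List.getElem?_append_left (by
      simp [hm, i]; omega)]
    simp [hm, i, hr]
  · intro r b hr
    have hlt := (List.getElem?_eq_some_iff.1 hr).1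
    rw [List.getElem?_append_right (by simp [hm, j]; omega), List.getElem?_append_right (by
      simp [hm, j]; omega), List.getElem?_append_left (by simp [hm, j]; omega)]
    have : j + r - (front i j l).length - (Pf.map (Expr.shift i)).length = r := by
      simp [hm, j]; omega
    rw [this, List.getElem?_map, hr]; rfl
  · intro r b hr
    rw [List.getElem?_append_right (by simp [hm, l]; omega), List.getElem?_append_right (by
      simp [hm, l]; omega), List.getElem?_append_right (by simp [hm, l]; omega)]
    have : l + r - (front i j l).length - (Pf.map (Expr.shift i)).length -
        (Pg.map (Expr.shift j)).length = r := by
      simp [hm, l]; omega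
    rw [this, List.getElem?_map, hr]; rfl
  · intro r b hr
    rw [List.getElem?_append_left (List.getElem?_eq_some_iff.1 hr).1, hr]

theorem PolyTime.of_expr {f : α → β} (e : Expr) (p : Polynomial ℕ)
    (h : ∀ x, ∃ t, Eval [e] [enc x] e (enc (f x)) t ∧ t ≤ p.eval (esize x) ∧
      esize (f x) ≤ p.eval (esize x)) : PolyTime f :=
  ⟨[e], p, e, rfl, h⟩

/-- Retyping is free where encodings agree, as for a pair and a nonempty list, or for a number and a
list of units. -/
theorem PolyTime.of_enc_eq {f : α → β} {g : α → γ} (hf : PolyTime f)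
    (h : ∀ x, enc (f x) = enc (g x)) : PolyTime g := by
  obtain ⟨P, p, body, hb, hf⟩ := hf
  refine ⟨P, p, body, hb, fun x => ?_⟩
  obtain ⟨t, h1, h2, h3⟩ := hf x
  rw [h x] at h1
  refine ⟨t, h1, h2, ?_⟩
  rwa [esize, ← h x]

theorem PolyTime.id : PolyTime (fun x : α => x) :=
  .of_expr (.var 0) (Polynomial.X + 1) fun x => ⟨1, .var rfl, by simp, by simp⟩

theorem PolyTime.const (c : β) : PolyTime (fun _ : α => c) :=
  .of_expr (enc c).literal (Polynomial.C (esize c)) fun x =>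
    ⟨_, Eval.literal _ _ _, by simp [esize], by simp⟩

theorem PolyTime.comp {g : β → γ} {f : α → β} (hg : PolyTime g) (hf : PolyTime f) :
    PolyTime (fun x => g (f x)) := by
  obtain ⟨P, i, j, l, pf, pg, -, hf, hg, -, hP⟩ := exists_link hf hg (PolyTime.id (α := Unit)) 1
    (fun i j _ => [.call j (.call i (.var 0))]) (fun _ _ _ => rfl)
  refine ⟨P, pf + pg.comp pf + 3, _, hP 0 _ rfl, fun x => ?_⟩
  obtain ⟨s, hs, hs'⟩ := hf.call (ρ := [enc x]) (x := x) (.var (i := 0) rfl)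
  obtain ⟨t, ht, ht'⟩ := hg.call hs
  have h1 := hf.esize_le x
  have h2 := hg.esize_le (f x)
  have h3 := eval_mono pg h1
  refine ⟨t, ht, ?_, ?_⟩ <;> simp only [Polynomial.eval_add, Polynomial.eval_comp,
    Polynomial.eval_ofNat] <;> omega

theorem PolyTime.pair {f : α → β} {g : α → γ} (hf : PolyTime f) (hg : PolyTime g) :
    PolyTime (fun x => (f x, g x)) := by
  obtain ⟨P, i, j, l, pf, pg, -, hf, hg, -, hP⟩ := exists_link hf hg (PolyTime.id (α := Unit)) 1
    (fun i j _ => [.cons (.call i (.var 0)) (.call j (.var 0))]) (fun _ _ _ => rfl)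
  refine ⟨P, pf + pg + 5, _, hP 0 _ rfl, fun x => ?_⟩
  obtain ⟨s, hs, hs'⟩ := hf.call (ρ := [enc x]) (x := x) (.var (i := 0) rfl)
  obtain ⟨t, ht, ht'⟩ := hg.call (ρ := [enc x]) (x := x) (.var (i := 0) rfl)
  have h1 := hf.esize_le x
  have h2 := hg.esize_le x
  refine ⟨_, .cons hs ht, ?_, ?_⟩ <;> simp only [Polynomial.eval_add, esize_pair,
    Polynomial.eval_ofNat] <;> omega

theorem PolyTime.fst {f : α → β × γ} (hf : PolyTime f) : PolyTime (fun x => (f x).1) := by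
  refine PolyTime.comp (g := Prod.fst) (.of_expr (.split (.var 0) .nil (.var 0))
    (Polynomial.X + 3) fun x => ⟨_, .splitCons (.var rfl) (.var rfl), by simp, ?_⟩) hf
  rw [esize_pair]
  simp only [Polynomial.eval_add, Polynomial.eval_X, Polynomial.eval_ofNat]
  omega

theorem PolyTime.snd {f : α → β × γ} (hf : PolyTime f) : PolyTime (fun x => (f x).2) := by
  refine PolyTime.comp (g := Prod.snd) (.of_expr (.split (.var 0) .nil (.var 1))
    (Polynomial.X + 3) fun x => ⟨_, .splitCons (.var rfl) (.var rfl), by simp, ?_⟩) hf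
  rw [esize_pair]
  simp only [Polynomial.eval_add, Polynomial.eval_X, Polynomial.eval_ofNat]
  omega

theorem PolyTime.ite {b : α → Bool} {f g : α → β} (hb : PolyTime b) (hf : PolyTime f)
    (hg : PolyTime g) : PolyTime (fun x => if b x then f x else g x) := by
  obtain ⟨P, i, j, l, pb, pf, pg, hb, hf, hg, hP⟩ := exists_link hb hf hg 1
    -- Taking the value true apart binds two variables, so the argument moves to index 2.
    (fun i j l => [.split (.call i (.var 0)) (.call l (.var 0)) (.call j (.var 2))])
    (fun _ _ _ => rfl)
  refine ⟨P, pb + pf + pg + 6, _, hP 0 _ rfl, fun x => ?_⟩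
  obtain ⟨s, hs, hs'⟩ := hb.call (ρ := [enc x]) (x := x) (.var (i := 0) rfl)
  have h1 := hf.esize_le x
  have h2 := hg.esize_le x
  change ∃ t, Eval P [enc x] _ (enc (if b x = true then f x else g x)) t ∧ _ ∧
    esize (if b x = true then f x else g x) ≤ _
  cases hbx : b x with
  | false =>
    obtain ⟨t, ht, ht'⟩ := hg.call (ρ := [enc x]) (x := x) (.var (i := 0) rfl)
    rw [hbx] at hs
    refine ⟨_, .splitNil hs ht, ?_, ?_⟩ <;> simp only [Polynomial.eval_add,
      Polynomial.eval_ofNat, Bool.false_eq_true, if_false] <;> omega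
  | true =>
    obtain ⟨t, ht, ht'⟩ := hf.call (ρ := [Data.nil, Data.nil, enc x]) (x := x) (.var (i := 2) rfl)
    rw [hbx] at hs
    refine ⟨_, .splitCons hs ht, ?_, ?_⟩ <;> simp only [Polynomial.eval_add,
      Polynomial.eval_ofNat, if_true] <;> omega

theorem PolyTime.cons {f : α → β} {g : α → List β} (hf : PolyTime f) (hg : PolyTime g) :
    PolyTime (fun x => f x :: g x) :=
  (hf.pair hg).of_enc_eq fun _ => rfl

theorem PolyTime.tail {f : α → List β} (hf : PolyTime f) : PolyTime (fun x => (f x).tail) := by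
  refine PolyTime.comp (g := List.tail) (.of_expr (.split (.var 0) .nil (.var 1))
    (Polynomial.X + 3) fun x => ?_) hf
  cases x with
  | nil => exact ⟨_, .splitNil (.var rfl) .nil, by simp, by simp⟩
  | cons a l =>
    refine ⟨_, .splitCons (.var rfl) (.var rfl), by simp, ?_⟩
    simp [esize_cons]
    omega

theorem PolyTime.headD {f : α → List β} {d : α → β} (hf : PolyTime f) (hd : PolyTime d) :
    PolyTime (fun x => (f x).headD (d x)) := by
  refine PolyTime.comp (g := fun y : List β × β => y.1.headD y.2) (.of_expr
    (.split (.var 0) .nil (.split (.var 0) (.var 1) (.var 0)))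
    (Polynomial.X + 5) fun x => ?_) (hf.pair hd)
  obtain ⟨l, y⟩ := x
  cases l with
  | nil =>
    refine ⟨_, .splitCons (.var rfl) (.splitNil (.var rfl) (.var rfl)), by simp, ?_⟩
    simp [esize_pair, esize_nil]
    omega
  | cons a l =>
    refine ⟨_, .splitCons (.var rfl) (.splitCons (.var rfl) (.var rfl)), by simp, ?_⟩
    simp [esize_pair, esize_cons]
    omega

theorem PolyTime.isEmpty {f : α → List β} (hf : PolyTime f) :
    PolyTime (fun x => (f x).isEmpty) := by
  refine PolyTime.comp (g := List.isEmpty) (.of_expr (.split (.var 0) (.cons .nil .nil) .nil)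
    (Polynomial.X + 5) fun x => ?_) hf
  cases x with
  | nil => exact ⟨_, .splitNil (.var rfl) (.cons .nil .nil), by simp, by simp [esize, enc, Data.size, Data.ofBool]⟩
  | cons a l =>
    exact ⟨_, .splitCons (.var rfl) .nil, by simp, by simp [esize, enc, Data.size, Data.ofBool]⟩

/-- Recursion on a list, if the values have polynomial size. -/
theorem PolyTime.foldr {l : α → List β} {i : α → γ} {s : α → β → γ → γ} (hl : PolyTime l)
    (hi : PolyTime i) (hs : PolyTime (fun y : α × β × γ => s y.1 y.2.1 y.2.2))
    (B : Polynomial ℕ)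
    (hB : ∀ x l', l' <:+ l x → esize (l'.foldr (s x) (i x)) ≤ B.eval (esize x)) :
    PolyTime (fun x => (l x).foldr (s x) (i x)) := by
  obtain ⟨P, j₁, j₂, j₃, pl, pi, ps, hl, hi, hs, hP⟩ := exists_link hl hi hs 2
    -- Function 1 recurses on the list and carries the argument along. The bound `B` is needed
    -- because intermediate values might otherwise grow with every entry.
    (fun j₁ j₂ j₃ => [.call 1 (.cons (.var 0) (.call j₁ (.var 0))),
      .split (.var 0) .nil (.split (.var 1) (.call j₂ (.var 0))
        (.call j₃ (.cons (.var 2) (.cons (.var 0) (.call 1 (.cons (.var 2) (.var 1)))))))])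
    (fun _ _ _ => rfl)
  have key : ∀ x l', l' <:+ l x → ∃ t, Eval P [.cons (enc x) (enc l')]
      (.split (.var 0) .nil (.split (.var 1) (.call j₂ (.var 0))
        (.call j₃ (.cons (.var 2) (.cons (.var 0) (.call 1 (.cons (.var 2) (.var 1))))))))
      (enc (l'.foldr (s x) (i x))) t ∧
      t ≤ (l'.length + 1) * (pi.eval (esize x) +
        ps.eval (esize x + esize (l x) + B.eval (esize x) + 2) + 20) := by
    intro x l'
    induction l' with
    | nil =>
      intro _
      obtain ⟨t, ht, ht'⟩ := hi.call (ρ := [enc x, Data.nil, .cons (enc x) .nil]) (x := x)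
        (.var (i := 0) rfl)
      refine ⟨_, .splitCons (.var rfl) (.splitNil (.var rfl) ht), ?_⟩
      simp only [List.length_nil, zero_add, one_mul]
      omega
    | cons a l' ih =>
      intro hsuf
      have hsuf' : l' <:+ l x := (List.suffix_cons a l').trans hsuf
      obtain ⟨t, ht, ht'⟩ := ih hsuf'
      have h1 : Eval P [enc a, enc l', enc x, .cons (enc a) (enc l'),
          .cons (enc x) (.cons (enc a) (enc l'))] (.call 1 (.cons (.var 2) (.var 1)))
          (enc (l'.foldr (s x) (i x))) _ :=
        .call (.cons (.var rfl) (.var rfl)) (hP 1 _ rfl) ht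
      obtain ⟨r, hr, hr'⟩ := hs.call (x := (x, a, l'.foldr (s x) (i x)))
        (.cons (.var (i := 2) rfl) (.cons (.var (i := 0) rfl) h1))
      refine ⟨_, .splitCons (.var rfl) (.splitCons (.var rfl) hr), ?_⟩
      have h2 : esize (x, a, l'.foldr (s x) (i x)) ≤
          esize x + esize (l x) + B.eval (esize x) + 2 := by
        have := hB x l' hsuf'
        have := esize_le_of_mem (hsuf.subset (show a ∈ a :: l' by simp))
        simp only [esize_pair]
        omega
      have h3 := eval_mono ps h2
      rw [List.length_cons, add_mul (l'.length + 1)]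
      omega
  refine ⟨P, pl + B + (pl + 1) * (pi + ps.comp (Polynomial.X + pl + B + 2) + 20) + 10, _,
    hP 0 _ rfl, fun x => ?_⟩
  obtain ⟨t, ht, ht'⟩ := hl.call (ρ := [enc x]) (x := x) (.var (i := 0) rfl)
  obtain ⟨r, hr, hr'⟩ := key x (l x) (List.suffix_refl _)
  have h1 := hl.esize_le x
  have h2 := hB x (l x) (List.suffix_refl _)
  refine ⟨_, .call (.cons (.var rfl) ht) (hP 1 _ rfl) hr, ?_, ?_⟩
  · simp only [Polynomial.eval_add, Polynomial.eval_mul, Polynomial.eval_comp,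
      Polynomial.eval_X, Polynomial.eval_ofNat, Polynomial.eval_one]
    have h3 : r ≤ (pl.eval (esize x) + 1) * (pi.eval (esize x) +
        ps.eval (esize x + pl.eval (esize x) + B.eval (esize x) + 2) + 20) := by
      refine hr'.trans (Nat.mul_le_mul ?_ ?_)
      · have := length_le_esize (l x); omega
      · have := eval_mono ps (show esize x + esize (l x) + B.eval (esize x) + 2 ≤
          esize x + pl.eval (esize x) + B.eval (esize x) + 2 by omega)
        omega
    omega
  · simp only [Polynomial.eval_add]
    omega

theorem PolyTime.append {f g : α → List β} (hf : PolyTime f) (hg : PolyTime g) :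
    PolyTime (fun x => f x ++ g x) := by
  obtain ⟨pf, hf'⟩ := hf.exists_bound
  obtain ⟨pg, hg'⟩ := hg.exists_bound
  have h := PolyTime.foldr (s := fun _ a m => a :: m) hf hg
    (PolyTime.cons (f := fun y : α × β × List β => y.2.1) (g := fun y => y.2.2) PolyTime.id.snd.fst
      PolyTime.id.snd.snd) (pf + pg) (fun x l' hl' => by
        have h1 := hf' x
        have h2 := hg' x
        have h3 := esize_le_of_suffix hl'
        have h4 := esize_append l' (g x)
        rw [List.foldr_cons_eq_append', Polynomial.eval_add]
        omega)
  simpa using h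

end Machine

/-! ### List and number operations in polynomial time -/

section Library

open Enc (enc)

variable {α β γ δ : Type} [Enc α] [Enc β] [Enc γ] [Enc δ]

theorem esize_flatMap_le {l : List α} {f : α → List β} {N : ℕ} (h : ∀ a ∈ l, esize (f a) ≤ N) :
    esize (l.flatMap f) ≤ l.length * N + 1 := by
  induction l with
  | nil => simp [esize_nil]
  | cons a l ih =>
    have h1 := h a (by simp)
    have h2 := ih fun b hb => h b (by simp [hb])
    have h3 := esize_append (f a) (l.flatMap f)
    rw [List.flatMap_cons, List.length_cons, add_mul]
    omega

theorem PolyTime.flatMap {l : α → List β} {f : α → β → List γ} (hl : PolyTime l)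
    (hf : PolyTime (fun y : α × β => f y.1 y.2)) : PolyTime (fun x => (l x).flatMap (f x)) := by
  obtain ⟨pl, hl'⟩ := hl.exists_bound
  obtain ⟨pf, hf'⟩ := hf.exists_bound
  have e : ∀ (x : α) (l' : List β), l'.foldr (fun a acc => f x a ++ acc) [] = l'.flatMap (f x) := by
    intro x l'
    induction l' with
    | nil => rfl
    | cons a l' ih => simp [ih]
  have h := PolyTime.foldr (i := fun _ => []) (s := fun x a acc => f x a ++ acc) hl
    (PolyTime.const []) (PolyTime.append (f := fun y : α × β × List γ => f y.1 y.2.1)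
      (hf.comp (f := fun y : α × β × List γ => (y.1, y.2.1))
        (PolyTime.id.fst.pair PolyTime.id.snd.fst)) PolyTime.id.snd.snd)
    (pl * pf.comp (Polynomial.X + pl + 1) + 1) (fun x l' hl'' => by
      rw [e]
      refine (esize_flatMap_le (N := pf.eval (esize x + pl.eval (esize x) + 1)) ?_).trans ?_
      · intro a ha
        refine (hf' (x, a)).trans (eval_mono _ ?_)
        have := esize_le_of_mem (hl''.subset ha)
        have := hl' x
        rw [esize_pair]
        dsimp only
        omega
      · simp only [Polynomial.eval_add, Polynomial.eval_mul, Polynomial.eval_comp,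
          Polynomial.eval_X, Polynomial.eval_one]
        have := length_le_esize l'
        have := esize_le_of_suffix hl''
        have := hl' x
        gcongr
        omega)
  simpa only [e] using h

theorem PolyTime.map {l : α → List β} {f : α → β → γ} (hl : PolyTime l)
    (hf : PolyTime (fun y : α × β => f y.1 y.2)) : PolyTime (fun x => (l x).map (f x)) := by
  have h := PolyTime.flatMap (f := fun x a => [f x a]) hl (hf.cons (.const []))
  simpa only [← List.map_eq_flatMap] using h

theorem PolyTime.filter {l : α → List β} {p : α → β → Bool} (hl : PolyTime l)
    (hp : PolyTime (fun y : α × β => p y.1 y.2)) : PolyTime (fun x => (l x).filter (p x)) := by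
  have h := PolyTime.flatMap (f := fun x a => if p x a then [a] else []) hl
    (hp.ite (PolyTime.id.snd.cons (.const [])) (.const []))
  have e : ∀ (p : β → Bool) (l : List β), l.flatMap (fun a => if p a then [a] else []) =
      l.filter p := by
    intro p l
    induction l with
    | nil => rfl
    | cons a l ih => cases hpa : p a <;> simp [hpa, ih]
  simpa only [e] using h

theorem PolyTime.or {f g : α → Bool} (hf : PolyTime f) (hg : PolyTime g) :
    PolyTime (fun x => f x || g x) := by
  have h := hf.ite (.const true) hg
  have e : ∀ a b : Bool, (if a then true else b) = (a || b) := by decide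
  simpa only [e] using h

theorem PolyTime.and {f g : α → Bool} (hf : PolyTime f) (hg : PolyTime g) :
    PolyTime (fun x => f x && g x) := by
  have h := hf.ite hg (.const false)
  have e : ∀ a b : Bool, (if a then b else false) = (a && b) := by decide
  simpa only [e] using h

theorem PolyTime.not {f : α → Bool} (hf : PolyTime f) : PolyTime (fun x => !f x) := by
  have h := hf.ite (.const false) (.const true)
  have e : ∀ a : Bool, (if a then false else true) = !a := by decide
  simpa only [e] using h

theorem PolyTime.any {l : α → List β} {p : α → β → Bool} (hl : PolyTime l)
    (hp : PolyTime (fun y : α × β => p y.1 y.2)) : PolyTime (fun x => (l x).any (p x)) := by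
  have h := (PolyTime.filter hl hp).isEmpty.not
  have e : ∀ (p : β → Bool) (l : List β), (!(l.filter p).isEmpty) = l.any p := by
    intro p l
    induction l with
    | nil => rfl
    | cons a l ih => cases hpa : p a <;> simp_all
  simpa only [e] using h

theorem PolyTime.all {l : α → List β} {p : α → β → Bool} (hl : PolyTime l)
    (hp : PolyTime (fun y : α × β => p y.1 y.2)) : PolyTime (fun x => (l x).all (p x)) := by
  have h := (PolyTime.any (p := fun x a => !p x a) hl hp.not).not
  simpa only [List.not_any_eq_all_not, Bool.not_not] using h

theorem enc_nat_eq_enc_replicate (n : ℕ) : enc n = enc (List.replicate n ()) := by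
  induction n with
  | zero => rfl
  | succ n ih =>
    rw [List.replicate_succ, enc_cons, ← ih]
    rfl

theorem PolyTime.replicate {n : α → ℕ} (hn : PolyTime n) :
    PolyTime (fun x => List.replicate (n x) ()) :=
  hn.of_enc_eq fun x => enc_nat_eq_enc_replicate (n x)

theorem PolyTime.length {l : α → List β} (hl : PolyTime l) : PolyTime (fun x => (l x).length) :=
  (PolyTime.map (f := fun _ _ => ()) hl (.const ())).of_enc_eq fun x => by
    rw [enc_nat_eq_enc_replicate, List.map_const']

/-- Numbers are unary lists, so dropping entries also yields subtraction, comparison and indexing.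
-/
theorem PolyTime.drop {l : α → List β} {n : α → ℕ} (hl : PolyTime l) (hn : PolyTime n) :
    PolyTime (fun x => (l x).drop (n x)) := by
  have e : ∀ (m : List β) (u : List Unit), u.foldr (fun _ acc => acc.tail) m = m.drop u.length := by
    intro m u
    induction u with
    | nil => rfl
    | cons a u ih => rw [List.foldr_cons, ih, List.tail_drop, List.length_cons]
  obtain ⟨pl, hl'⟩ := hl.exists_bound
  have h := PolyTime.foldr (s := fun _ _ acc => acc.tail) hn.replicate hl
    (PolyTime.id.snd.snd.tail) pl (fun x l' _ => by
      rw [e]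
      exact (esize_le_of_suffix (List.drop_suffix _ _)).trans (hl' x))
  simpa only [e, List.length_replicate] using h

theorem PolyTime.sub {m n : α → ℕ} (hm : PolyTime m) (hn : PolyTime n) :
    PolyTime (fun x => m x - n x) := by
  have h := (hm.replicate.drop hn).length
  simpa only [List.length_drop, List.length_replicate] using h

theorem PolyTime.le {m n : α → ℕ} (hm : PolyTime m) (hn : PolyTime n) :
    PolyTime (fun x => decide (m x ≤ n x)) := by
  have h := (hm.replicate.drop hn).isEmpty
  have e : ∀ m n : ℕ, ((List.replicate m ()).drop n).isEmpty = decide (m ≤ n) := by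
    intro m n
    rw [Bool.eq_iff_iff]
    simp [Nat.sub_eq_zero_iff_le]
  simpa only [e] using h

theorem PolyTime.natEq {m n : α → ℕ} (hm : PolyTime m) (hn : PolyTime n) :
    PolyTime (fun x => decide (m x = n x)) := by
  have h := (hm.le hn).and (hn.le hm)
  have e : ∀ m n : ℕ, (decide (m ≤ n) && decide (n ≤ m)) = decide (m = n) := by
    intro m n
    rw [Bool.eq_iff_iff]
    simp
    omega
  simpa only [e] using h

theorem PolyTime.getD {l : α → List β} {n : α → ℕ} {d : α → β} (hl : PolyTime l)
    (hn : PolyTime n) (hd : PolyTime d) : PolyTime (fun x => (l x).getD (n x) (d x)) := by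
  have h := (hl.drop hn).headD hd
  have e : ∀ (l : List β) (n : ℕ) (d : β), (l.drop n).headD d = l.getD n d := by
    intro l n d
    rw [List.headD_eq_head?_getD, List.head?_drop, List.getD_eq_getElem?_getD]
  simpa only [e] using h

end Library

/-! ### Running time of the search -/

section Search

open Enc (enc)

/-- The expression that decides whether some member of a list is accepted by function number
`f`; it is to be function number `g`. -/
def anyExpr (f g : ℕ) : Expr :=
  .split (.var 0) .nil (.split (.call f (.var 0)) (.call g (.var 1)) (.cons .nil .nil))

/-- The expression that applies function number `f` and, unless this decides the question,
continues with function number `g` on the list of subproblems. -/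
def searchExpr (f g : ℕ) : Expr :=
  .split (.call f (.var 0)) .nil (.split (.var 0) (.call g (.var 1)) (.cons .nil .nil))

variable {σ : Type} [Enc σ]

/-- Each level of the search tree has total weight at most `c ^ μ s`, and there are at most `μ s +
1` levels since `μ` decreases. The constant pays for one call of `step` and one pass over its
subproblems; the invariant `R` keeps all instances below the size `N`. -/
theorem Eval.search {P : Program} {step : σ → Bool × List σ} {i : ℕ} {p : Polynomial ℕ} {f g : ℕ}
    (hstep : Computes P i step p) (hf : P[f]? = some (searchExpr i g))
    (hg : P[g]? = some (anyExpr f g)) {R : σ → Prop} {μ : σ → ℕ} {ans : σ → Bool} {N : ℕ} {c : ℝ}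
    (hc : 1 ≤ c) (hN : ∀ s, R s → esize s ≤ N) (hR : ∀ s, R s → ∀ s' ∈ (step s).2, R s')
    (hμ : ∀ s, R s → ∀ s' ∈ (step s).2, μ s' < μ s)
    (hw : ∀ s, R s → ((step s).2.map fun s' => c ^ μ s').sum ≤ c ^ μ s)
    (hans : ∀ s, R s → ans s = ((step s).1 || (step s).2.any ans)) (s : σ) (hs : R s) :
    ∃ t, Eval P [enc s] (searchExpr i g) (.ofBool (ans s)) t ∧
      (t : ℝ) ≤ (11 * p.eval N + 40 : ℕ) * ((μ s + 1) * c ^ μ s) := by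
  set K : ℕ := 11 * p.eval N + 40
  induction hm : μ s using Nat.strong_induction_on generalizing s with
  | _ m ih =>
  subst hm
  have hany : ∀ l : List σ, l ⊆ (step s).2 → ∃ t, Eval P [enc l] (anyExpr f g)
      (.ofBool (l.any ans)) t ∧
      (t : ℝ) ≤ (l.map fun s' => (K : ℝ) * ((μ s' + 1) * c ^ μ s')).sum + 10 * l.length + 10 := by
    intro l
    induction l with
    | nil =>
      intro _
      exact ⟨_, .splitNil (.var rfl) .nil, by norm_num⟩
    | cons a l ihl =>
      intro hl
      rw [List.cons_subset] at hl
      obtain ⟨t, ht, ht'⟩ := ih _ (hμ s hs a hl.1) a (hR s hs a hl.1) rfl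
      obtain ⟨r, hr, hr'⟩ := ihl hl.2
      have h1 : Eval P [enc a, enc l, enc (a :: l)] (.call f (.var 0)) (.ofBool (ans a)) _ :=
        .call (.var rfl) hf ht
      have hr0 : (0 : ℝ) ≤ r := by positivity
      rw [List.any_cons, List.map_cons, List.sum_cons, List.length_cons]
      cases haa : ans a with
      | true =>
        rw [haa] at h1
        refine ⟨_, .splitCons (.var rfl) (.splitCons h1 (.cons .nil .nil)), ?_⟩
        push_cast
        linarith
      | false =>
        rw [haa] at h1
        refine ⟨_, .splitCons (.var rfl) (.splitNil h1 (.call (.var rfl) hg hr)), ?_⟩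
        push_cast
        linarith
  obtain ⟨t, ht, ht'⟩ := hstep.call (ρ := [enc s]) (x := s) (.var (i := 0) rfl)
  obtain ⟨r, hr, hr'⟩ := hany (step s).2 (fun _ => id)
  have h1 := hstep.esize_le s
  have h2 := eval_mono p (hN s hs)
  have h3 : (step s).2.length ≤ p.eval N := by
    have := length_le_esize (step s).2
    have := esize_pair (step s)
    omega
  -- As `μ s' + 1 ≤ μ s`, the subproblems leave a share `K * c ^ μ s` for the step itself.
  have hsum : ((step s).2.map fun s' => (K : ℝ) * ((μ s' + 1) * c ^ μ s')).sum ≤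
      K * (μ s * c ^ μ s) := by
    have h4 : ((step s).2.map fun s' => (K : ℝ) * ((μ s' + 1) * c ^ μ s')).sum ≤
        ((step s).2.map fun s' => (K : ℝ) * μ s * c ^ μ s').sum := by
      refine List.sum_le_sum fun s' hs' => ?_
      have h5 : ((μ s' : ℝ) + 1) ≤ μ s := by exact_mod_cast hμ s hs s' hs'
      rw [mul_assoc]
      gcongr
    refine h4.trans ?_
    rw [List.sum_map_mul_left, ← mul_assoc]
    gcongr
    exact hw s hs
  have hK : (11 * p.eval N + 40 : ℝ) ≤ K * c ^ μ s := by
    have : (1 : ℝ) ≤ c ^ μ s := one_le_pow₀ hc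
    have hK' : (K : ℝ) = 11 * p.eval N + 40 := by simp [K]
    rw [← hK']
    exact le_mul_of_one_le_right (by positivity) this
  have ht2 : (t : ℝ) ≤ p.eval N + 2 := by
    have : t ≤ p.eval N + 2 := by omega
    exact_mod_cast this
  have h3' : ((step s).2.length : ℝ) ≤ p.eval N := by exact_mod_cast h3
  have hfin : (K : ℝ) * ((μ s + 1) * c ^ μ s) = K * (μ s * c ^ μ s) + K * c ^ μ s := by ring
  have hr0 : (0 : ℝ) ≤ r := by positivity
  rw [hans s hs]
  cases hflag : (step s).1 with
  | true =>
    have ht3 : Eval P [enc s] (.call i (.var 0)) (.cons (.cons .nil .nil) (enc (step s).2)) t := by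
      rw [enc_pair, hflag] at ht
      exact ht
    refine ⟨_, .splitCons ht3 (.splitCons (.var rfl) (.cons .nil .nil)), ?_⟩
    push_cast
    linarith
  | false =>
    have ht3 : Eval P [enc s] (.call i (.var 0)) (.cons .nil (enc (step s).2)) t := by
      rw [enc_pair, hflag] at ht
      exact ht
    refine ⟨_, .splitCons ht3 (.splitNil (.var rfl) (.call (.var rfl) hg hr)), ?_⟩
    push_cast
    linarith

/-- The expression that computes the minimum of the length of a list and a number, in time
proportional to the length of the list; it is to be function number `f`. -/
def minExpr (f : ℕ) : Expr :=
  .split (.var 0) .nil (.split (.var 0) .nil (.split (.var 3) .nil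
    (.cons .nil (.call f (.cons (.var 3) (.var 1))))))

/-- The unary `k` may be far longer than the graph. The recursion ends with the list, so the time
does not depend on `k`. -/
theorem Eval.min {α : Type} [Enc α] {P : Program} {f : ℕ} (hf : P[f]? = some (minExpr f))
    (l : List α) (k : ℕ) : ∃ t ≤ 20 * l.length + 20,
      Eval P [.cons (enc l) (.ofNat k)] (minExpr f) (.ofNat (min l.length k)) t := by
  induction l generalizing k with
  | nil =>
    rw [List.length_nil, Nat.zero_min]
    exact ⟨_, by simp, .splitCons (.var rfl) (.splitNil (.var rfl) .nil)⟩
  | cons a l ih =>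
    cases k with
    | zero => exact ⟨_, by simp, .splitCons (.var rfl) (.splitCons (.var rfl)
        (.splitNil (.var rfl) .nil))⟩
    | succ k =>
      obtain ⟨t, ht, h⟩ := ih k
      rw [List.length_cons, Nat.add_min_add_right]
      refine ⟨_, ?_, .splitCons (.var rfl) (.splitCons (.var rfl) (.splitCons (.var rfl)
        (.cons .nil (.call (.cons (.var rfl) (.var rfl)) hf h))))⟩
      omega

end Search

/-! ### One search step as a polynomial-time function -/

section Algorithm

/-- Adjacency read off a matrix. -/
def adjM (M : List (List Bool)) (i j : ℕ) : Bool := (M.getD i []).getD j false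

/-- The test for induced paths with middle vertex `y`. -/
def pathM (M : List (List Bool)) (x y z : ℕ) : Bool :=
  adjM M x y && adjM M y z && !adjM M x z && !decide (x = z)

/-- The test for induced paths on three vertices. -/
def p3M (M : List (List Bool)) (x y z : ℕ) : Bool :=
  pathM M x y z || pathM M y z x || pathM M z x y

/-- The list version of `conflicts`. -/
def conflictsL (M : List (List Bool)) (A : List ℕ) (v u : ℕ) : List ℕ := A.filter (p3M M v u)

/-- The list without the entry `u`. -/
def eraseL (A : List ℕ) (u : ℕ) : List ℕ := A.filter fun s => !decide (s = u)

/-- The list without the entries of `D`. -/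
def sdiffL (A D : List ℕ) : List ℕ := A.filter fun s => !D.any fun d => decide (s = d)

/-- The list version of `twins`. -/
def twinsL (M : List (List Bool)) (A : List ℕ) (v : ℕ) : List ℕ :=
  A.filter fun u => A.all fun s =>
    if decide (s = u) || adjM M s u then decide (s = v) || adjM M s v
    else !(decide (s = v) || adjM M s v)

/-- The test for `Settled`. -/
def settledL (M : List (List Bool)) (A : List ℕ) (v : ℕ) : Bool :=
  A.all fun y => A.all fun z => !p3M M v y z

/-- The test for `Cluster`. -/
def clusterL (M : List (List Bool)) (A : List ℕ) : Bool := A.all fun x => settledL M A x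

/-- The families of all branching trees. -/
def trees (M : List (List Bool)) (v : ℕ) : ℕ → List ℕ → List (List (List ℕ))
  | 0, A => [[A]]
  | L + 1, A => [A] :: A.flatMap fun u =>
      if adjM M v u then
        (if decide ((conflictsL M A v u).length = 1) then trees M v L (sdiffL A (conflictsL M A v u))
          else []) ++
        (trees M v L (eraseL A u)).flatMap fun F₁ =>
          (trees M v L (sdiffL A (conflictsL M A v u))).map fun F₂ => F₁ ++ F₂
      else []

/-- The families of `KeepFamily`. -/
def keepFamilies (M : List (List Bool)) (L : ℕ) (A : List ℕ) : List (List (List ℕ)) :=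
  A.flatMap fun v => A.flatMap fun x => A.flatMap fun y =>
    if (!decide (v = x) && !decide (v = y)) && (settledL M (sdiffL A [x, y]) v &&
        decide ((if decide (x = y) then 1 else 2) ≤ (twinsL M A v).length)) then
      trees M v L A else []

/-- The families of `RuleFamily`. -/
def ruleFamilies (M : List (List Bool)) (L : ℕ) (A : List ℕ) : List (List (List ℕ)) :=
  keepFamilies M L A ++
  ((A.flatMap fun v => (trees M v L A).map fun F => sdiffL A (twinsL M A v) :: F) ++
  ((A.flatMap fun v => A.flatMap fun a => A.flatMap fun b =>
    if (!decide (v = a) && !decide (v = b)) && settledL M (sdiffL A [a, b]) v then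
      (trees M v L A).map fun F => sdiffL (eraseL A v) (conflictsL M A a b) :: F
    else []) ++
  (A.flatMap fun w => (keepFamilies M L (eraseL A w)).flatMap fun F₁ =>
    (trees M w L A).map fun F₂ => F₁ ++ F₂)))

/-- Integral weights, proportional to the powers of `γ` up to rounding. -/
noncomputable def intWeight (j : ℕ) : ℕ := ⌊(10 ^ 6 : ℝ) * γ ^ j⌋₊ + 1

/-- The weight of the deletion of `j` vertices, read off a finite table. -/
noncomputable def tableWeight (j : ℕ) : ℕ :=
  ((List.range 24).map intWeight).getD j (intWeight 24)

/-- The test whether a family has small weight. -/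
noncomputable def lightL (A : List ℕ) (F : List (List ℕ)) : Bool :=
  decide ((F.flatMap fun A' =>
    List.replicate (tableWeight (A.length - A'.length)) ()).length ≤ 10 ^ 6)

/-- One step of the algorithm: the answer is found, or the subproblems are listed. -/
noncomputable def step (s : List (List Bool) × List ℕ × ℕ) :
    Bool × List (List (List Bool) × List ℕ × ℕ) :=
  if clusterL s.1 s.2.1 then (true, [])
  else (false, (((((ruleFamilies s.1 4 s.2.1).filter fun F => lightL s.2.1 F).headD []).filter
    fun A' => decide (s.2.1.length - A'.length ≤ s.2.2)).map
      fun A' => (s.1, A', s.2.2 - (s.2.1.length - A'.length))))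

variable {α β : Type} [Enc α] [Enc β]

theorem PolyTime.lift {f : α → β} (h : PolyTime f) {γ : Type} [Enc γ] :
    PolyTime (fun y : α × γ => f y.1) := h.comp PolyTime.id.fst

theorem PolyTime.last : PolyTime (fun y : α × β => y.2) := PolyTime.id.snd

variable {M : α → List (List Bool)} {A D : α → List ℕ} {x y z v u : α → ℕ}

theorem PolyTime.adjM (hM : PolyTime M) (hx : PolyTime x) (hy : PolyTime y) :
    PolyTime (fun a => adjM (M a) (x a) (y a)) :=
  (hM.getD hx (.const [])).getD hy (.const false)

theorem PolyTime.pathM (hM : PolyTime M) (hx : PolyTime x) (hy : PolyTime y) (hz : PolyTime z) :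
    PolyTime (fun a => pathM (M a) (x a) (y a) (z a)) :=
  (((hM.adjM hx hy).and (hM.adjM hy hz)).and (hM.adjM hx hz).not).and (hx.natEq hz).not

theorem PolyTime.p3M (hM : PolyTime M) (hx : PolyTime x) (hy : PolyTime y) (hz : PolyTime z) :
    PolyTime (fun a => p3M (M a) (x a) (y a) (z a)) :=
  ((hM.pathM hx hy hz).or (hM.pathM hy hz hx)).or (hM.pathM hz hx hy)

theorem PolyTime.conflictsL (hM : PolyTime M) (hA : PolyTime A) (hv : PolyTime v)
    (hu : PolyTime u) : PolyTime (fun a => conflictsL (M a) (A a) (v a) (u a)) := by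
  unfold ClusterVD.conflictsL
  exact hA.filter (hM.lift.p3M hv.lift hu.lift .last)

theorem PolyTime.eraseL (hA : PolyTime A) (hu : PolyTime u) :
    PolyTime (fun a => eraseL (A a) (u a)) := by
  unfold ClusterVD.eraseL
  exact hA.filter (PolyTime.last.natEq hu.lift).not

theorem PolyTime.sdiffL (hA : PolyTime A) (hD : PolyTime D) :
    PolyTime (fun a => sdiffL (A a) (D a)) := by
  unfold ClusterVD.sdiffL
  refine hA.filter (PolyTime.not ?_)
  exact hD.lift.any (PolyTime.last.lift.natEq .last)

theorem PolyTime.twinsL (hM : PolyTime M) (hA : PolyTime A) (hv : PolyTime v) :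
    PolyTime (fun a => twinsL (M a) (A a) (v a)) := by
  unfold ClusterVD.twinsL
  refine hA.filter (hA.lift.all ?_)
  have h1 := (PolyTime.last.natEq hv.lift.lift).or
    (hM.lift.lift.adjM (α := (α × ℕ) × ℕ) .last hv.lift.lift)
  have h2 := (PolyTime.last.natEq (PolyTime.last (α := α) (β := ℕ)).lift).or
    (hM.lift.lift.adjM (α := (α × ℕ) × ℕ) .last PolyTime.last.lift)
  exact h2.ite h1 h1.not

theorem PolyTime.settledL (hM : PolyTime M) (hA : PolyTime A) (hv : PolyTime v) :
    PolyTime (fun a => settledL (M a) (A a) (v a)) := by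
  unfold ClusterVD.settledL
  refine hA.all (hA.lift.all (PolyTime.not ?_))
  exact hM.lift.lift.p3M hv.lift.lift PolyTime.last.lift .last

theorem PolyTime.clusterL (hM : PolyTime M) (hA : PolyTime A) :
    PolyTime (fun a => clusterL (M a) (A a)) := by
  unfold ClusterVD.clusterL
  exact hA.all (hM.lift.settledL hA.lift .last)

/-- The depth is a constant: each level adds one construction on top of the previous, and the
polynomial may depend on `L`. -/
theorem PolyTime.trees (L : ℕ) (hM : PolyTime M) (hv : PolyTime v) (hA : PolyTime A) :
    PolyTime (fun a => trees (M a) (v a) L (A a)) := by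
  suffices h : PolyTime (fun y : List (List Bool) × ℕ × List ℕ =>
      ClusterVD.trees y.1 y.2.1 L y.2.2) from h.comp (hM.pair (hv.pair hA))
  clear hM hv hA
  induction L with
  | zero =>
    unfold ClusterVD.trees
    exact (PolyTime.id.snd.snd.cons (.const [])).cons (.const [])
  | succ L ih =>
    unfold ClusterVD.trees
    have hM : PolyTime (fun y : List (List Bool) × ℕ × List ℕ => y.1) := PolyTime.id.fst
    have hv : PolyTime (fun y : List (List Bool) × ℕ × List ℕ => y.2.1) := PolyTime.id.snd.fst
    have hA : PolyTime (fun y : List (List Bool) × ℕ × List ℕ => y.2.2) := PolyTime.id.snd.snd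
    have hu : PolyTime (fun y : (List (List Bool) × ℕ × List ℕ) × ℕ => y.2) := .last
    have hc := hM.lift.conflictsL hA.lift hv.lift hu
    have h1 := ih.comp (hM.lift.pair (hv.lift.pair (hA.lift.sdiffL hc)))
    have h2 := ih.comp (hM.lift.pair (hv.lift.pair (hA.lift.eraseL hu)))
    refine (hA.cons (.const [])).cons (hA.flatMap (.ite (hM.lift.adjM hv.lift hu) (.append
      (.ite (hc.length.natEq (.const 1)) h1 (.const [])) (h2.flatMap (h1.lift.map ?_)))
      (.const [])))
    exact PolyTime.last.lift.append .last

theorem PolyTime.keepFamilies (L : ℕ) (hM : PolyTime M) (hA : PolyTime A) :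
    PolyTime (fun a => keepFamilies (M a) L (A a)) := by
  unfold ClusterVD.keepFamilies
  have hv : PolyTime (fun y : ((α × ℕ) × ℕ) × ℕ => y.1.1.2) := PolyTime.last.lift.lift
  have hx : PolyTime (fun y : ((α × ℕ) × ℕ) × ℕ => y.1.2) := PolyTime.last.lift
  have hy : PolyTime (fun y : ((α × ℕ) × ℕ) × ℕ => y.2) := PolyTime.last
  have hM' := hM.lift (γ := ℕ) |>.lift (γ := ℕ) |>.lift (γ := ℕ)
  have hA' := hA.lift (γ := ℕ) |>.lift (γ := ℕ) |>.lift (γ := ℕ)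
  refine hA.flatMap (hA.lift.flatMap (hA.lift.lift.flatMap (.ite (.and (.and (hv.natEq hx).not
    (hv.natEq hy).not) (.and (hM'.settledL (hA'.sdiffL (hx.cons (hy.cons (.const [])))) hv)
    (.le (.ite (hx.natEq hy) (.const 1) (.const 2)) (hM'.twinsL hA' hv).length)))
    (.trees L hM' hv hA') (.const []))))

theorem PolyTime.ruleFamilies (L : ℕ) (hM : PolyTime M) (hA : PolyTime A) :
    PolyTime (fun a => ruleFamilies (M a) L (A a)) := by
  unfold ClusterVD.ruleFamilies
  have hM₁ := hM.lift (γ := ℕ)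
  have hA₁ := hA.lift (γ := ℕ)
  have hv₁ : PolyTime (fun y : α × ℕ => y.2) := .last
  have hv : PolyTime (fun y : ((α × ℕ) × ℕ) × ℕ => y.1.1.2) := PolyTime.last.lift.lift
  have hx : PolyTime (fun y : ((α × ℕ) × ℕ) × ℕ => y.1.2) := PolyTime.last.lift
  have hy : PolyTime (fun y : ((α × ℕ) × ℕ) × ℕ => y.2) := PolyTime.last
  have hM' := hM.lift (γ := ℕ) |>.lift (γ := ℕ) |>.lift (γ := ℕ)
  have hA' := hA.lift (γ := ℕ) |>.lift (γ := ℕ) |>.lift (γ := ℕ)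
  refine (PolyTime.keepFamilies L hM hA).append (.append ?_ (.append ?_ ?_))
  · exact hA.flatMap ((PolyTime.trees L hM₁ hv₁ hA₁).map
      ((hA₁.lift.sdiffL (hM₁.twinsL hA₁ hv₁).lift).cons .last))
  · exact hA.flatMap (hA.lift.flatMap (hA.lift.lift.flatMap (.ite (.and (.and (hv.natEq hx).not
      (hv.natEq hy).not) (hM'.settledL (hA'.sdiffL (hx.cons (hy.cons (.const [])))) hv))
      ((PolyTime.trees L hM' hv hA').map (((hA'.eraseL hv).sdiffL
        (hM'.conflictsL hA' hx hy)).lift.cons .last)) (.const []))))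
  · exact hA.flatMap ((PolyTime.keepFamilies L hM₁ (hA₁.eraseL hv₁)).flatMap
      ((PolyTime.trees L hM₁ hv₁ hA₁).lift.map (PolyTime.last.lift.append .last)))

/-- Real powers enter only through a finite table, which is a literal of the program. -/
theorem PolyTime.tableWeight (hx : PolyTime x) : PolyTime (fun a => tableWeight (x a)) :=
  (PolyTime.const ((List.range 24).map intWeight)).getD hx (.const (intWeight 24))

theorem PolyTime.lightL {F : α → List (List ℕ)} (hA : PolyTime A) (hF : PolyTime F) :
    PolyTime (fun a => lightL (A a) (F a)) := by
  unfold ClusterVD.lightL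
  exact .le (hF.flatMap (PolyTime.tableWeight (hA.lift.length.sub PolyTime.last.length)).replicate).length
    (.const _)

theorem PolyTime.step : PolyTime step := by
  unfold ClusterVD.step
  have hM : PolyTime (fun y : List (List Bool) × List ℕ × ℕ => y.1) := PolyTime.id.fst
  have hA : PolyTime (fun y : List (List Bool) × List ℕ × ℕ => y.2.1) := PolyTime.id.snd.fst
  have hk : PolyTime (fun y : List (List Bool) × List ℕ × ℕ => y.2.2) := PolyTime.id.snd.snd
  have hc : PolyTime (fun y : (List (List Bool) × List ℕ × ℕ) × List ℕ =>
      y.1.2.1.length - y.2.length) := hA.lift.length.sub PolyTime.last.length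
  refine .ite (hM.clusterL hA) (.const _) (.pair (.const false) (.map (.filter (.headD
    (.filter (PolyTime.ruleFamilies 4 hM hA) ?_) (.const [])) (hc.le hk.lift))
    (.pair hM.lift (.pair .last (hk.lift.sub hc)))))
  exact hA.lift.lightL .last

end Algorithm

/-! ### Lists against sets, and rounding of weights -/

section Correctness

variable {M : List (List Bool)} {G : SimpleGraph ℕ} [DecidableRel G.Adj]

theorem p3M_iff (hM : ∀ i j, adjM M i j = true ↔ G.Adj i j) (x y z : ℕ) :
    p3M M x y z = true ↔ P3 G x y z := by
  have hM' : ∀ i j, adjM M i j = false ↔ ¬ G.Adj i j := fun i j => by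
    rw [← hM, Bool.not_eq_true]
  simp [p3M, pathM, P3, hM, hM', and_assoc, or_assoc]

theorem toFinset_conflictsL (hM : ∀ i j, adjM M i j = true ↔ G.Adj i j) (A : List ℕ) (v u : ℕ) :
    (conflictsL M A v u).toFinset = conflicts G A.toFinset v u := by
  ext s
  simp [conflictsL, mem_conflicts, p3M_iff hM]

theorem toFinset_eraseL (A : List ℕ) (u : ℕ) : (eraseL A u).toFinset = A.toFinset.erase u := by
  ext s
  simp [eraseL, and_comm]

theorem toFinset_sdiffL (A D : List ℕ) : (sdiffL A D).toFinset = A.toFinset \ D.toFinset := by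
  ext s
  simp only [sdiffL, List.mem_toFinset, List.mem_filter, Finset.mem_sdiff]
  simp
  intro _
  exact ⟨fun h hs => h s hs rfl, fun h x hx e => h (e ▸ hx)⟩

theorem toFinset_twinsL (hM : ∀ i j, adjM M i j = true ↔ G.Adj i j) (A : List ℕ) (v : ℕ) :
    (twinsL M A v).toFinset = twins G A.toFinset v := by
  ext u
  simp only [twinsL, List.mem_toFinset, List.mem_filter, mem_twins, List.all_eq_true]
  refine and_congr_right fun _ => forall₂_congr fun s _ => ?_
  by_cases h : s = u ∨ G.Adj s u
  · simp [hM, h]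
  · simp only [h, false_iff, Bool.or_eq_true, decide_eq_true_eq, hM, if_false, Bool.not_eq_true',
      ← Bool.not_eq_true]

theorem settledL_iff (hM : ∀ i j, adjM M i j = true ↔ G.Adj i j) (A : List ℕ) (v : ℕ) :
    settledL M A v = true ↔ Settled G A.toFinset v := by
  have hp : ∀ x y z, p3M M x y z = false ↔ ¬ P3 G x y z := fun x y z => by
    rw [← p3M_iff hM, Bool.not_eq_true]
  simp [settledL, Settled, hp]

theorem clusterL_iff (hM : ∀ i j, adjM M i j = true ↔ G.Adj i j) (A : List ℕ) :
    clusterL M A = true ↔ Cluster G A.toFinset := by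
  simp only [clusterL, List.all_eq_true, settledL_iff hM]
  simp [Cluster, Settled]

theorem conflictsL_sublist (A : List ℕ) (v u : ℕ) : (conflictsL M A v u).Sublist A :=
  List.filter_sublist
theorem eraseL_sublist (A : List ℕ) (u : ℕ) : (eraseL A u).Sublist A := List.filter_sublist
theorem sdiffL_sublist (A D : List ℕ) : (sdiffL A D).Sublist A := List.filter_sublist
theorem twinsL_sublist (A : List ℕ) (v : ℕ) : (twinsL M A v).Sublist A := List.filter_sublist

/-- The lists of `F` are sublists of `A`, and their sets form the family `F₀`. -/
def Lists (A : List ℕ) (F : List (List ℕ)) (F₀ : List (Finset ℕ)) : Prop :=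
  (∀ A' ∈ F, A'.Sublist A) ∧ F.map List.toFinset = F₀

theorem Lists.append {A : List ℕ} {F₁ F₂ : List (List ℕ)} {E₁ E₂ : List (Finset ℕ)}
    (h₁ : Lists A F₁ E₁) (h₂ : Lists A F₂ E₂) : Lists A (F₁ ++ F₂) (E₁ ++ E₂) := by
  refine ⟨fun A' h => (List.mem_append.1 h).elim (h₁.1 A') (h₂.1 A'), ?_⟩
  rw [List.map_append, h₁.2, h₂.2]

theorem Lists.cons {A B : List ℕ} {F : List (List ℕ)} {E : List (Finset ℕ)} {S : Finset ℕ}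
    (hB : B.Sublist A) (hS : B.toFinset = S) (h : Lists A F E) : Lists A (B :: F) (S :: E) :=
  Lists.append (F₁ := [B]) (E₁ := [S]) ⟨by simpa using hB, by simpa using hS⟩ h

theorem Lists.mono {A A' : List ℕ} {F : List (List ℕ)} {E : List (Finset ℕ)} (h : Lists A F E)
    (hA : A.Sublist A') : Lists A' F E :=
  ⟨fun B hB => (h.1 B hB).trans hA, h.2⟩

/-- Without duplicates, lengths are cardinalities, so the tests on lists are the conditions on sets.
-/
theorem exists_tree_of_mem_trees (hM : ∀ i j, adjM M i j = true ↔ G.Adj i j) {v L : ℕ}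
    {A : List ℕ} (hA : A.Nodup) {F : List (List ℕ)} (hF : F ∈ trees M v L A) :
    ∃ F₀, Lists A F F₀ ∧ Tree G v L A.toFinset F₀ := by
  induction L generalizing A F with
  | zero =>
    rw [trees, List.mem_singleton] at hF
    subst hF
    exact ⟨_, ⟨by simp, rfl⟩, .leaf _ _⟩
  | succ L ih =>
    rw [trees, List.mem_cons, List.mem_flatMap] at hF
    rcases hF with rfl | ⟨u, hu, hF⟩
    · exact ⟨_, ⟨by simp, rfl⟩, .leaf _ _⟩
    · rw [List.mem_ite_nil_right] at hF
      obtain ⟨hvu, hF⟩ := hF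
      have hs := sdiffL_sublist A (conflictsL M A v u)
      have he := eraseL_sublist A u
      have hu' : u ∈ A.toFinset := by simpa using hu
      have hs' := toFinset_sdiffL A (conflictsL M A v u)
      rw [toFinset_conflictsL hM] at hs'
      rcases List.mem_append.1 hF with hF | hF
      · rw [List.mem_ite_nil_right, decide_eq_true_eq,
          ← List.toFinset_card_of_nodup (hA.sublist (conflictsL_sublist _ _ _)),
          toFinset_conflictsL hM] at hF
        obtain ⟨F₀, h1, h2⟩ := ih (hA.sublist hs) hF.2
        exact ⟨F₀, h1.mono hs, .forced hu' ((hM _ _).1 hvu) hF.1 (hs' ▸ h2)⟩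
      · obtain ⟨F₁, hF₁, hF⟩ := List.mem_flatMap.1 hF
        obtain ⟨F₂, hF₂, rfl⟩ := List.mem_map.1 hF
        obtain ⟨E₁, h1, h2⟩ := ih (hA.sublist he) hF₁
        obtain ⟨E₂, h3, h4⟩ := ih (hA.sublist hs) hF₂
        exact ⟨_, (h1.mono he).append (h3.mono hs), .branch hu' ((hM _ _).1 hvu)
          (toFinset_eraseL A u ▸ h2) (hs' ▸ h4)⟩

theorem exists_mem_trees_of_tree (hM : ∀ i j, adjM M i j = true ↔ G.Adj i j) {v L : ℕ}
    {S : Finset ℕ} {F₀ : List (Finset ℕ)} (h : Tree G v L S F₀) {A : List ℕ} (hA : A.Nodup)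
    (hS : A.toFinset = S) : ∃ F ∈ trees M v L A, Lists A F F₀ := by
  induction h generalizing A with
  | leaf L S =>
    refine ⟨[A], ?_, by simp, by simp [hS]⟩
    cases L <;> simp [trees]
  | @forced L S F u hu hvu h1 hF ih =>
    subst hS
    have hs := sdiffL_sublist A (conflictsL M A v u)
    obtain ⟨F', h2, h3⟩ := ih (hA.sublist hs) (by rw [toFinset_sdiffL, toFinset_conflictsL hM])
    refine ⟨F', ?_, h3.mono hs⟩
    rw [← toFinset_conflictsL hM,
      List.toFinset_card_of_nodup (hA.sublist (conflictsL_sublist _ _ _))] at h1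
    rw [trees, List.mem_cons, List.mem_flatMap]
    refine Or.inr ⟨u, by simpa using hu, ?_⟩
    rw [if_pos ((hM _ _).2 hvu), if_pos (by simpa using h1)]
    exact List.mem_append_left _ h2
  | @branch L S F₁ F₂ u hu hvu h₁ h₂ ih₁ ih₂ =>
    subst hS
    have hs := sdiffL_sublist A (conflictsL M A v u)
    have he := eraseL_sublist A u
    obtain ⟨E₁, h1, h2⟩ := ih₁ (hA.sublist he) (toFinset_eraseL A u)
    obtain ⟨E₂, h3, h4⟩ := ih₂ (hA.sublist hs) (by rw [toFinset_sdiffL, toFinset_conflictsL hM])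
    refine ⟨_, ?_, (h2.mono he).append (h4.mono hs)⟩
    rw [trees, List.mem_cons, List.mem_flatMap]
    refine Or.inr ⟨u, by simpa using hu, ?_⟩
    rw [if_pos ((hM _ _).2 hvu)]
    exact List.mem_append_right _ (List.mem_flatMap.2 ⟨E₁, h1, List.mem_map_of_mem h3⟩)

theorem settledL_sdiffL_iff (hM : ∀ i j, adjM M i j = true ↔ G.Adj i j) (A : List ℕ)
    (v x y : ℕ) : settledL M (sdiffL A [x, y]) v = true ↔ Settled G (A.toFinset \ {x, y}) v := by
  rw [settledL_iff hM, toFinset_sdiffL]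
  simp

theorem keepTest_iff (hM : ∀ i j, adjM M i j = true ↔ G.Adj i j) {A : List ℕ} (hA : A.Nodup)
    (v x y : ℕ) : ((!decide (v = x) && !decide (v = y)) && (settledL M (sdiffL A [x, y]) v &&
        decide ((if decide (x = y) then 1 else 2) ≤ (twinsL M A v).length))) = true ↔
      v ≠ x ∧ v ≠ y ∧ Settled G (A.toFinset \ {x, y}) v ∧
        ({x, y} : Finset ℕ).card ≤ (twins G A.toFinset v).card := by
  have : ({x, y} : Finset ℕ).card = if decide (x = y) then 1 else 2 := by
    by_cases h : x = y
    · simp [h]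
    · simp [h, Finset.card_pair h]
  rw [this, ← toFinset_twinsL hM, List.toFinset_card_of_nodup (hA.sublist (twinsL_sublist _ _)),
    ← settledL_sdiffL_iff hM]
  simp only [Bool.and_eq_true, Bool.not_eq_true', decide_eq_false_iff_not, decide_eq_true_eq]
  tauto

theorem exists_keepFamily_of_mem (hM : ∀ i j, adjM M i j = true ↔ G.Adj i j) {L : ℕ}
    {A : List ℕ} (hA : A.Nodup) {F : List (List ℕ)} (hF : F ∈ keepFamilies M L A) :
    ∃ F₀, Lists A F F₀ ∧ KeepFamily G L A.toFinset F₀ := by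
  simp only [keepFamilies, List.mem_flatMap] at hF
  obtain ⟨v, hv, x, hx, y, hy, hF⟩ := hF
  rw [List.mem_ite_nil_right, keepTest_iff hM hA] at hF
  obtain ⟨⟨h1, h2, h3, h4⟩, hF⟩ := hF
  obtain ⟨F₀, h5, h6⟩ := exists_tree_of_mem_trees hM hA hF
  exact ⟨F₀, h5, v, by simpa, x, by simpa, y, by simpa, h1, h2, h3, h4, h6⟩

theorem exists_mem_of_keepFamily (hM : ∀ i j, adjM M i j = true ↔ G.Adj i j) {L : ℕ}
    {A : List ℕ} (hA : A.Nodup) {F₀ : List (Finset ℕ)} (h : KeepFamily G L A.toFinset F₀) :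
    ∃ F ∈ keepFamilies M L A, Lists A F F₀ := by
  obtain ⟨v, hv, x, hx, y, hy, h1, h2, h3, h4, h5⟩ := h
  obtain ⟨F, h6, h7⟩ := exists_mem_trees_of_tree hM h5 hA rfl
  refine ⟨F, ?_, h7⟩
  simp only [keepFamilies, List.mem_flatMap]
  refine ⟨v, by simpa using hv, x, by simpa using hx, y, by simpa using hy, ?_⟩
  rwa [if_pos ((keepTest_iff hM hA v x y).2 ⟨h1, h2, h3, h4⟩)]

theorem exists_ruleFamily_of_mem (hM : ∀ i j, adjM M i j = true ↔ G.Adj i j) {L : ℕ}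
    {A : List ℕ} (hA : A.Nodup) {F : List (List ℕ)} (hF : F ∈ ruleFamilies M L A) :
    ∃ F₀, Lists A F F₀ ∧ RuleFamily G L A.toFinset F₀ := by
  simp only [ruleFamilies, List.mem_append, List.mem_flatMap] at hF
  rcases hF with hF | ⟨v, hv, hF⟩ | ⟨v, hv, a, ha, b, hb, hF⟩ | ⟨w, hw, F₁, hF₁, hF⟩
  · obtain ⟨F₀, h1, h2⟩ := exists_keepFamily_of_mem hM hA hF
    exact ⟨F₀, h1, Or.inl h2⟩
  · obtain ⟨F', hF', rfl⟩ := List.mem_map.1 hF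
    obtain ⟨F₀, h1, h2⟩ := exists_tree_of_mem_trees hM hA hF'
    exact ⟨_, h1.cons (sdiffL_sublist _ _) (by rw [toFinset_sdiffL, toFinset_twinsL hM]),
      Or.inr (Or.inl ⟨v, by simpa, F₀, h2, rfl⟩)⟩
  · simp only [List.mem_ite_nil_right, Bool.and_eq_true, Bool.not_eq_true',
      decide_eq_false_iff_not, settledL_sdiffL_iff hM] at hF
    obtain ⟨h, hF⟩ := hF
    obtain ⟨F', hF', rfl⟩ := List.mem_map.1 hF
    obtain ⟨F₀, h1, h2⟩ := exists_tree_of_mem_trees hM hA hF'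
    refine ⟨_, h1.cons ((sdiffL_sublist _ _).trans (eraseL_sublist _ _)) rfl,
      Or.inr (Or.inr (Or.inl ⟨v, by simpa, a, by simpa, b, by simpa, h.1.1, h.1.2, h.2, F₀, h2,
        ?_⟩))⟩
    rw [toFinset_sdiffL, toFinset_eraseL, toFinset_conflictsL hM]
  · obtain ⟨F₂, hF₂, rfl⟩ := List.mem_map.1 hF
    obtain ⟨E₁, h1, h2⟩ := exists_keepFamily_of_mem hM (hA.sublist (eraseL_sublist _ _)) hF₁
    obtain ⟨E₂, h3, h4⟩ := exists_tree_of_mem_trees hM hA hF₂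
    rw [toFinset_eraseL] at h2
    exact ⟨_, (h1.mono (eraseL_sublist _ _)).append h3,
      Or.inr (Or.inr (Or.inr ⟨w, by simpa, E₁, E₂, h2, h4, rfl⟩))⟩

theorem exists_mem_of_ruleFamily (hM : ∀ i j, adjM M i j = true ↔ G.Adj i j) {L : ℕ}
    {A : List ℕ} (hA : A.Nodup) {F₀ : List (Finset ℕ)} (h : RuleFamily G L A.toFinset F₀) :
    ∃ F ∈ ruleFamilies M L A, Lists A F F₀ := by
  simp only [ruleFamilies, List.mem_append, List.mem_flatMap]
  rcases h with h | ⟨v, hv, F', hT, rfl⟩ | ⟨v, hv, a, ha, b, hb, hva, hvb, hS, F', hT, rfl⟩ |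
    ⟨w, hw, F₁, F₂, hK, hT, rfl⟩
  · obtain ⟨F, h1, h2⟩ := exists_mem_of_keepFamily hM hA h
    exact ⟨F, Or.inl h1, h2⟩
  · obtain ⟨F, h1, h2⟩ := exists_mem_trees_of_tree hM hT hA rfl
    exact ⟨_, Or.inr (Or.inl ⟨v, by simpa using hv, List.mem_map_of_mem h1⟩),
      h2.cons (sdiffL_sublist _ _) (by rw [toFinset_sdiffL, toFinset_twinsL hM])⟩
  · obtain ⟨F, h1, h2⟩ := exists_mem_trees_of_tree hM hT hA rfl
    refine ⟨_, Or.inr (Or.inr (Or.inl ⟨v, by simpa using hv, a, by simpa using ha, b,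
      by simpa using hb, ?_⟩)), h2.cons ((sdiffL_sublist _ (conflictsL M A a b)).trans
        (eraseL_sublist _ v)) (by rw [toFinset_sdiffL, toFinset_eraseL, toFinset_conflictsL hM])⟩
    rw [if_pos]
    · exact List.mem_map_of_mem h1
    · simp only [Bool.and_eq_true, Bool.not_eq_true', decide_eq_false_iff_not,
        settledL_sdiffL_iff hM]
      exact ⟨⟨hva, hvb⟩, hS⟩
  · rw [← toFinset_eraseL] at hK
    obtain ⟨E₁, h1, h2⟩ := exists_mem_of_keepFamily hM (hA.sublist (eraseL_sublist _ _)) hK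
    obtain ⟨E₂, h3, h4⟩ := exists_mem_trees_of_tree hM hT hA rfl
    exact ⟨_, Or.inr (Or.inr (Or.inr ⟨w, by simpa using hw, E₁, h1, List.mem_map_of_mem h3⟩)),
      (h2.mono (eraseL_sublist _ _)).append h4⟩

/-- The number of leaves bounds the total rounding error. -/
theorem Tree.length_le {v L : ℕ} {S : Finset ℕ} {F : List (Finset ℕ)} (h : Tree G v L S F) :
    F.length ≤ 2 ^ L := by
  induction h with
  | leaf L A => simpa using Nat.one_le_two_pow
  | forced _ _ _ _ ih => rw [pow_succ]; omega
  | branch _ _ _ _ ih₁ ih₂ => rw [List.length_append, pow_succ]; omega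

theorem RuleFamily.length_le {L : ℕ} {S : Finset ℕ} {F : List (Finset ℕ)}
    (h : RuleFamily G L S F) : F.length ≤ 2 * 2 ^ L := by
  have h1 := Nat.one_le_two_pow (n := L)
  rcases h with ⟨v, _, x, _, y, _, _, _, _, _, hT⟩ | ⟨v, _, F', hT, rfl⟩ |
    ⟨v, _, a, _, b, _, _, _, _, F', hT, rfl⟩ |
    ⟨w, _, F₁, F₂, ⟨v, _, x, _, y, _, _, _, _, _, hT'⟩, hT, rfl⟩
  · have := hT.length_le
    omega
  · have := hT.length_le
    rw [List.length_cons]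
    omega
  · have := hT.length_le
    rw [List.length_cons]
    omega
  · have := hT.length_le
    have := hT'.length_le
    rw [List.length_append]
    omega

/-- Rounding is upwards, and `γ ^ 24` dominates everything beyond the table. A family that passes
the test thus has true weight at most 1. -/
theorem γ_pow_le_tableWeight (j : ℕ) : (10 ^ 6 : ℝ) * γ ^ j ≤ tableWeight j := by
  have h : ∀ j, (10 ^ 6 : ℝ) * γ ^ j ≤ intWeight j := fun j => by
    rw [intWeight]
    push_cast
    exact (Nat.lt_floor_add_one _).le
  unfold tableWeight
  by_cases hj : j < 24
  · rw [List.getD_eq_getElem _ _ (by simpa using hj)]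
    simpa using h j
  · rw [List.getD_eq_default _ _ (by simpa using hj)]
    refine le_trans ?_ (h 24)
    gcongr ?_ * ?_
    exact pow_le_pow_of_le_one (by norm_num [γ]) (by norm_num [γ]) (by omega)

theorem tableWeight_le (j : ℕ) : (tableWeight j : ℝ) ≤ 10 ^ 6 * γ ^ j + 5 := by
  have h : ∀ j, (intWeight j : ℝ) ≤ 10 ^ 6 * γ ^ j + 1 := fun j => by
    rw [intWeight]
    push_cast
    gcongr
    exact Nat.floor_le (by unfold γ; positivity)
  unfold tableWeight
  by_cases hj : j < 24
  · rw [List.getD_eq_getElem _ _ (by simpa using hj)]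
    have := h j
    simp only [List.getElem_map, List.getElem_range]
    linarith
  · rw [List.getD_eq_default _ _ (by simpa using hj)]
    have h1 := h 24
    have h2 : (10 ^ 6 : ℝ) * γ ^ 24 ≤ 1 := by norm_num [γ]
    have h3 : 0 ≤ (10 ^ 6 : ℝ) * γ ^ j := by unfold γ; positivity
    linarith

theorem lightL_iff (A : List ℕ) (F : List (List ℕ)) : lightL A F = true ↔
    (F.map fun A' => tableWeight (A.length - A'.length)).sum ≤ 10 ^ 6 := by
  simp [lightL, List.length_flatMap]

theorem sum_γ_pow_le_one {A : List ℕ} {F : List (List ℕ)} (h : lightL A F = true) :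
    (F.map fun A' => γ ^ (A.length - A'.length)).sum ≤ 1 := by
  rw [lightL_iff] at h
  have h1 : (10 ^ 6 : ℝ) * (F.map fun A' => γ ^ (A.length - A'.length)).sum ≤
      ((F.map fun A' => tableWeight (A.length - A'.length)).sum : ℕ) := by
    rw [← List.sum_map_mul_left, Nat.cast_list_sum, List.map_map]
    exact List.sum_le_sum fun A' _ => γ_pow_le_tableWeight _
  have h2 : ((F.map fun A' => tableWeight (A.length - A'.length)).sum : ℝ) ≤ 10 ^ 6 := by
    exact_mod_cast h
  push_cast at h1 h2
  linarith

/-- An unchanged set has weight `10 ^ 6 + 1` and fails the test alone: the 1 added in rounding makes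
the search terminate. -/
theorem length_lt_of_lightL {A : List ℕ} {F : List (List ℕ)} (h : lightL A F = true)
    {A' : List ℕ} (hA' : A' ∈ F) : A'.length < A.length := by
  rw [lightL_iff] at h
  by_contra hc
  have h1 : tableWeight (A.length - A'.length) ≤ 10 ^ 6 :=
    (List.single_le_sum (by simp) _ (List.mem_map_of_mem hA')).trans h
  rw [Nat.sub_eq_zero_of_le (by omega)] at h1
  have h2 : tableWeight 0 = 10 ^ 6 + 1 := by
    have : ⌊(10 ^ 6 : ℝ)⌋₊ = 10 ^ 6 := by exact_mod_cast Nat.floor_natCast (R := ℝ) (10 ^ 6)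
    simp [tableWeight, intWeight, this]
  omega

/-- The slack in 0.9995 is 500 units of the table, and at most 32 members with an error of at most 5
each use 160. -/
theorem lightL_of_weight {A : List ℕ} {F : List (List ℕ)} {F₀ : List (Finset ℕ)}
    (hA : A.Nodup) (hF : Lists A F F₀) (hw : weight F₀ ≤ 0.9995 * 1.811 ^ A.toFinset.card)
    (hl : F₀.length ≤ 32) : lightL A F = true := by
  obtain ⟨hs, rfl⟩ := hF
  rw [List.length_map] at hl
  rw [List.toFinset_card_of_nodup hA] at hw
  have h1 : (1.811 : ℝ) ^ A.length * (F.map fun A' => γ ^ (A.length - A'.length)).sum =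
      weight (F.map List.toFinset) := by
    rw [weight, List.map_map, ← List.sum_map_mul_left]
    congr 1
    refine List.map_congr_left fun A' hA' => ?_
    have h2 := (hs A' hA').length_le
    have h3 : (1.811 : ℝ) ^ (A.length - A'.length) * γ ^ (A.length - A'.length) = 1 := by
      rw [← mul_pow]; norm_num [γ]
    rw [Function.comp_apply, List.toFinset_card_of_nodup (hA.sublist (hs A' hA'))]
    conv_lhs => rw [← Nat.add_sub_of_le h2, pow_add]
    rw [Nat.add_sub_of_le h2, mul_assoc, h3, mul_one]
  have h4 : (F.map fun A' => γ ^ (A.length - A'.length)).sum ≤ 0.9995 := by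
    rw [← h1, mul_comm] at hw
    exact le_of_mul_le_mul_right hw (by positivity)
  have h5 : ((F.map fun A' => tableWeight (A.length - A'.length)).sum : ℝ) ≤
      10 ^ 6 * (F.map fun A' => γ ^ (A.length - A'.length)).sum + 5 * F.length := by
    clear hs h1 h4 hw hl
    induction F with
    | nil => simp
    | cons A' F ih =>
      have := tableWeight_le (A.length - A'.length)
      simp only [List.map_cons, List.sum_cons, List.length_cons]
      push_cast at *
      linarith
  rw [lightL_iff]
  have h6 : (F.length : ℝ) ≤ 32 := by exact_mod_cast hl
  have h7 : ((F.map fun A' => tableWeight (A.length - A'.length)).sum : ℝ) ≤ 10 ^ 6 := by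
    linarith
  exact_mod_cast h7

end Correctness

/-! ### The problem in terms of kept clusters -/

section Problem

/-- Under the local condition, the ends of every walk are equal or adjacent, by contracting one edge
at a time. -/
theorem isClusterGraph_iff {V : Type*} (G : SimpleGraph V) :
    IsClusterGraph G ↔ ∀ x y z, G.Adj x y → G.Adj y z → x ≠ z → G.Adj x z := by
  constructor
  · intro h x y z hxy hyz hxz
    refine h (G.connectedComponentMk x) rfl ?_ hxz
    exact SimpleGraph.ConnectedComponent.sound (hxy.reachable.trans hyz.reachable).symm
  · intro h C x hx z hz hxz
    have key : ∀ {a b : V}, G.Walk a b → a = b ∨ G.Adj a b := by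
      intro a b w
      induction w with
      | nil => exact Or.inl rfl
      | @cons a m b ham w ih =>
        rcases ih with rfl | ih
        · exact Or.inr ham
        · by_cases hab : a = b
          · exact Or.inl hab
          · exact Or.inr (h a m b ham ih hab)
    obtain ⟨w⟩ := SimpleGraph.ConnectedComponent.exact
      (((C.mem_supp_iff x).1 hx).trans ((C.mem_supp_iff z).1 hz).symm)
    exact (key w).resolve_left hxz

theorem cluster_iff {V : Type*} [DecidableEq V] {G : SimpleGraph V} {B : Finset V} :
    Cluster G B ↔ ∀ x ∈ B, ∀ y ∈ B, ∀ z ∈ B, G.Adj x y → G.Adj y z → x ≠ z → G.Adj x z := by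
  constructor
  · intro h x hx y hy z hz hxy hyz hxz
    by_contra hc
    exact h x hx y hy z hz (Or.inl ⟨hxy, hyz, hc, hxz⟩)
  · rintro h x hx y hy z hz (hp | hp | hp)
    · exact hp.2.2.1 (h x hx y hy z hz hp.1 hp.2.1 hp.2.2.2)
    · exact hp.2.2.1 (h y hy z hz x hx hp.1 hp.2.1 hp.2.2.2)
    · exact hp.2.2.1 (h z hz x hx y hy hp.1 hp.2.1 hp.2.2.2)

/-- `B` is the set that remains. A budget above `n` is of no use, which justifies the cut to `min n
k`. -/
theorem clusterVertexDeletion_iff {n : ℕ} (G : SimpleGraph (Fin n)) (k : ℕ) :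
    ClusterVertexDeletion G k ↔ ∃ B ⊆ Finset.range n, Cluster (G.map Fin.valEmbedding) B ∧
      n ≤ B.card + min n k := by
  have hdel : ∀ S : Finset (Fin n), IsClusterDeletionSet G (S : Set (Fin n)) ↔
      Cluster (G.map Fin.valEmbedding) (Sᶜ.map Fin.valEmbedding) := by
    intro S
    rw [IsClusterDeletionSet, isClusterGraph_iff, cluster_iff]
    simp only [Finset.forall_mem_map, SimpleGraph.map_adj_apply, SimpleGraph.comap_adj,
      Subtype.forall, Function.Embedding.subtype_apply, Fin.valEmbedding.injective.ne_iff,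
      Finset.mem_compl, Set.mem_compl_iff, Finset.mem_coe, ne_eq, Subtype.mk.injEq]
  constructor
  · rintro ⟨S, hS, h⟩
    refine ⟨_, ?_, (hdel S).1 h, ?_⟩
    · intro s hs
      obtain ⟨i, -, rfl⟩ := Finset.mem_map.1 hs
      simp
    · rw [Finset.card_map, Finset.card_compl, Fintype.card_fin]
      have := S.card_le_univ
      rw [Fintype.card_fin] at this
      omega
  · rintro ⟨B, hBn, hB, hc⟩
    have hBe : ((Finset.univ.filter fun i : Fin n => (i : ℕ) ∉ B)ᶜ).map Fin.valEmbedding = B := by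
      ext s
      simp only [Finset.mem_map, Finset.mem_compl, Finset.mem_filter, Finset.mem_univ, true_and,
        not_not]
      exact ⟨by rintro ⟨i, hi, rfl⟩; exact hi,
        fun hs => ⟨⟨s, by simpa using hBn hs⟩, hs, rfl⟩⟩
    refine ⟨_, ?_, (hdel _).2 (hBe.symm ▸ hB)⟩
    have h1 := congrArg Finset.card hBe
    have h2 := Finset.card_le_univ (Finset.univ.filter fun i : Fin n => (i : ℕ) ∉ B)
    rw [Finset.card_map, Finset.card_compl, Fintype.card_fin] at h1
    rw [Fintype.card_fin] at h2
    omega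

end Problem

/-! ### Correctness and running time of the program -/

section Run

open Classical in
/-- The adjacency matrix as a list of rows. -/
noncomputable def matrix {n : ℕ} (G : SimpleGraph (Fin n)) : List (List Bool) :=
  (List.finRange n).map fun i => (List.finRange n).map fun j => decide (G.Adj i j)

open Enc (enc)

theorem enc_matrix {n : ℕ} (G : SimpleGraph (Fin n)) : enc (matrix G) = encodeGraph G := by
  simp only [enc, matrix, encodeGraph, List.map_map, Function.comp_def]

theorem adjM_matrix {n : ℕ} (G : SimpleGraph (Fin n)) (i j : ℕ) :
    adjM (matrix G) i j = true ↔ (G.map Fin.valEmbedding).Adj i j := by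
  rw [SimpleGraph.map_adj]
  unfold adjM matrix
  by_cases hi : i < n
  · by_cases hj : j < n
    · simp only [List.getD_eq_getElem?_getD]
      simp [hi, hj]
      exact ⟨fun h => ⟨⟨i, hi⟩, ⟨j, hj⟩, h, rfl, rfl⟩, by rintro ⟨a, b, h, rfl, rfl⟩; exact h⟩
    · simp only [List.getD_eq_getElem?_getD]
      simp [hi, hj]
      rintro a b - - rfl
      exact hj b.2
  · simp only [List.getD_eq_getElem?_getD]
    simp [hi]
    rintro a b - rfl
    exact absurd a.2 hi

theorem length_matrix {n : ℕ} (G : SimpleGraph (Fin n)) : (matrix G).length = n := by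
  simp [matrix]

theorem esize_nat (n : ℕ) : esize n = 2 * n + 1 := by
  induction n with
  | zero => rfl
  | succ n ih =>
    have : esize (n + 1) = 1 + esize n + 1 := rfl
    omega

theorem esize_matrix_le {n : ℕ} (G : SimpleGraph (Fin n)) :
    esize (matrix G) ≤ n * (n * 4 + 2) + 1 := by
  refine (esize_le_of_forall (N := n * 4 + 1) fun r hr => ?_).trans ?_
  · obtain ⟨i, -, rfl⟩ := List.mem_map.1 hr
    refine (esize_le_of_forall (N := 3) fun b _ => ?_).trans (by simp)
    cases b <;> simp [esize, enc, Data.ofBool, Data.size]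
  · rw [length_matrix]

/-- The list of the vertices of a graph with the given matrix. -/
def vertexList (M : List (List Bool)) : List ℕ := M.foldr (fun _ l => l.length :: l) []

theorem vertexList_eq (M : List (List Bool)) : vertexList M = (List.range M.length).reverse := by
  unfold vertexList
  induction M with
  | nil => rfl
  | cons r M ih => rw [List.foldr_cons, ih, List.length_cons, List.range_succ]; simp

theorem esize_vertexSet_le {n : ℕ} {A : List ℕ} (hA : A.Nodup) (hn : ∀ a ∈ A, a < n) :
    esize A ≤ n * (2 * n + 2) + 1 := by
  have h1 : A.length ≤ n := by
    rw [← List.toFinset_card_of_nodup hA]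
    refine (Finset.card_le_card fun a ha => ?_).trans (Finset.card_range n).le
    simpa using hn a (by simpa using ha)
  refine (esize_le_of_forall (N := 2 * n + 1) fun a ha => ?_).trans ?_
  · have := hn a ha
    rw [esize_nat]
    omega
  · exact Nat.add_le_add_right (Nat.mul_le_mul_right _ h1) _

theorem PolyTime.init :
    PolyTime (fun y : List (List Bool) × ℕ => (y.1, vertexList y.1, y.2)) := by
  refine .pair PolyTime.id.fst (.pair ?_ .last)
  refine PolyTime.foldr (s := fun _ _ l => l.length :: l) PolyTime.id.fst (.const [])
    (.cons PolyTime.id.snd.snd.length PolyTime.id.snd.snd)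
    (Polynomial.X * (2 * Polynomial.X + 2) + 1) fun x l' hl' => ?_
  have h1 : l'.length ≤ esize x := by
    have := hl'.length_le
    have := length_le_esize x.1
    have := esize_pair x
    omega
  have h2 : esize (vertexList l') ≤ esize x * (2 * esize x + 2) + 1 := by
    refine esize_vertexSet_le ?_ ?_
    · rw [vertexList_eq]
      exact List.nodup_reverse.2 List.nodup_range
    · intro a ha
      rw [vertexList_eq, List.mem_reverse, List.mem_range] at ha
      omega
  simpa [vertexList] using h2

variable {M : List (List Bool)} {G : SimpleGraph ℕ} [DecidableRel G.Adj]

/-- The vertices of `A` can be made a cluster graph by the deletion of at most `k` of them. -/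
def Solvable (G : SimpleGraph ℕ) (A : List ℕ) (k : ℕ) : Prop :=
  ∃ B ⊆ A.toFinset, Cluster G B ∧ A.length ≤ B.card + k

/-- The family from `good_of_not_cluster` only shows that the filtered list is not empty, so the
default of `headD` is never used. The family taken may be another, but any light family of a rule
serves. -/
theorem step_of_not_cluster (hM : ∀ i j, adjM M i j = true ↔ G.Adj i j) {A : List ℕ}
    (hA : A.Nodup) (hC : ¬ Cluster G A.toFinset) :
    ∃ F F₀, Lists A F F₀ ∧ RuleFamily G 4 A.toFinset F₀ ∧ lightL A F = true ∧ ∀ k,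
      step (M, A, k) = (false, (F.filter fun A' => decide (A.length - A'.length ≤ k)).map
        fun A' => (M, A', k - (A.length - A'.length))) := by
  obtain ⟨F₁, h1, h2⟩ := good_of_not_cluster hC
  obtain ⟨F₂, h3, h4⟩ := exists_mem_of_ruleFamily hM hA h1
  have h5 := lightL_of_weight hA h4 h2 h1.length_le
  obtain ⟨F, l, hl⟩ := List.exists_cons_of_ne_nil
    (List.ne_nil_of_mem (List.mem_filter.2 ⟨h3, h5⟩))
  have hF : F ∈ (ruleFamilies M 4 A).filter fun F => lightL A F := by rw [hl]; simp
  rw [List.mem_filter] at hF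
  obtain ⟨F₀, h6, h7⟩ := exists_ruleFamily_of_mem hM hA hF.1
  refine ⟨F, F₀, h6, h7, hF.2, fun k => ?_⟩
  rw [← clusterL_iff hM] at hC
  rw [step, if_neg hC]
  simp only [hl, List.headD_cons]

theorem mem_step (hM : ∀ i j, adjM M i j = true ↔ G.Adj i j) {A : List ℕ} (hA : A.Nodup) {k : ℕ}
    {s : List (List Bool) × List ℕ × ℕ} (hs : s ∈ (step (M, A, k)).2) :
    s.1 = M ∧ s.2.1.Sublist A ∧ s.2.2 < k := by
  by_cases hC : Cluster G A.toFinset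
  · rw [step, if_pos ((clusterL_iff hM A).2 hC)] at hs
    simp at hs
  · obtain ⟨F, F₀, h1, -, h2, h3⟩ := step_of_not_cluster hM hA hC
    rw [h3] at hs
    obtain ⟨A', hA', rfl⟩ := List.mem_map.1 hs
    rw [List.mem_filter, decide_eq_true_eq] at hA'
    have := length_lt_of_lightL h2 hA'.1
    exact ⟨rfl, h1.1 A' hA'.1, by dsimp only; omega⟩

/-- Members that exceed the budget are filtered out, so the subtraction is exact and each remaining
term is `1.811 ^ k` multiplied by its relative weight. -/
theorem sum_step_le (hM : ∀ i j, adjM M i j = true ↔ G.Adj i j) {A : List ℕ} (hA : A.Nodup)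
    (k : ℕ) : ((step (M, A, k)).2.map fun s => (1.811 : ℝ) ^ s.2.2).sum ≤ 1.811 ^ k := by
  by_cases hC : Cluster G A.toFinset
  · rw [step, if_pos ((clusterL_iff hM A).2 hC)]
    simpa using pow_nonneg (by norm_num) k
  · obtain ⟨F, F₀, -, -, h2, h3⟩ := step_of_not_cluster hM hA hC
    rw [h3]
    have h4 := sum_γ_pow_le_one h2
    have hγ : 0 ≤ γ := by unfold γ; positivity
    have h5 : ((F.filter fun A' => decide (A.length - A'.length ≤ k)).map
        fun A' => γ ^ (A.length - A'.length)).sum ≤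
        (F.map fun A' => γ ^ (A.length - A'.length)).sum := by
      refine List.Sublist.sum_le_sum (List.filter_sublist.map _) fun x hx => ?_
      obtain ⟨A', -, rfl⟩ := List.mem_map.1 hx
      positivity
    have h6 : (1.811 : ℝ) ^ k * ((F.filter fun A' => decide (A.length - A'.length ≤ k)).map
        fun A' => γ ^ (A.length - A'.length)).sum ≤ 1.811 ^ k :=
      mul_le_of_le_one_right (by positivity) (h5.trans h4)
    refine le_trans (le_of_eq ?_) h6
    rw [← List.sum_map_mul_left, List.map_map]
    refine congrArg List.sum (List.map_congr_left fun A' hA' => ?_)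
    rw [List.mem_filter, decide_eq_true_eq] at hA'
    have h7 : (1.811 : ℝ) ^ (A.length - A'.length) * γ ^ (A.length - A'.length) = 1 := by
      rw [← mul_pow]; norm_num [γ]
    obtain ⟨m, rfl⟩ := Nat.exists_eq_add_of_le hA'.2
    simp only [Function.comp_apply, Nat.add_sub_cancel_left]
    rw [pow_add, mul_right_comm, h7, one_mul]

/-- One direction is the covering property. For the other, a cluster in a subset is one in `A`, and
the budget was lowered by exactly the number of vertices removed. -/
theorem solvable_iff_step (hM : ∀ i j, adjM M i j = true ↔ G.Adj i j) {A : List ℕ}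
    (hA : A.Nodup) (k : ℕ) : Solvable G A k ↔
      (step (M, A, k)).1 = true ∨ ∃ s ∈ (step (M, A, k)).2, Solvable G s.2.1 s.2.2 := by
  by_cases hC : Cluster G A.toFinset
  · rw [step, if_pos ((clusterL_iff hM A).2 hC)]
    simp only [true_or, iff_true]
    exact ⟨_, subset_rfl, hC, by rw [List.toFinset_card_of_nodup hA]; omega⟩
  · obtain ⟨F, F₀, h1, h2, h3, h4⟩ := step_of_not_cluster hM hA hC
    rw [h4]
    simp only [Bool.false_eq_true, false_or]
    constructor
    · rintro ⟨B, hBA, hB, hk⟩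
      obtain ⟨S, hS, B', hB'S, hB', hc⟩ := h2.covers hBA hB
      rw [← h1.2] at hS
      obtain ⟨A', hA', rfl⟩ := List.mem_map.1 hS
      have h5 := Finset.card_le_card hB'S
      rw [List.toFinset_card_of_nodup (hA.sublist (h1.1 A' hA'))] at h5
      have h6 := (h1.1 A' hA').length_le
      refine ⟨_, List.mem_map_of_mem (List.mem_filter.2 ⟨hA', ?_⟩), B', hB'S, hB', ?_⟩
      · rw [decide_eq_true_eq]
        omega
      · dsimp only
        omega
    · rintro ⟨s, hs, B, hBA, hB, hk⟩
      obtain ⟨A', hA', rfl⟩ := List.mem_map.1 hs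
      rw [List.mem_filter, decide_eq_true_eq] at hA'
      have hsub := h1.1 A' hA'.1
      refine ⟨B, hBA.trans fun a ha => ?_, hB, ?_⟩
      · rw [List.mem_toFinset] at ha ⊢
        exact hsub.subset ha
      · dsimp only at hk
        omega

/-- A bound for the size of the instances that arise from a graph on `n` vertices. -/
noncomputable def sizeBound : Polynomial ℕ := 6 * Polynomial.X ^ 2 + 6 * Polynomial.X + 6

theorem eval_sizeBound (n : ℕ) : sizeBound.eval n = 6 * n ^ 2 + 6 * n + 6 := by simp [sizeBound]

open Classical in
theorem exists_eval_search {P : Program} {i : ℕ} {p : Polynomial ℕ} (hstep : Computes P i step p)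
    {f g : ℕ} (hf : P[f]? = some (searchExpr i g)) (hg : P[g]? = some (anyExpr f g)) {n : ℕ}
    (G : SimpleGraph (Fin n)) {k : ℕ} (hk : k ≤ n) :
    ∃ t, Eval P [enc (matrix G, vertexList (matrix G), k)] (searchExpr i g)
        (.ofBool (decide (Solvable (G.map Fin.valEmbedding) (vertexList (matrix G)) k))) t ∧
      (t : ℝ) ≤ (11 * p.eval (sizeBound.eval n) + 40 : ℕ) * ((k + 1) * 1.811 ^ k) := by
  have hM := adjM_matrix G
  refine Eval.search (c := 1.811) hstep hf hg (R := fun s => s.1 = matrix G ∧ s.2.1.Nodup ∧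
    (∀ a ∈ s.2.1, a < n) ∧ s.2.2 ≤ n) (μ := fun s => s.2.2)
    (ans := fun s => decide (Solvable (G.map Fin.valEmbedding) s.2.1 s.2.2)) (by norm_num)
    ?_ ?_ ?_ ?_ ?_ _ ?_
  · rintro ⟨_, A, m⟩ ⟨rfl, h1, h2, h3⟩
    have h4 := esize_matrix_le G
    have h5 := esize_vertexSet_le h1 h2
    have h6 := esize_nat m
    dsimp only at h3
    rw [esize_pair, esize_pair, eval_sizeBound]
    dsimp only
    nlinarith
  · rintro ⟨_, A, m⟩ ⟨rfl, h1, h2, h3⟩ s hs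
    obtain ⟨h4, h5, h6⟩ := mem_step hM h1 hs
    exact ⟨h4, h1.sublist h5, fun a ha => h2 a (h5.subset ha), h6.le.trans h3⟩
  · rintro ⟨_, A, m⟩ ⟨rfl, h1, h2, h3⟩ s hs
    exact (mem_step hM h1 hs).2.2
  · rintro ⟨_, A, m⟩ ⟨rfl, h1, h2, h3⟩
    exact sum_step_le hM h1 m
  · rintro ⟨_, A, m⟩ ⟨rfl, h1, h2, h3⟩
    rw [Bool.eq_iff_iff]
    simpa using solvable_iff_step hM h1 m
  · refine ⟨rfl, ?_, ?_, hk⟩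
    · rw [vertexList_eq]
      exact List.nodup_reverse.2 List.nodup_range
    · intro a ha
      simpa [vertexList_eq, length_matrix] using ha

/-- The main function: the parameter is reduced to the number of vertices, and the search
started. -/
def mainExpr (i : ℕ) : Expr :=
  .split (.var 0) .nil (.call 2 (.call i (.cons (.var 0) (.call 1 (.var 2)))))

/-- Cutting the budget to `min n k` first makes all sizes, and the number of search levels,
polynomial in `n` alone. -/
theorem exists_program : ∃ (P : Program) (p : Polynomial ℕ),
    ∀ (n k : ℕ) (G : SimpleGraph (Fin n)), ∃ (answer : Bool) (t : ℕ),
      P.HaltsWith (encodeInstance G k) (Data.ofBool answer) t ∧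
      (answer = true ↔ ClusterVertexDeletion G k) ∧
      (t : ℝ) ≤ (1.811 : ℝ) ^ k * ((p.eval n : ℕ) : ℝ) := by
  classical
  obtain ⟨P, i, j, -, pi, pj, -, hi, hj, -, hP⟩ := exists_link PolyTime.init PolyTime.step
    (PolyTime.id (α := Unit)) 4
    (fun i j _ => [mainExpr i, minExpr 1, searchExpr j 3, anyExpr 2 3]) (fun _ _ _ => rfl)
  refine ⟨P, 20 * Polynomial.X + 40 + pi.comp sizeBound +
    (11 * pj.comp sizeBound + 40) * (Polynomial.X + 1), fun n k G => ?_⟩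
  obtain ⟨t₁, ht₁, h₁⟩ := Eval.min (P := P) (hP 1 _ rfl) (matrix G) k
  rw [length_matrix] at ht₁ h₁
  obtain ⟨t₂, h₂, ht₂⟩ := exists_eval_search hj (hP 2 _ rfl) (hP 3 _ rfl) G (min_le_left n k)
  have h₃ : Eval P [enc (matrix G), .ofNat k, .cons (enc (matrix G)) (.ofNat k)]
      (.cons (.var 0) (.call 1 (.var 2))) (enc (matrix G, min n k)) _ :=
    .cons (.var rfl) (.call (.var rfl) (hP 1 _ rfl) h₁)
  obtain ⟨t₄, h₄, ht₄⟩ := hi.call h₃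
  have h₅ := Eval.call (ρ := [_]) (e := .var 0) (.var rfl) (hP 0 _ rfl)
    (.splitCons (.var rfl) (.call h₄ (hP 2 _ rfl) h₂))
  rw [enc_matrix] at h₅
  refine ⟨_, _, h₅, ?_, ?_⟩
  · have h6 : (List.range n).reverse.toFinset = Finset.range n := by ext; simp
    rw [decide_eq_true_eq, clusterVertexDeletion_iff, Solvable, vertexList_eq, length_matrix, h6,
      List.length_reverse, List.length_range]
  · have h5 : esize (matrix G, min n k) ≤ sizeBound.eval n := by
      have h4 := esize_matrix_le G
      have h6 := esize_nat (min n k)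
      have h7 := min_le_left n k
      rw [esize_pair, eval_sizeBound]
      dsimp only
      nlinarith
    have h6 := eval_mono pi h5
    have h7 : (1 : ℝ) ≤ 1.811 ^ k := one_le_pow₀ (by norm_num)
    have h8 : (1.811 : ℝ) ^ min n k ≤ 1.811 ^ k :=
      pow_le_pow_right₀ (by norm_num) (min_le_right n k)
    have h9 : ((min n k : ℕ) : ℝ) ≤ n := by exact_mod_cast min_le_left n k
    have h10 : (t₂ : ℝ) ≤ 1.811 ^ k * ((11 * pj.eval (sizeBound.eval n) + 40 : ℕ) * (n + 1)) := by
      refine ht₂.trans ?_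
      rw [mul_comm ((1.811 : ℝ) ^ k), mul_assoc]
      gcongr
    have h11 : (t₄ + 5 : ℝ) ≤ 20 * n + 40 + (pi.eval (sizeBound.eval n) : ℕ) := by
      have : t₄ + 5 ≤ 20 * n + 40 + pi.eval (sizeBound.eval n) := by omega
      exact_mod_cast this
    -- The polynomial time of the preparation is absorbed because `1 ≤ 1.811 ^ k`.
    have h12 : (20 * n + 40 + (pi.eval (sizeBound.eval n) : ℕ) : ℝ) ≤
        1.811 ^ k * (20 * n + 40 + (pi.eval (sizeBound.eval n) : ℕ)) :=
      le_mul_of_one_le_left (by positivity) h7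
    simp only [Polynomial.eval_add, Polynomial.eval_mul, Polynomial.eval_comp, Polynomial.eval_X,
      Polynomial.eval_one, Polynomial.eval_ofNat]
    push_cast at *
    linarith

end Run

end ClusterVD

/-- Cluster Vertex Deletion can be solved in `O*(1.811 ^ k)` time: one program decides every
instance `(G, k)` with `G` a graph on `n` vertices in at most `1.811 ^ k * p n` steps, for a
polynomial `p`. -/
theorem mainTheorem1 :
    ∃ (P : ClusterVD.Program) (p : Polynomial ℕ),
      ∀ (n k : ℕ) (G : SimpleGraph (Fin n)),
        ∃ (answer : Bool) (t : ℕ),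
          P.HaltsWith (ClusterVD.encodeInstance G k) (ClusterVD.Data.ofBool answer) t ∧
          (answer = true ↔ ClusterVD.ClusterVertexDeletion G k) ∧
          (t : ℝ) ≤ (1.811 : ℝ) ^ k * ((p.eval n : ℕ) : ℝ) :=
  ClusterVD.exists_program
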